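/- **Model.** Let $1\le M<K$ and $T\ge 1$. In each round $t$ every agent $m\in[M]$ pulls an arm of $[K]$; an agent that shares its arm with another agent gets reward $0$, otherwise agent $m$ on arm $k$ gets $X_{m,k}(t)\sim\mathrm{Bernoulli}(\mu_{m,k})$, the matrices $X(t)$ being independent over $t$. In addition an agent may ask for a hint, that is, observe $X_{m,k'}(t)$ for an arm $k'$ of its choice without cost. For a map $G:[M]\to[K]$ and a matrix $w$ put $U(G;w)=\sum_m w_{m,G(m)}\mathbf 1\{G(m')\ne G(m)\ \forall m'\neq m\}$. Assume that $U(\cdot;\mu)$ has a unique maximizer $G^*$ and let $\Delta_{\min}=\min_{G\ne G^*}\big(U(G^*;\mu)-U(G;\mu)\big)$. **Algorithm EBHD-ETC** (it is not given $\Delta_{\min}$). Let $\varepsilon^\rho=\sqrt{\log(2/\eta)/\rho}$ with $\eta=\sqrt{2/(MT^2)}$ (and $\varepsilon^0=\infty$), $\tilde\mu^0=0$, $\mathcal C^0=[M]\times[K]$, and let $\mathrm{Hungarian}(w)$ denote a maximum-weight matching, ties being broken by a fixed rule. The agents know their ranks $1,\dots,M$; rank assignment has taken the first $\tau\le T$ rounds.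 For $\rho=0,1,2,\dots$, as long as $|\mathcal C^\rho|>M$: * *Exploration* ($K$ rounds). All agents pull $G^\rho=\mathrm{Hungarian}(\tilde\mu^\rho)$, and in round $t$ they ask for hints along the covering matching $R_{(t\bmod K)+1}$, where $R_i$ joins agent $m$ to arm $m+i-1$ (modulo $K$). Each agent averages all its observations (pulls and hints) of an arm in these phases to the empirical mean $\hat\mu_{m,k}$. * *Communication*. Let $b_\rho=\lceil 1+\tfrac12\log_2\rho\rceil$, let $\tilde\mu^{\rho+1}_{m,k}$ be $\hat\mu_{m,k}$ rounded up to a multiple of $2^{-b_{\rho+1}}$, and let $\tilde\delta_{m,k}=\tilde\mu^{\rho+1}_{m,k}-\tilde\mu^{\rho}_{m,k}$. For each arm $k$, each agent $m$ in turn sends to each other agent $m'$ the bit string of the integer $2^{b_{\rho+1}}\tilde\delta_{m,k}$ (a sign bit and the binary digits of the absolute value without leading zeros), one bit per round: for a bit $1$ agent $m$ pulls the arm $G^\rho(m')$, for a bit $0$ its own arm $G^\rho(m)$; all other agents pull their arms of $G^\rho$. Afterwards all agents know $\tilde\mu^{\rho+1}$. * *Elimination*. $\mathcal C^{\rho+1}$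 consists of the edges $(m,k)\in\mathcal C^\rho$ with $U(G^\rho;\tilde\mu^\rho)-U(G^\rho_{(m,k)};\tilde\mu^\rho)\le 4M\varepsilon^\rho$, where $G^\rho_{(m,k)}=\{(m,k)\}\cup\mathrm{Hungarian}(\tilde\mu^\rho_{-m,-k})$ and $\tilde\mu^\rho_{-m,-k}$ is $\tilde\mu^\rho$ without row $m$ and column $k$. When $|\mathcal C^\rho|\le M$, the agents pull $\mathrm{Hungarian}(\tilde\mu^\rho)$ in all remaining rounds (*exploitation*). The algorithm stops after round $T$, whatever the phase. Let $R^{\rm exp}(T)$ be the expected sum of $U(G^*;\mu)-U(G(t);\mu)$, $G(t)$ being the arms pulled in round $t$, over the rounds of the exploration and exploitation phases, $R^{\rm com}(T)$ the same sum over the rounds of the communication phases, and $L(T)$ the expected total number of hints queried by all agents. **Theorem.** There is an absolute constant $C$ such that for all $M,K,T,\tau,\mu$ as above, 1. $R^{\rm exp}(T)\le C\,\dfrac{M^3K^2}{\Delta_{\min}^2}$; in particular $R^{\rm exp}(T)\in O(M^3K^2)$, uniformly in $T$, for fixed gap $\Delta_{\min}$; 2. $L(T)\le C\,\dfrac{M^3K\log(T\sqrt{2M})}{\Delta_{\min}^2}$;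 3. $R^{\rm com}(T)\le C\,\dfrac{M^4K\log(T\sqrt{2M})}{\Delta_{\min}^2}$. -/

import Mathlib

namespace HMA2B

/-! ### The hinted heterogeneous multi-agent multi-armed bandit -/

/-- Arm-pulling graphs: every agent is joined to exactly one arm; several agents may choose the
same arm (a collision). -/
abbrev PullGraph (M K : ℕ) := Fin M → Fin K

/-- The matrices of realizations `X_{m,k}(t)` of the Bernoulli rewards, one for each round `t`. -/
abbrev RewardTable (M K : ℕ) := ℕ → Fin M → Fin K → Bool

/-- Agent `m` shares its arm with no other agent. -/
def NoCollision {M K : ℕ} (G : PullGraph M K) (m : Fin M) : Prop :=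
  ∀ m', m' ≠ m → G m' ≠ G m

open Classical in
/-- The utility `U(G; w)`: colliding agents contribute `0`. -/
noncomputable def utility {M K : ℕ} (G : PullGraph M K) (w : Fin M → Fin K → ℝ) : ℝ :=
  ∑ m, if NoCollision G m then w m (G m) else 0

open Classical in
/-- The reward (`0` or `1`) of agent `m` when `G` is pulled and the realizations are `x`. -/
noncomputable def reward {M K : ℕ} (x : Fin M → Fin K → Bool) (G : PullGraph M K) (m : Fin M) :
    ℕ :=
  if NoCollision G m then (x m (G m)).toNat else 0

/-- `Gstar` is the unique graph of largest utility. -/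
def IsUniqueOptimal {M K : ℕ} (μ : Fin M → Fin K → ℝ) (Gstar : PullGraph M K) : Prop :=
  ∀ G : PullGraph M K, G ≠ Gstar → utility G μ < utility Gstar μ

/-- The minimum gap `min_{G ≠ G*} U(G*; μ) - U(G; μ)`. -/
noncomputable def minGap {M K : ℕ} (μ : Fin M → Fin K → ℝ) (Gstar : PullGraph M K) : ℝ :=
  ⨅ G : {G : PullGraph M K // G ≠ Gstar}, (utility Gstar μ - utility G.1 μ)

/-! ### Maximum-weight matchings -/

theorem exists_maxWeightMatching {α β : Type} [Fintype α] [Fintype β]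
    (h : Fintype.card α ≤ Fintype.card β) (w : α → β → ℝ) :
    ∃ f : α ↪ β, ∀ g : α ↪ β, ∑ a, w a (g a) ≤ ∑ a, w a (f a) := by
  classical
  have : Nonempty (α ↪ β) := Function.Embedding.nonempty_of_card_le h
  exact Finite.exists_max fun f : α ↪ β => ∑ a, w a (f a)

/-- The output of the Hungarian algorithm: a matching of maximum weight.  Ties are broken by a
fixed rule, the same for all agents. -/
noncomputable def hungarian {α β : Type} [Fintype α] [Fintype β]
    (h : Fintype.card α ≤ Fintype.card β) (w : α → β → ℝ) : α ↪ β :=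
  Classical.choose (exists_maxWeightMatching h w)

theorem card_le_of_lt {M K : ℕ} (h : M < K) :
    Fintype.card (Fin M) ≤ Fintype.card (Fin K) := by
  simpa using h.le

theorem card_remove_le {M K : ℕ} (h : M < K) (m : Fin M) (k : Fin K) :
    Fintype.card {m' : Fin M // m' ≠ m} ≤ Fintype.card {k' : Fin K // k' ≠ k} := by
  simp only [ne_eq, Fintype.card_subtype_compl, Fintype.card_fin, Fintype.card_unique]
  omega

/-- The matching `Hungarian(w)` of all agents. -/
noncomputable def bestMatching {M K : ℕ} (h : M < K) (w : Fin M → Fin K → ℝ) : PullGraph M K :=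
  hungarian (card_le_of_lt h) w

/-- The matching `{(m, k)} ∪ Hungarian(w_{-m,-k})`: the edge `(m, k)` together with a
maximum-weight matching of the matrix with row `m` and column `k` removed. -/
noncomputable def bestMatchingThrough {M K : ℕ} (h : M < K) (w : Fin M → Fin K → ℝ)
    (m : Fin M) (k : Fin K) : PullGraph M K :=
  fun m' =>
    if hm : m' = m then k
    else (hungarian (card_remove_le h m k)
      (fun (a : {a : Fin M // a ≠ m}) (b : {b : Fin K // b ≠ k}) => w a.1 b.1) ⟨m', hm⟩).1

/-! ### The algorithm EBHD-ETC -/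

/-- `η = √(2 / (M T²))`. -/
noncomputable def etaParam (M T : ℕ) : ℝ := Real.sqrt (2 / ((M : ℝ) * (T : ℝ) ^ 2))

/-- `ε^ρ = √(log (2 / η) / ρ)`, used for `ρ ≥ 1` only (`ε^0 = ∞`). -/
noncomputable def epsParam (M T ρ : ℕ) : ℝ :=
  Real.sqrt (Real.log (2 / etaParam M T) / (ρ : ℝ))

/-- The precision `⌈1 + (log₂ ρ) / 2⌉`, in bits, of the statistics shared before epoch `ρ`. -/
noncomputable def precision (ρ : ℕ) : ℕ := ⌈1 + Real.logb 2 (ρ : ℝ) / 2⌉₊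

/-- Rounding `y` up to a multiple of `2 ^ (-precision ρ)`. -/
noncomputable def quantize (ρ : ℕ) (y : ℝ) : ℝ :=
  (⌈y * 2 ^ precision ρ⌉ : ℝ) / 2 ^ precision ρ

/-- A signed integer as a string of bits: a sign bit (`true` for negative numbers), followed by the
binary digits of the absolute value, the most significant digit first and without leading zeros. -/
def bitString (d : ℤ) : List Bool := decide (d < 0) :: (Nat.bits d.natAbs).reverse

/-- One round of a communication phase: `sender` transmits `bit` to `receiver`. -/
structure Transmission (M : ℕ) where
  sender : Fin M
  receiver : Fin M
  bit : Bool

/-- What the next round is used for. -/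
inductive Phase (M : ℕ) where
  /-- exploration; `j` of the `K` rounds of the current epoch are already over -/
  | explore (j : ℕ)
  /-- communication; the transmissions that are still to be made, one per round -/
  | communicate (queue : List (Transmission M))
  /-- exploitation -/
  | exploit

/-- The state of the algorithm before a round. -/
structure State (M K : ℕ) where
  /-- the index `ρ` of the current epoch -/
  epoch : ℕ
  /-- the sum of all observations (by pulls and hints) of each edge -/
  sum : Fin M → Fin K → ℕ
  /-- the number of all observations (by pulls and hints) of each edge -/
  count : Fin M → Fin K → ℕ
  /-- the quantized statistics `μ̃^ρ` that all agents know -/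
  shared : Fin M → Fin K → ℝ
  /-- the set `𝒞^ρ` of active edges -/
  active : Finset (Fin M × Fin K)
  phase : Phase M

namespace State

variable {M K : ℕ}

/-- The empirical mean `μ̂` of an edge. -/
noncomputable def empMean (s : State M K) (m : Fin M) (k : Fin K) : ℝ :=
  (s.sum m k : ℝ) / (s.count m k : ℝ)

/-- The next quantized statistics `μ̃^{ρ+1}`, computed from the current empirical means. -/
noncomputable def nextShared (s : State M K) (m : Fin M) (k : Fin K) : ℝ :=
  quantize (s.epoch + 1) (s.empMean m k)

/-- The difference `δ̃^{ρ+1} = μ̃^{ρ+1} - μ̃^ρ`, in units of the last shared binary digit.  (The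
product is an integer, as the precision does not decrease with `ρ`.) -/
noncomputable def diffUnits (s : State M K) (m : Fin M) (k : Fin K) : ℤ :=
  ⌊(s.nextShared m k - s.shared m k) * 2 ^ precision (s.epoch + 1)⌋

/-- The transmissions of a communication phase: for each arm `k`, the agents take turns to send
their bit string of `δ̃_{m,k}^{ρ+1}` to each of the other agents. -/
noncomputable def messages (s : State M K) : List (Transmission M) :=
  (List.finRange K).flatMap fun k =>
    (List.finRange M).flatMap fun m =>
      ((List.finRange M).filter fun m' => m' ≠ m).flatMap fun m' =>
        (bitString (s.diffUnits m k)).map fun b => ⟨m, m', b⟩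

/-- The matching `Hungarian(μ̃^ρ)`.  It is `G^ρ` during epoch `ρ` and the communication phase
after it, and it is `G'*` during exploitation. -/
noncomputable def matching (h : M < K) (s : State M K) : PullGraph M K :=
  bestMatching h s.shared

/-- The arms that are pulled in the next round.  To send the bit `1`, the sender pulls the arm of
the receiver; all other agents keep to their arms. -/
noncomputable def pulls (h : M < K) (s : State M K) : PullGraph M K :=
  match s.phase with
  | .communicate (tr :: _) =>
      if tr.bit then Function.update (s.matching h) tr.sender (s.matching h tr.receiver)
      else s.matching h
  | _ => s.matching h

open Classical in
/-- The active edges `𝒞^{ρ+1}`: those edges `(m, k)` of `𝒞^ρ` that satisfy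
`U(G^ρ; μ̃^ρ) - U(G^ρ_{(m,k)}; μ̃^ρ) ≤ 4 M ε^ρ`. -/
noncomputable def nextActive (h : M < K) (T : ℕ) (s : State M K) : Finset (Fin M × Fin K) :=
  s.active.filter fun e =>
    s.epoch = 0 ∨
      utility (s.matching h) s.shared - utility (bestMatchingThrough h s.shared e.1 e.2) s.shared
        ≤ 4 * (M : ℝ) * epsParam M T s.epoch

/-- The end of epoch `ρ` and of the communication phase after it. -/
noncomputable def nextEpoch (h : M < K) (T : ℕ) (s : State M K) : State M K where
  epoch := s.epoch + 1
  sum := s.sum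
  count := s.count
  shared := s.nextShared
  active := s.nextActive h T
  phase := if M < (s.nextActive h T).card then .explore 0 else .exploit

/-- Communication goes on with the transmissions in `queue`, or ends if there are none. -/
noncomputable def continueComm (h : M < K) (T : ℕ) (s : State M K)
    (queue : List (Transmission M)) : State M K :=
  match queue with
  | [] => s.nextEpoch h T
  | _ :: _ => { s with phase := .communicate queue }

/-- The arm of which agent `m` asks for a hint in an exploration round `t`: with agents and arms
numbered from `0`, the covering matching `R_{(t % K) + 1}` joins agent `m` and arm
`m + t` modulo `K`. -/
def hintArm (h : M < K) (t : ℕ) (m : Fin M) : Fin K :=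
  ⟨(m.1 + t % K) % K, Nat.mod_lt _ (Nat.zero_lt_of_lt h)⟩

/-- The statistics after the observations of an exploration round `t` with realizations `x`: every
agent observes its reward and its hint. -/
noncomputable def observe (h : M < K) (t : ℕ) (x : Fin M → Fin K → Bool) (s : State M K) :
    State M K :=
  { s with
    sum := fun m k => s.sum m k
      + (if s.pulls h m = k then reward x (s.pulls h) m else 0)
      + (if hintArm h t m = k then (x m k).toNat else 0)
    count := fun m k => s.count m k
      + (if s.pulls h m = k then 1 else 0)
      + (if hintArm h t m = k then 1 else 0) }

/-- Round `t`, with realizations `x`. -/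
noncomputable def step (h : M < K) (T t : ℕ) (x : Fin M → Fin K → Bool) (s : State M K) :
    State M K :=
  match s.phase with
  | .explore j =>
      let s' := s.observe h t x
      if j + 1 < K then { s' with phase := .explore (j + 1) }
      else s'.continueComm h T s'.messages
  | .communicate queue => s.continueComm h T queue.tail
  | .exploit => s

/-- The initial state: no observations, all edges active. -/
def init (M K : ℕ) : State M K where
  epoch := 0
  sum := fun _ _ => 0
  count := fun _ _ => 0
  shared := fun _ _ => 0
  active := Finset.univ
  phase := .explore 0

end State

/-- The state of EBHD-ETC with horizon `T` before round `τ + n`, for the realizations `x`.  Rounds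
are numbered from `0`; rank assignment has taken the first `τ` rounds, and the agents are named by
their ranks. -/
noncomputable def stateAt {M K : ℕ} (h : M < K) (T τ : ℕ) (x : RewardTable M K) : ℕ → State M K
  | 0 => State.init M K
  | n + 1 => (stateAt h T τ x n).step h T (τ + n) (x (τ + n))

/-- The loss `U(G*; μ) - U(G(t); μ)` of a round. -/
noncomputable def loss {M K : ℕ} (h : M < K) (μ : Fin M → Fin K → ℝ) (Gstar : PullGraph M K)
    (s : State M K) : ℝ :=
  utility Gstar μ - utility (s.pulls h) μ

/-- The loss of a round that belongs to an exploration or the exploitation phase. -/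
noncomputable def expLoss {M K : ℕ} (h : M < K) (μ : Fin M → Fin K → ℝ) (Gstar : PullGraph M K)
    (s : State M K) : ℝ :=
  match s.phase with
  | .communicate _ => 0
  | _ => loss h μ Gstar s

/-- The loss of a round that belongs to a communication phase. -/
noncomputable def comLoss {M K : ℕ} (h : M < K) (μ : Fin M → Fin K → ℝ) (Gstar : PullGraph M K)
    (s : State M K) : ℝ :=
  match s.phase with
  | .communicate _ => loss h μ Gstar s
  | _ => 0

/-- The number of hints queried in a round: one for each agent during exploration. -/
def hintQueries {M K : ℕ} (s : State M K) : ℝ :=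
  match s.phase with
  | .explore _ => (M : ℝ)
  | _ => 0

/-- The sum of `f` over the rounds `τ, …, T - 1`, for the realizations `x`. -/
noncomputable def total {M K : ℕ} (h : M < K) (T τ : ℕ) (f : State M K → ℝ)
    (x : RewardTable M K) : ℝ :=
  ∑ n ∈ Finset.range (T - τ), f (stateAt h T τ x n)

end HMA2B

/-! Write L = log(T√(2M)), let Δ be the gap, and let A be √ρ times the error of an empirical mean
after ρ exploration blocks (`scaledDev`). Everything rests on P(A ≥ u) ≤ 2 exp(-2u²), for every edge
and every ρ (`scaledDev_tail`). The difficulty there is that the number n of observations is random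
and that a pull and a hint of the same arm count one realization twice. A round thus enters with a
predictable weight w in {0, 1, 2}, and exp(∑ (s w (X - μ) - s² w²/8)) has mean at most 1. Every
block contains, for each edge, a round with w = 1, so ∑ w² ≤ 2n - ρ. With s = 4y, a deviation of the
sum by yn makes the exponent at least 4y²n - 2y²(2n - ρ) = 2ρy²; the random n cancels. Rounding adds
at most 1/(2√ρ), which is of the same order as the error.

Exploration needs no good event, hence no logarithm. The matching of an epoch loses either 0 or some
δ ≥ Δ, and then δ ≤ δ³/Δ². Since √ρ δ is at most a sum of errors over 2M edges plus M/2, third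
moments give an expected loss of order ρ^(-3/2) M³K/Δ² per round; this is summable over ρ, and an
epoch has K rounds (`utility_sub_matching_le_cube`).

Exploitation is optimal outside an event of small probability (`matching_eq_of_exploit`). If it
starts late, the estimates alone identify the optimum. If it starts early, matchings through
eliminated edges lose more than the final matching can, so the M or fewer remaining edges are those
of the optimum. The early case needs errors below (7/8)√L instead of √L, but only for O(M²L/Δ²)
epochs, and the exponent 2(7/8)² > 3/2 still beats the factor L T.

If all errors are at most √L, only optimal edges survive the test of epoch r = ⌈64 M²L/Δ²⌉, so every
round before exploitation has epoch at most r (`epoch_le_lastEpoch`). This bounds the hints by MK(r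
+ 1). In communication, the precision grows like √ρ, as the accuracy does, so a message has bounded
expected length and a phase O(M²K) expected rounds. Such a round loses at most 2 more than the
matching of the epoch, whose loss is O(M√(L/ρ)); summed over the epochs up to r this is O(M²L/Δ²).
-/

namespace HMA2B

/-! ### Matchings, utilities and the gap -/

section Matchings

variable {M K : ℕ}

theorem utility_of_injective {G : PullGraph M K} (hG : Function.Injective G)
    (w : Fin M → Fin K → ℝ) : utility G w = ∑ m, w m (G m) := by
  refine Finset.sum_congr rfl fun m _ => if_pos fun m' hm' he => hm' (hG he)

theorem bestMatching_injective (h : M < K) (w : Fin M → Fin K → ℝ) :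
    Function.Injective (bestMatching h w) :=
  (hungarian (card_le_of_lt h) w).injective

theorem utility_le_bestMatching (h : M < K) (w : Fin M → Fin K → ℝ) {G : PullGraph M K}
    (hG : Function.Injective G) : utility G w ≤ utility (bestMatching h w) w := by
  rw [utility_of_injective hG, utility_of_injective (bestMatching_injective h w)]
  exact Classical.choose_spec (exists_maxWeightMatching (card_le_of_lt h) w) ⟨G, hG⟩

theorem bestMatchingThrough_self (h : M < K) (w : Fin M → Fin K → ℝ) (m : Fin M) (k : Fin K) :
    bestMatchingThrough h w m k m = k := by
  simp [bestMatchingThrough]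

theorem bestMatchingThrough_injective (h : M < K) (w : Fin M → Fin K → ℝ) (m : Fin M)
    (k : Fin K) : Function.Injective (bestMatchingThrough h w m k) := by
  intro a b hab
  unfold bestMatchingThrough at hab
  split_ifs at hab with ha hb hb
  · rw [ha, hb]
  · exact absurd hab.symm (hungarian (card_remove_le h m k) _ ⟨b, hb⟩).2
  · exact absurd hab (hungarian (card_remove_le h m k) _ ⟨a, ha⟩).2
  · have := (hungarian (card_remove_le h m k) _).injective (Subtype.ext hab)
    exact congrArg Subtype.val this

theorem sum_eq_add_sum_ne {M : ℕ} (f : Fin M → ℝ) (m : Fin M) :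
    ∑ a, f a = f m + ∑ a : {a : Fin M // a ≠ m}, f a := by
  rw [← Finset.add_sum_erase _ f (Finset.mem_univ m)]
  congr 1
  exact Finset.sum_subtype _ (by simp) f

/-- Removing the edge of `m` from `G` leaves a competitor in the reduced matching problem. A failed
elimination test therefore says something about every matching through the edge. -/
theorem utility_le_bestMatchingThrough (h : M < K) (w : Fin M → Fin K → ℝ) {G : PullGraph M K}
    (hG : Function.Injective G) (m : Fin M) :
    utility G w ≤ utility (bestMatchingThrough h w m (G m)) w := by
  rw [utility_of_injective hG, utility_of_injective (bestMatchingThrough_injective h w m (G m)),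
    sum_eq_add_sum_ne _ m, sum_eq_add_sum_ne (fun a => w a (bestMatchingThrough h w m (G m) a)) m,
    bestMatchingThrough_self]
  have key := Classical.choose_spec (exists_maxWeightMatching (card_remove_le h m (G m))
    (fun (a : {a : Fin M // a ≠ m}) (b : {b : Fin K // b ≠ G m}) => w a.1 b.1))
    ⟨fun a => ⟨G a.1, fun he => a.2 (hG he)⟩, fun a b hab =>
      Subtype.ext (hG (congrArg Subtype.val hab))⟩
  refine add_le_add le_rfl (key.trans (le_of_eq ?_))
  refine Finset.sum_congr rfl fun a _ => ?_
  unfold bestMatchingThrough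
  rw [dif_neg a.2]
  rfl

variable {μ : Fin M → Fin K → ℝ}

theorem utility_nonneg (h0 : ∀ m k, 0 ≤ μ m k) (G : PullGraph M K) : 0 ≤ utility G μ :=
  Finset.sum_nonneg fun m _ => by split_ifs <;> simp [h0]

theorem utility_le_card (h1 : ∀ m k, μ m k ≤ 1) (G : PullGraph M K) : utility G μ ≤ M := by
  calc utility G μ ≤ ∑ _m : Fin M, (1 : ℝ) :=
        Finset.sum_le_sum fun m _ => by split_ifs <;> simp [h1]
    _ = M := by simp

theorem exists_notMem_range (h : M < K) (G : PullGraph M K) : ∃ k, ∀ m, G m ≠ k := by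
  by_contra! hc
  have := Fintype.card_le_of_surjective G hc
  simp at this
  omega

/-- Since M < K there is a free arm; moving one of two colliding agents to it costs nothing, which
contradicts uniqueness. -/
theorem IsUniqueOptimal.injective (h : M < K) (h0 : ∀ m k, 0 ≤ μ m k) {Gstar : PullGraph M K}
    (hopt : IsUniqueOptimal μ Gstar) : Function.Injective Gstar := by
  classical
  intro a b hab
  by_contra hne
  obtain ⟨k, hk⟩ := exists_notMem_range h Gstar
  have hG : Function.update Gstar a k ≠ Gstar := fun he =>
    hk a (by rw [← he]; simp)
  refine absurd (hopt _ hG) (not_lt.mpr (Finset.sum_le_sum fun m _ => ?_))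
  by_cases hm : m = a
  · subst hm
    rw [if_neg]
    · split_ifs <;> simp [h0]
    · exact fun hc => hc b (Ne.symm hne) hab.symm
  · by_cases hc : NoCollision Gstar m
    · rw [if_pos hc, if_pos, Function.update_of_ne hm]
      intro m' hm'
      rw [Function.update_of_ne hm]
      by_cases h2 : m' = a
      · subst h2
        rw [Function.update_self]
        exact (hk m).symm
      · rw [Function.update_of_ne h2]
        exact hc m' hm'
    · rw [if_neg hc]
      split_ifs <;> simp [h0]

theorem minGap_le {Gstar : PullGraph M K} {G : PullGraph M K} (hG : G ≠ Gstar) :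
    minGap μ Gstar ≤ utility Gstar μ - utility G μ :=
  ciInf_le (Set.finite_range fun G : {G : PullGraph M K // G ≠ Gstar} =>
    utility Gstar μ - utility G.1 μ).bddBelow ⟨G, hG⟩

theorem exists_ne_injective (hM : 1 ≤ M) (h : M < K) {Gstar : PullGraph M K}
    (hinj : Function.Injective Gstar) :
    ∃ a k, (∀ m, Gstar m ≠ k) ∧ Function.update Gstar a k ≠ Gstar ∧
      Function.Injective (Function.update Gstar a k) := by
  classical
  obtain ⟨k, hk⟩ := exists_notMem_range h Gstar
  refine ⟨⟨0, hM⟩, k, hk, fun he => hk ⟨0, hM⟩ (by rw [← he]; simp), fun a b hab => ?_⟩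
  simp only [Function.update_apply] at hab
  split_ifs at hab with h1 h2 h2
  · rw [h1, h2]
  · exact absurd hab.symm (hk _)
  · exact absurd hab (hk _)
  · exact hinj hab

theorem minGap_pos (hM : 1 ≤ M) (h : M < K) (h0 : ∀ m k, 0 ≤ μ m k) {Gstar : PullGraph M K}
    (hopt : IsUniqueOptimal μ Gstar) : 0 < minGap μ Gstar := by
  obtain ⟨a, k, -, hne, -⟩ := exists_ne_injective hM h (hopt.injective h h0)
  have : Nonempty {G : PullGraph M K // G ≠ Gstar} := ⟨_, hne⟩
  obtain ⟨G, hG⟩ := exists_eq_ciInf_of_finite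
    (f := fun G : {G : PullGraph M K // G ≠ Gstar} => utility Gstar μ - utility G.1 μ)
  unfold minGap
  rw [← hG]
  exact sub_pos.mpr (hopt G.1 G.2)

/-- Moving a single agent of the optimum to a free arm loses at most one reward. The bound lets
terms without 1/Δ² be absorbed. -/
theorem minGap_le_one (hM : 1 ≤ M) (h : M < K) (h0 : ∀ m k, 0 ≤ μ m k) (h1 : ∀ m k, μ m k ≤ 1)
    {Gstar : PullGraph M K} (hopt : IsUniqueOptimal μ Gstar) : minGap μ Gstar ≤ 1 := by
  classical
  have hinj := hopt.injective h h0
  obtain ⟨a, k, -, hne, hinj'⟩ := exists_ne_injective hM h hinj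
  refine (minGap_le hne).trans ?_
  rw [utility_of_injective hinj, utility_of_injective hinj', sum_eq_add_sum_ne _ a,
    sum_eq_add_sum_ne (fun m => μ m (Function.update Gstar a k m)) a]
  have : ∑ m : {m : Fin M // m ≠ a}, μ m (Function.update Gstar a k m)
      = ∑ m : {m : Fin M // m ≠ a}, μ m (Gstar m) :=
    Finset.sum_congr rfl fun m _ => by rw [Function.update_of_ne m.2]
  rw [this]
  have := h1 a (Gstar a)
  have := h0 a (Function.update Gstar a k a)
  linarith

/-- Sending a bit disturbs only the sender and the receiver. -/
theorem utility_sub_update_le (h0 : ∀ m k, 0 ≤ μ m k) (h1 : ∀ m k, μ m k ≤ 1)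
    {G : PullGraph M K} (hG : Function.Injective G) (a b : Fin M) :
    utility G μ - utility (Function.update G a (G b)) μ ≤ 2 := by
  classical
  have key : ∀ m, (μ m (G m) - if NoCollision (Function.update G a (G b)) m
        then μ m (Function.update G a (G b) m) else 0)
      ≤ (if m = a then 1 else 0) + if m = b then 1 else 0 := by
    intro m
    by_cases hma : m = a
    · rw [if_pos hma]
      have := h1 m (G m)
      have : (0 : ℝ) ≤ if NoCollision (Function.update G a (G b)) m
        then μ m (Function.update G a (G b) m) else 0 := by split_ifs <;> simp [h0]
      have : (0 : ℝ) ≤ if m = b then 1 else 0 := by split_ifs <;> simp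
      linarith
    · by_cases hmb : m = b
      · rw [if_pos hmb]
        have := h1 m (G m)
        have : (0 : ℝ) ≤ if NoCollision (Function.update G a (G b)) m
          then μ m (Function.update G a (G b) m) else 0 := by split_ifs <;> simp [h0]
        have : (0 : ℝ) ≤ if m = a then 1 else 0 := by simp [hma]
        linarith
      · rw [if_neg hma, if_neg hmb, if_pos, Function.update_of_ne hma]
        · simp
        · intro m' hm'
          rw [Function.update_of_ne hma]
          by_cases h2 : m' = a
          · subst h2
            rw [Function.update_self]
            exact fun he => hmb (hG he).symm
          · rw [Function.update_of_ne h2]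
            exact fun he => hm' (hG he)
  rw [utility_of_injective hG]
  unfold utility
  rw [← Finset.sum_sub_distrib]
  refine (Finset.sum_le_sum fun m _ => key m).trans ?_
  rw [Finset.sum_add_distrib]
  simp
  norm_num

/-- Two matchings compared under two weights that are close to each other. -/
theorem utility_sub_le_of_close {w : Fin M → Fin K → ℝ} {a b : ℝ}
    (hlo : ∀ m k, -a ≤ w m k - μ m k) (hhi : ∀ m k, w m k - μ m k ≤ b)
    {G G' : PullGraph M K} (hG : Function.Injective G) (hG' : Function.Injective G') :
    utility G w - utility G' w ≤ utility G μ - utility G' μ + M * (a + b) := by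
  simp only [utility_of_injective hG, utility_of_injective hG']
  have : ∑ m, w m (G m) - ∑ m, w m (G' m)
      ≤ ∑ m, μ m (G m) - ∑ m, μ m (G' m) + ∑ _m : Fin M, (a + b) := by
    rw [← Finset.sum_sub_distrib, ← Finset.sum_sub_distrib, ← Finset.sum_add_distrib]
    refine Finset.sum_le_sum fun m _ => ?_
    have := hlo m (G' m)
    have := hhi m (G m)
    linarith
  rwa [Finset.sum_const, Finset.card_univ, Fintype.card_fin, nsmul_eq_mul] at this

end Matchings

/-! ### Transitions of the algorithm and the structure of exploration blocks -/

section Run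

variable {M K : ℕ}

/-- The number of completed exploration blocks. -/
def State.blocks (s : State M K) : ℕ :=
  match s.phase with
  | .communicate _ => s.epoch + 1
  | _ => s.epoch

/-- How often agent `m` observes arm `k` in round `t`. -/
noncomputable def State.weight (h : M < K) (t : ℕ) (s : State M K) (m : Fin M) (k : Fin K) : ℕ :=
  match s.phase with
  | .explore _ => (if s.pulls h m = k then 1 else 0) + (if State.hintArm h t m = k then 1 else 0)
  | _ => 0

/-- The state after the observations of a round, before any change of phase. -/
noncomputable def State.observed (h : M < K) (t : ℕ) (x : Fin M → Fin K → Bool)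
    (s : State M K) : State M K :=
  match s.phase with
  | .explore _ => s.observe h t x
  | _ => s

theorem State.weight_of_explore (h : M < K) (t : ℕ) {s : State M K} {j : ℕ}
    (hp : s.phase = .explore j) (m : Fin M) (k : Fin K) :
    s.weight h t m k
      = (if bestMatching h s.shared m = k then 1 else 0)
        + (if State.hintArm h t m = k then 1 else 0) := by
  simp only [State.weight, hp, State.pulls, State.matching]

theorem State.weight_of_ne_explore (h : M < K) (t : ℕ) {s : State M K}
    (hp : ∀ j, s.phase ≠ .explore j) (m : Fin M) (k : Fin K) : s.weight h t m k = 0 := by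
  unfold State.weight
  split
  · exact absurd ‹_› (hp _)
  · rfl

theorem State.pulls_of_ne_communicate (h : M < K) {s : State M K}
    (hp : ∀ q, s.phase ≠ .communicate q) : s.pulls h = s.matching h := by
  unfold State.pulls
  split
  · exact absurd ‹_› (hp _)
  · rfl

/-- Exploration pulls a matching, so no reward is lost to a collision: pull and hint both see the
realization, and together they may count it twice. -/
theorem State.observed_sum (h : M < K) (t : ℕ) (x : Fin M → Fin K → Bool) (s : State M K)
    (m : Fin M) (k : Fin K) :
    (s.observed h t x).sum m k = s.sum m k + s.weight h t m k * (x m k).toNat := by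
  unfold State.observed State.weight
  split
  · rename_i j hp
    have hpull : s.pulls h = s.matching h :=
      s.pulls_of_ne_communicate h fun q => by rw [hp]; nofun
    have hnc : NoCollision (s.pulls h) m := by
      rw [hpull]
      exact fun m' hm' he => hm' (bestMatching_injective h _ he)
    simp only [State.observe, reward, if_pos hnc]
    by_cases h1 : s.pulls h m = k <;> by_cases h2 : State.hintArm h t m = k <;>
      simp [h1, h2, two_mul, add_assoc]
  · simp

theorem State.observed_count (h : M < K) (t : ℕ) (x : Fin M → Fin K → Bool) (s : State M K)
    (m : Fin M) (k : Fin K) :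
    (s.observed h t x).count m k = s.count m k + s.weight h t m k := by
  unfold State.observed State.weight
  split
  · simp [State.observe, add_assoc]
  · simp

/-- The possible transitions in one round, as far as they do not depend on the statistics. -/
inductive Transition (h : M < K) (T : ℕ) (s s' : State M K) : Prop
  | explore (j : ℕ) (hp : s.phase = .explore j) (hj : j + 1 < K)
      (hp' : s'.phase = .explore (j + 1)) (he : s'.epoch = s.epoch) (hs : s'.shared = s.shared)
      (ha : s'.active = s.active)
  | beginComm (j : ℕ) (hp : s.phase = .explore j) (hj : K ≤ j + 1)
      (hp' : s'.phase = .communicate s'.messages) (hne : s'.messages ≠ [])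
      (he : s'.epoch = s.epoch) (hs : s'.shared = s.shared) (ha : s'.active = s.active)
  | comm (q : List (Transmission M)) (hp : s.phase = .communicate q)
      (hp' : s'.phase = .communicate q.tail) (hne : q.tail ≠ [])
      (he : s'.epoch = s.epoch) (hs : s'.shared = s.shared) (ha : s'.active = s.active)
      (hm : s'.messages = s.messages)
  | epoch (hp : (∃ j, s.phase = .explore j ∧ K ≤ j + 1) ∨
        ∃ q, s.phase = .communicate q)
      (he : s'.epoch = s.epoch + 1)
      (hs : ∀ m k, s'.shared m k = quantize (s.epoch + 1) (s'.empMean m k))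
      (ha : s'.active = s.nextActive h T)
      (hp' : s'.phase = if M < s'.active.card then .explore 0 else .exploit)
  | exploit (hp : s.phase = .exploit) (hs : s' = s)

theorem State.step_sum_count (h : M < K) (T t : ℕ) (x : Fin M → Fin K → Bool) (s : State M K) :
    (s.step h T t x).sum = (s.observed h t x).sum ∧
      (s.step h T t x).count = (s.observed h t x).count := by
  unfold State.step
  split
  · rename_i j hp
    have ho : s.observed h t x = s.observe h t x := by simp only [State.observed, hp]
    rw [ho]
    dsimp only
    split_ifs
    · exact ⟨rfl, rfl⟩
    · unfold State.continueComm
      split <;> exact ⟨rfl, rfl⟩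
  · rename_i q hp
    have ho : s.observed h t x = s := by simp only [State.observed, hp]
    rw [ho]
    unfold State.continueComm
    split <;> exact ⟨rfl, rfl⟩
  · rename_i hp
    have ho : s.observed h t x = s := by simp only [State.observed, hp]
    rw [ho]
    exact ⟨rfl, rfl⟩

theorem State.transition_step (h : M < K) (T t : ℕ) (x : Fin M → Fin K → Bool) (s : State M K) :
    Transition h T s (s.step h T t x) := by
  unfold State.step
  split
  · rename_i j hp
    dsimp only
    split_ifs with hj
    · exact .explore j hp hj rfl rfl rfl rfl
    · unfold State.continueComm
      split
      -- An empty message list, as with a single agent, ends the epoch without any communication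
      -- round.
      · exact .epoch (.inl ⟨j, hp, not_lt.mp hj⟩) rfl (fun _ _ => rfl) rfl rfl
      · rename_i q hq
        refine .beginComm j hp (not_lt.mp hj) rfl ?_ rfl rfl rfl
        intro h0
        have h1 : (s.observe h t x).messages = [] := h0
        rw [hq] at h1
        exact List.cons_ne_nil _ _ h1
  · rename_i q hp
    unfold State.continueComm
    split
    · exact .epoch (.inr ⟨q, hp⟩) rfl (fun _ _ => rfl) rfl rfl
    · rename_i a b hq
      exact .comm q hp rfl (by simp [hq]) rfl rfl rfl rfl
  · exact .exploit ‹_› rfl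

variable (h : M < K) (T τ : ℕ) (x : RewardTable M K)

theorem transition_stateAt (n : ℕ) :
    Transition h T (stateAt h T τ x n) (stateAt h T τ x (n + 1)) :=
  State.transition_step h T _ _ _

/-- How often agent `m` observes arm `k` in round `τ + i`. -/
noncomputable def obsWeight (m : Fin M) (k : Fin K) (i : ℕ) : ℕ :=
  (stateAt h T τ x i).weight h (τ + i) m k

theorem stateAt_sum (n : ℕ) (m : Fin M) (k : Fin K) :
    (stateAt h T τ x n).sum m k
      = ∑ i ∈ Finset.range n, obsWeight h T τ x m k i * (x (τ + i) m k).toNat := by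
  induction n with
  | zero => rfl
  | succ n ih =>
    rw [Finset.sum_range_succ, ← ih, stateAt, (State.step_sum_count h T _ _ _).1,
      State.observed_sum]
    rfl

theorem stateAt_count (n : ℕ) (m : Fin M) (k : Fin K) :
    (stateAt h T τ x n).count m k = ∑ i ∈ Finset.range n, obsWeight h T τ x m k i := by
  induction n with
  | zero => rfl
  | succ n ih =>
    rw [Finset.sum_range_succ, ← ih, stateAt, (State.step_sum_count h T _ _ _).2,
      State.observed_count]
    rfl

theorem State.blocks_of_explore {s : State M K} {j : ℕ} (hp : s.phase = .explore j) :
    s.blocks = s.epoch := by simp [State.blocks, hp]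

theorem State.blocks_of_exploit {s : State M K} (hp : s.phase = .exploit) :
    s.blocks = s.epoch := by simp [State.blocks, hp]

theorem State.blocks_of_communicate {s : State M K} {q : List (Transmission M)}
    (hp : s.phase = .communicate q) : s.blocks = s.epoch + 1 := by simp [State.blocks, hp]

theorem State.epoch_le_blocks (s : State M K) : s.epoch ≤ s.blocks := by
  unfold State.blocks
  split <;> omega

theorem Transition.blocks_of_epoch {s' : State M K}
    (hp' : s'.phase = if M < s'.active.card then .explore 0 else .exploit) :
    s'.blocks = s'.epoch := by
  split_ifs at hp'
  · exact State.blocks_of_explore hp'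
  · exact State.blocks_of_exploit hp'

variable {h T} in
theorem Transition.blocks_le {s s' : State M K} (ht : Transition h T s s') :
    s.blocks ≤ s'.blocks ∧ s'.blocks ≤ s.blocks + 1 ∧ s.epoch ≤ s'.epoch := by
  cases ht with
  | explore j hp hj hp' he =>
    rw [State.blocks_of_explore hp, State.blocks_of_explore hp']; omega
  | beginComm j hp hj hp' hne he =>
    rw [State.blocks_of_explore hp, State.blocks_of_communicate hp']; omega
  | comm q hp hp' hne he =>
    rw [State.blocks_of_communicate hp, State.blocks_of_communicate hp']; omega
  | epoch hp he hs ha hp' =>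
    rw [Transition.blocks_of_epoch hp', he]
    rcases hp with ⟨j, hp, -⟩ | ⟨q, hp⟩
    · rw [State.blocks_of_explore hp]; omega
    · rw [State.blocks_of_communicate hp]; omega
  | exploit hp hs => subst hs; omega

theorem blocks_mono : Monotone fun n => (stateAt h T τ x n).blocks :=
  monotone_nat_of_le_succ fun n => (transition_stateAt h T τ x n).blocks_le.1

theorem epoch_mono : Monotone fun n => (stateAt h T τ x n).epoch :=
  monotone_nat_of_le_succ fun n => (transition_stateAt h T τ x n).blocks_le.2.2

theorem blocks_le (n : ℕ) : (stateAt h T τ x n).blocks ≤ n := by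
  induction n with
  | zero => exact le_rfl
  | succ n ih => exact (transition_stateAt h T τ x n).blocks_le.2.1.trans (by omega)

theorem exists_hintArm_eq (t : ℕ) (m : Fin M) (k : Fin K) : ∃ i < K, State.hintArm h (t + i) m = k := by
  have hK : 0 < K := Nat.zero_lt_of_lt h
  -- The offset is k - (m + t) modulo K, with K - 1 playing the role of -1.
  refine ⟨(k.1 + (K - 1) * (m.1 + t)) % K, Nat.mod_lt _ hK, Fin.ext ?_⟩
  change (m.1 + (t + (k.1 + (K - 1) * (m.1 + t)) % K) % K) % K = k.1
  rw [Nat.add_mod_mod, ← add_assoc, Nat.add_mod_mod]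
  have : m.1 + t + (k.1 + (K - 1) * (m.1 + t)) = k.1 + K * (m.1 + t) := by
    obtain ⟨c, rfl⟩ : ∃ c, K = c + 1 := ⟨K - 1, by omega⟩
    simp only [Nat.add_sub_cancel]
    ring
  rw [this, Nat.add_mul_mod_self_left, Nat.mod_eq_of_lt k.2]

theorem hintArm_ne_succ (t : ℕ) (m : Fin M) : State.hintArm h t m ≠ State.hintArm h (t + 1) m := by
  intro he
  have hK : 2 ≤ K := by have := m.2; omega
  have he : (m.1 + t % K) % K = (m.1 + (t + 1) % K) % K := congrArg Fin.val he
  rw [Nat.add_mod_mod, Nat.add_mod_mod, ← add_assoc] at he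
  have : (m.1 + t + 0) % K = (m.1 + t + 1) % K := by simpa using he
  have : 0 % K = 1 % K := Nat.ModEq.add_left_cancel' _ this
  rw [Nat.zero_mod, Nat.mod_eq_of_lt hK] at this
  omega

/-- In a complete exploration block each edge is observed exactly once in some round. -/
theorem exists_obsWeight_eq_one (n₀ : ℕ) (G : PullGraph M K)
    (hblock : ∀ i < K, ∃ j, (stateAt h T τ x (n₀ + i)).phase = .explore j ∧
      bestMatching h (stateAt h T τ x (n₀ + i)).shared = G) (m : Fin M) (k : Fin K) :
    ∃ i < K, obsWeight h T τ x m k (n₀ + i) = 1 := by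
  have hw : ∀ i < K, obsWeight h T τ x m k (n₀ + i)
      = (if G m = k then 1 else 0) + (if State.hintArm h (τ + n₀ + i) m = k then 1 else 0) := by
    intro i hi
    obtain ⟨j, hj, hG⟩ := hblock i hi
    rw [obsWeight, State.weight_of_explore h _ hj, hG, add_assoc]
  -- On a pulled edge the weight is 1 or 2, and two consecutive rounds cannot both have their hint
  -- on it. On any other edge the round of its hint has weight 1.
  by_cases hG : G m = k
  · have hK : 2 ≤ K := by have := m.2; omega
    by_cases h0 : State.hintArm h (τ + n₀ + 0) m = k
    · refine ⟨1, by omega, ?_⟩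
      rw [hw 1 (by omega), if_pos hG, if_neg]
      exact fun h1 => hintArm_ne_succ h (τ + n₀) m (h0.trans h1.symm)
    · exact ⟨0, by omega, by rw [hw 0 (by omega), if_pos hG, if_neg h0]⟩
  · obtain ⟨i, hi, he⟩ := exists_hintArm_eq h (τ + n₀) m k
    exact ⟨i, hi, by rw [hw i hi, if_neg hG, if_pos he]⟩

/-- The number of rounds with exactly one observation of the edge. -/
noncomputable def singles (m : Fin M) (k : Fin K) (n : ℕ) : ℕ :=
  ((Finset.range n).filter fun i => obsWeight h T τ x m k i = 1).card

theorem singles_mono (m : Fin M) (k : Fin K) : Monotone (singles h T τ x m k) := fun _ _ hab =>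
  Finset.card_le_card (Finset.filter_subset_filter _ (Finset.range_subset_range.mpr hab))

theorem singles_lt {m : Fin M} {k : Fin K} {a i b : ℕ} (ha : a ≤ i) (hb : i < b)
    (hi : obsWeight h T τ x m k i = 1) : singles h T τ x m k a + 1 ≤ singles h T τ x m k b := by
  unfold singles
  refine Finset.card_lt_card (Finset.ssubset_iff.mpr ⟨i, by simp; omega, fun c hc => ?_⟩)
  simp only [Finset.mem_insert, Finset.mem_filter, Finset.mem_range] at hc ⊢
  rcases hc with rfl | ⟨h1, h2⟩
  · exact ⟨hb, hi⟩
  · exact ⟨by omega, h2⟩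

/-- All observations of the edge in the first `n` rounds belong to complete blocks. -/
def Settled (m : Fin M) (k : Fin K) (n ρ : ℕ) : Prop :=
  (∀ i < n, obsWeight h T τ x m k i = 0 ∨ (stateAt h T τ x i).blocks < ρ) ∧
    ρ ≤ singles h T τ x m k n

/-- Invariant of the run. Within a block the shared statistics, hence the pulled matching, have not
changed since its first round n₀, so a completed block contributes a round of weight 1. During a
block the claim is made at n₀ only, because later observations belong to an unfinished block. -/
theorem block_structure (m : Fin M) (k : Fin K) (n : ℕ) :
    (∀ j, (stateAt h T τ x n).phase = .explore j → ∃ n₀, n = n₀ + j ∧ j < K ∧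
      Settled h T τ x m k n₀ (stateAt h T τ x n).epoch ∧
      ∀ i < j, (stateAt h T τ x (n₀ + i)).phase = .explore i ∧
        (stateAt h T τ x (n₀ + i)).shared = (stateAt h T τ x n).shared) ∧
    ((∀ j, (stateAt h T τ x n).phase ≠ .explore j) →
      Settled h T τ x m k n (stateAt h T τ x n).blocks) := by
  have hzero : ∀ n, (∀ j, (stateAt h T τ x n).phase ≠ .explore j) →
      obsWeight h T τ x m k n = 0 := fun n hp => State.weight_of_ne_explore h _ hp m k
  induction n with
  | zero =>
    refine ⟨fun j hj => ⟨0, ?_⟩, fun hp => absurd rfl (hp 0)⟩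
    obtain rfl : 0 = j := by injection hj
    refine ⟨rfl, Nat.zero_lt_of_lt h, ⟨by simp, Nat.zero_le _⟩, by simp⟩
  | succ n ih =>
    have hdone : ∀ j, (stateAt h T τ x n).phase = .explore j → K ≤ j + 1 →
        Settled h T τ x m k (n + 1) ((stateAt h T τ x n).epoch + 1) := by
      intro j hp hj
      obtain ⟨n₀, hn, hjK, ⟨hset, hcount⟩, hblock⟩ := ih.1 j hp
      refine ⟨fun i hi => .inr ?_, ?_⟩
      · have := blocks_mono h T τ x (Nat.lt_succ_iff.mp hi)
        simp only [State.blocks_of_explore hp] at this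
        omega
      · obtain ⟨i, hi, hw⟩ := exists_obsWeight_eq_one h T τ x n₀
          (bestMatching h (stateAt h T τ x n).shared) (fun i hi => by
            by_cases hij : i < j
            · exact ⟨i, (hblock i hij).1, by rw [(hblock i hij).2]⟩
            · obtain rfl : i = j := by omega
              exact ⟨i, hn ▸ hp, by rw [hn]⟩) m k
        have := singles_lt h T τ x (a := n₀) (b := n + 1) (by omega) (by omega) hw
        omega
    cases transition_stateAt h T τ x n with
    | explore j hp hj hp' he hs ha =>
      refine ⟨fun j' hj' => ?_, fun hne => absurd hp' (hne _)⟩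
      obtain rfl : j' = j + 1 := by rw [hp'] at hj'; injection hj' with h1; exact h1.symm
      obtain ⟨n₀, hn, hjK, hset, hblock⟩ := ih.1 j hp
      refine ⟨n₀, by omega, hj, he ▸ hset, fun i hi => ?_⟩
      rw [hs]
      by_cases hij : i < j
      · exact hblock i hij
      · obtain rfl : i = j := by omega
        rw [← hn]
        exact ⟨hp, rfl⟩
    | beginComm j hp hj hp' hne he hs ha =>
      refine ⟨fun j' hj' => (by rw [hp'] at hj'; nomatch hj'), fun _ => ?_⟩
      rw [State.blocks_of_communicate hp', he]
      exact hdone j hp hj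
    | comm q hp hp' hne he hs ha hm =>
      have hnx : ∀ j, (stateAt h T τ x n).phase ≠ .explore j := fun j => by
        rw [hp]; nofun
      refine ⟨fun j' hj' => (by rw [hp'] at hj'; nomatch hj'), fun _ => ?_⟩
      obtain ⟨h1, h2⟩ := ih.2 hnx
      rw [State.blocks_of_communicate hp', he, ← State.blocks_of_communicate hp]
      refine ⟨fun i hi => ?_, h2.trans (singles_mono h T τ x m k (Nat.le_succ n))⟩
      rcases Nat.lt_succ_iff_lt_or_eq.mp hi with hi | rfl
      · exact h1 i hi
      · exact .inl (hzero _ hnx)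
    | epoch hp he hs ha hp' =>
      have key : Settled h T τ x m k (n + 1) (stateAt h T τ x (n + 1)).epoch := by
        rw [he]
        rcases hp with ⟨j, hp, hj⟩ | ⟨q, hp⟩
        · exact hdone j hp hj
        · have hnx : ∀ j, (stateAt h T τ x n).phase ≠ .explore j := fun j => by
            rw [hp]; nofun
          obtain ⟨h1, h2⟩ := ih.2 hnx
          rw [← State.blocks_of_communicate hp]
          refine ⟨fun i hi => ?_, h2.trans (singles_mono h T τ x m k (Nat.le_succ n))⟩
          rcases Nat.lt_succ_iff_lt_or_eq.mp hi with hi | rfl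
          · exact h1 i hi
          · exact .inl (hzero _ hnx)
      refine ⟨fun j' hj' => ?_, fun _ => ?_⟩
      · obtain rfl : j' = 0 := by
          split_ifs at hp'
          · rw [hp'] at hj'; injection hj' with h1; exact h1.symm
          · rw [hp'] at hj'; nomatch hj'
        exact ⟨n + 1, rfl, Nat.zero_lt_of_lt h, key, by simp⟩
      · rw [Transition.blocks_of_epoch hp']
        exact key
    | exploit hp hs =>
      have hnx : ∀ j, (stateAt h T τ x n).phase ≠ .explore j := fun j => by
        rw [hp]; nofun
      rw [hs]
      refine ⟨fun j hj => absurd hj (hnx j), fun hp => ?_⟩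
      obtain ⟨h1, h2⟩ := ih.2 hnx
      refine ⟨fun i hi => ?_, h2.trans (singles_mono h T τ x m k (Nat.le_succ n))⟩
      rcases Nat.lt_succ_iff_lt_or_eq.mp hi with hi | rfl
      · exact h1 i hi
      · exact .inl (hzero _ hnx)

theorem settled_of_phase (m : Fin M) (k : Fin K) {n : ℕ}
    (hp : ∀ j, (stateAt h T τ x n).phase ≠ .explore (j + 1)) :
    Settled h T τ x m k n (stateAt h T τ x n).blocks := by
  by_cases h0 : (stateAt h T τ x n).phase = .explore 0
  · obtain ⟨n₀, hn, -, hset, -⟩ := (block_structure h T τ x m k n).1 0 h0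
    rw [add_zero] at hn
    rw [State.blocks_of_explore h0]
    rwa [← hn] at hset
  · refine (block_structure h T τ x m k n).2 fun j => ?_
    cases j with
    | zero => exact h0
    | succ j => exact hp j

theorem blocks_le_singles (m : Fin M) (k : Fin K) (n : ℕ) :
    (stateAt h T τ x n).blocks ≤ singles h T τ x m k n := by
  by_cases hp : ∃ j, (stateAt h T τ x n).phase = .explore j
  · obtain ⟨j, hp⟩ := hp
    obtain ⟨n₀, hn, -, hset, -⟩ := (block_structure h T τ x m k n).1 j hp
    rw [State.blocks_of_explore hp]
    exact hset.2.trans (singles_mono h T τ x m k (by omega))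
  · exact ((block_structure h T τ x m k n).2 (not_exists.mp hp)).2

end Run

/-! ### Rounding and the length of messages -/

section Quantization

theorem le_quantize (ρ : ℕ) (y : ℝ) : y ≤ quantize ρ y := by
  have hp : (0 : ℝ) < 2 ^ precision ρ := by positivity
  rw [quantize, le_div_iff₀ hp]
  exact Int.le_ceil _

theorem quantize_le (ρ : ℕ) (y : ℝ) : quantize ρ y ≤ y + 1 / 2 ^ precision ρ := by
  have hp : (0 : ℝ) < 2 ^ precision ρ := by positivity
  rw [quantize, div_le_iff₀ hp, add_mul, one_div_mul_cancel hp.ne']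
  exact (Int.ceil_lt_add_one _).le

theorem two_rpow_precision {ρ : ℕ} (hρ : 1 ≤ ρ) :
    (2 : ℝ) ^ (1 + Real.logb 2 (ρ : ℝ) / 2) = 2 * √ρ := by
  have hρ' : (0 : ℝ) < ρ := by exact_mod_cast hρ
  rw [Real.rpow_add two_pos, Real.rpow_one, Real.sqrt_eq_rpow, div_eq_mul_one_div,
    Real.rpow_mul two_pos.le, Real.rpow_logb two_pos (by norm_num) hρ']

theorem two_mul_sqrt_le_two_pow_precision {ρ : ℕ} (hρ : 1 ≤ ρ) :
    2 * √ρ ≤ 2 ^ precision ρ := by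
  rw [← two_rpow_precision hρ, ← Real.rpow_natCast]
  exact Real.rpow_le_rpow_of_exponent_le one_le_two (Nat.le_ceil _)

theorem two_pow_precision_le {ρ : ℕ} (hρ : 1 ≤ ρ) : 2 ^ precision ρ ≤ 4 * √(ρ : ℝ) := by
  have hlog : 0 ≤ Real.logb 2 (ρ : ℝ) :=
    Real.logb_nonneg one_lt_two (by exact_mod_cast hρ)
  have h1 : (precision ρ : ℝ) ≤ (1 + Real.logb 2 (ρ : ℝ) / 2) + 1 :=
    (Nat.ceil_lt_add_one (by positivity)).le
  calc (2 : ℝ) ^ precision ρ = (2 : ℝ) ^ (precision ρ : ℝ) := (Real.rpow_natCast _ _).symm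
    _ ≤ (2 : ℝ) ^ ((1 + Real.logb 2 (ρ : ℝ) / 2) + 1) :=
        Real.rpow_le_rpow_of_exponent_le one_le_two h1
    _ = 4 * √ρ := by
        rw [Real.rpow_add two_pos, two_rpow_precision hρ, Real.rpow_one]; ring

theorem abs_floor_le (y : ℝ) : ((⌊y⌋.natAbs : ℕ) : ℝ) ≤ |y| + 1 := by
  rw [Nat.cast_natAbs, Int.cast_abs, abs_le]
  have h1 := Int.floor_le y
  have h2 := Int.lt_floor_add_one y
  constructor
  · have := neg_abs_le y; linarith
  · have := le_abs_self y; linarith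

/-- The number of digits is bounded crudely by the number itself; this is enough because the
expected number of units sent is bounded. -/
theorem length_bitString_le (d : ℤ) : (bitString d).length ≤ d.natAbs + 1 := by
  rw [bitString, List.length_cons, List.length_reverse, Nat.size_eq_bits_len]
  exact Nat.succ_le_succ (Nat.size_le.mpr Nat.lt_two_pow_self)

end Quantization

/-! ### Estimation errors of the shared statistics and communication lengths -/

section Statistics

variable {M K : ℕ} (h : M < K) (T τ : ℕ) (x : RewardTable M K)

/-- The number of observations of an edge in the first `ρ` exploration blocks, among `N` rounds. -/
noncomputable def obsCount (N ρ : ℕ) (m : Fin M) (k : Fin K) : ℕ :=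
  ∑ i ∈ Finset.range N,
    if (stateAt h T τ x i).blocks < ρ then obsWeight h T τ x m k i else 0

/-- The sum of the observations of an edge in the first `ρ` exploration blocks. -/
noncomputable def obsSum (N ρ : ℕ) (m : Fin M) (k : Fin K) : ℕ :=
  ∑ i ∈ Finset.range N,
    if (stateAt h T τ x i).blocks < ρ then obsWeight h T τ x m k i * (x (τ + i) m k).toNat else 0

/-- The empirical mean of an edge after `ρ` exploration blocks. -/
noncomputable def obsMean (N ρ : ℕ) (m : Fin M) (k : Fin K) : ℝ :=
  (obsSum h T τ x N ρ m k : ℝ) / (obsCount h T τ x N ρ m k : ℝ)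

/-- The error of the empirical mean after `ρ` exploration blocks, multiplied by `√ρ`; it is `0` if
the blocks are not completed within `N` rounds. -/
noncomputable def scaledDev (μ : Fin M → Fin K → ℝ) (N ρ : ℕ) (m : Fin M) (k : Fin K) : ℝ :=
  if ρ ≤ (stateAt h T τ x N).blocks then √ρ * |obsMean h T τ x N ρ m k - μ m k| else 0

theorem scaledDev_nonneg (μ : Fin M → Fin K → ℝ) (N ρ : ℕ) (m : Fin M) (k : Fin K) :
    0 ≤ scaledDev h T τ x μ N ρ m k := by
  unfold scaledDev
  split_ifs <;> positivity

/-- Trades the random time `n` at which the statistics are read for the fixed horizon `N` with a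
cutoff on the block index. The cutoff is predictable, so the martingale argument applies to the
right-hand side. -/
theorem sum_range_eq_of_settled {m : Fin M} {k : Fin K} {n N ρ : ℕ} (hn : n ≤ N)
    (hset : Settled h T τ x m k n ρ) (hρ : ρ ≤ (stateAt h T τ x n).blocks) (f : ℕ → ℕ) :
    ∑ i ∈ Finset.range n, obsWeight h T τ x m k i * f i
      = ∑ i ∈ Finset.range N,
        if (stateAt h T τ x i).blocks < ρ then obsWeight h T τ x m k i * f i else 0 := by
  rw [← Finset.sum_subset (Finset.range_subset_range.mpr hn)]
  · refine Finset.sum_congr rfl fun i hi => ?_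
    rcases hset.1 i (Finset.mem_range.mp hi) with h0 | h0
    · simp [h0]
    · rw [if_pos h0]
  · intro i _ hi
    rw [if_neg]
    have := blocks_mono h T τ x (not_lt.mp fun hc => hi (Finset.mem_range.mpr hc))
    exact not_lt.mpr (hρ.trans this)

theorem empMean_stateAt {n N : ℕ} (hn : n ≤ N)
    (hp : ∀ j, (stateAt h T τ x n).phase ≠ .explore (j + 1)) (m : Fin M) (k : Fin K) :
    (stateAt h T τ x n).empMean m k = obsMean h T τ x N (stateAt h T τ x n).blocks m k := by
  have hset := settled_of_phase h T τ x m k hp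
  have h1 := sum_range_eq_of_settled h T τ x hn hset le_rfl fun i => (x (τ + i) m k).toNat
  have h2 := sum_range_eq_of_settled h T τ x hn hset le_rfl fun _ => 1
  simp only [mul_one] at h2
  rw [State.empMean, stateAt_sum, stateAt_count, h1, h2]
  rfl

theorem shared_of_epoch_eq_zero (n : ℕ) (h0 : (stateAt h T τ x n).epoch = 0) :
    (stateAt h T τ x n).shared = fun _ _ => 0 := by
  induction n with
  | zero => rfl
  | succ n ih =>
    cases transition_stateAt h T τ x n with
    | explore j hp hj hp' he hs => rw [hs, ih (by omega)]
    | beginComm j hp hj hp' hne he hs => rw [hs, ih (by omega)]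
    | comm q hp hp' hne he hs => rw [hs, ih (by omega)]
    | epoch hp he => omega
    | exploit hp hs => rw [hs] at h0 ⊢; exact ih h0

theorem shared_stateAt {n N : ℕ} (hn : n ≤ N) (h1 : 1 ≤ (stateAt h T τ x n).epoch) (m : Fin M)
    (k : Fin K) :
    (stateAt h T τ x n).shared m k = quantize (stateAt h T τ x n).epoch
      (obsMean h T τ x N (stateAt h T τ x n).epoch m k) := by
  induction n with
  | zero => exact absurd h1 (by simp [stateAt, State.init])
  | succ n ih =>
    cases transition_stateAt h T τ x n with
    | explore j hp hj hp' he hs => rw [hs, he, ih (by omega) (by omega)]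
    | beginComm j hp hj hp' hne he hs => rw [hs, he, ih (by omega) (by omega)]
    | comm q hp hp' hne he hs => rw [hs, he, ih (by omega) (by omega)]
    | epoch hp he hs ha hp' =>
      rw [hs, empMean_stateAt h T τ x hn, Transition.blocks_of_epoch hp', he]
      intro j hj
      split_ifs at hp'
      · rw [hp'] at hj; injection hj; omega
      · rw [hp'] at hj; nomatch hj
    | exploit hp hs => rw [hs] at h1 ⊢; exact ih (by omega) h1

variable {h T τ x} {μ : Fin M → Fin K → ℝ}

/-- The rounding step is at most 1/(2√ρ). Rounding is upwards, so the 1/2 occurs on one side only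
and, when two matchings are compared, once instead of twice per agent. -/
theorem quantize_obsMean_bounds {N ρ : ℕ} (hρ : 1 ≤ ρ) (hN : ρ ≤ (stateAt h T τ x N).blocks)
    (m : Fin M) (k : Fin K) :
    -scaledDev h T τ x μ N ρ m k ≤ √ρ * (quantize ρ (obsMean h T τ x N ρ m k) - μ m k) ∧
      √ρ * (quantize ρ (obsMean h T τ x N ρ m k) - μ m k)
        ≤ scaledDev h T τ x μ N ρ m k + 1 / 2 := by
  have hsq : 0 < √(ρ : ℝ) := Real.sqrt_pos.mpr (by exact_mod_cast hρ)
  rw [scaledDev, if_pos hN]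
  set y := obsMean h T τ x N ρ m k
  have h1 := le_quantize ρ y
  have h2 := quantize_le ρ y
  have h3 : √(ρ : ℝ) * (1 / 2 ^ precision ρ) ≤ 1 / 2 := by
    rw [mul_one_div, div_le_iff₀ (by positivity)]
    linarith [two_mul_sqrt_le_two_pow_precision hρ]
  constructor
  · rw [← mul_neg]
    refine mul_le_mul_of_nonneg_left ?_ hsq.le
    linarith [neg_abs_le (y - μ m k)]
  · calc √(ρ : ℝ) * (quantize ρ y - μ m k)
        ≤ √ρ * (|y - μ m k| + 1 / 2 ^ precision ρ) := by
          refine mul_le_mul_of_nonneg_left ?_ hsq.le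
          linarith [le_abs_self (y - μ m k)]
      _ ≤ √ρ * |y - μ m k| + 1 / 2 := by rw [mul_add]; linarith

theorem shared_bounds {n N : ℕ} (hn : n ≤ N) (h1 : 1 ≤ (stateAt h T τ x n).epoch) (m : Fin M)
    (k : Fin K) :
    -scaledDev h T τ x μ N (stateAt h T τ x n).epoch m k
        ≤ √(stateAt h T τ x n).epoch * ((stateAt h T τ x n).shared m k - μ m k) ∧
      √(stateAt h T τ x n).epoch * ((stateAt h T τ x n).shared m k - μ m k)
        ≤ scaledDev h T τ x μ N (stateAt h T τ x n).epoch m k + 1 / 2 := by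
  rw [shared_stateAt h T τ x hn h1]
  exact quantize_obsMean_bounds h1
    ((State.epoch_le_blocks _).trans (blocks_mono h T τ x hn)) m k

theorem nextShared_bounds {n N : ℕ} (hn : n ≤ N) {q : List (Transmission M)}
    (hp : (stateAt h T τ x n).phase = .communicate q) {ρ : ℕ}
    (hρ : (stateAt h T τ x n).epoch = ρ) (m : Fin M) (k : Fin K) :
    -scaledDev h T τ x μ N (ρ + 1) m k
        ≤ √(ρ + 1 : ℕ) * ((stateAt h T τ x n).nextShared m k - μ m k) ∧
      √(ρ + 1 : ℕ) * ((stateAt h T τ x n).nextShared m k - μ m k)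
        ≤ scaledDev h T τ x μ N (ρ + 1) m k + 1 / 2 := by
  have hb : (stateAt h T τ x n).blocks = ρ + 1 := by rw [State.blocks_of_communicate hp, hρ]
  rw [State.nextShared, empMean_stateAt h T τ x hn (fun j => by rw [hp]; nofun), hb, hρ]
  exact quantize_obsMean_bounds (Nat.le_add_left 1 ρ) (hb ▸ blocks_mono h T τ x hn) m k

/-- One unit is at least 1/(4√(ρ+1)), comparable with the errors of both statistics, so their
difference is O(1 + errors) units. The constant is 7 = 4(1/2 + 1) + 1, the last 1 coming from the
floor. -/
theorem abs_diffUnits_le (h0 : ∀ m k, 0 ≤ μ m k) (h1 : ∀ m k, μ m k ≤ 1) {n N : ℕ} (hn : n ≤ N)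
    {q : List (Transmission M)} (hp : (stateAt h T τ x n).phase = .communicate q) {ρ : ℕ}
    (hρ : (stateAt h T τ x n).epoch = ρ) (m : Fin M) (k : Fin K) :
    (((stateAt h T τ x n).diffUnits m k).natAbs : ℝ)
      ≤ 4 * scaledDev h T τ x μ N (ρ + 1) m k + 8 * scaledDev h T τ x μ N ρ m k + 7 := by
  have hb1 := nextShared_bounds (μ := μ) hn hp hρ m k
  have hA := scaledDev_nonneg h T τ x μ N ρ m k
  set s := stateAt h T τ x n
  set u := s.nextShared m k
  set v := s.shared m k
  have hsq : 0 ≤ √((ρ + 1 : ℕ) : ℝ) := Real.sqrt_nonneg _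
  have hv : |√((ρ + 1 : ℕ) : ℝ) * (v - μ m k)| ≤ 2 * scaledDev h T τ x μ N ρ m k + 1 := by
    -- In epoch 0 the old statistic is 0, at distance at most 1 from the mean. Later √(ρ+1) ≤ 2√ρ
    -- transfers the error bound of epoch ρ.
    rcases Nat.eq_zero_or_pos ρ with h00 | hpos
    · have : v = 0 := congrFun (congrFun (shared_of_epoch_eq_zero h T τ x n (hρ.trans h00)) m) k
      rw [h00, this]
      have := h0 m k
      have := h1 m k
      simp only [zero_add, Nat.cast_one, Real.sqrt_one, one_mul, zero_sub, abs_neg]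
      rw [abs_of_nonneg (h0 m k)]
      have := scaledDev_nonneg h T τ x μ N 0 m k
      linarith
    · have hb2 := shared_bounds (μ := μ) hn (hρ.symm ▸ hpos : 1 ≤ (stateAt h T τ x n).epoch) m k
      rw [hρ] at hb2
      have hle : √((ρ + 1 : ℕ) : ℝ) ≤ 2 * √(ρ : ℝ) := by
        rw [show (2 : ℝ) = √(4 : ℝ) by rw [show (4 : ℝ) = 2 ^ 2 by norm_num]; simp,
          ← Real.sqrt_mul (by norm_num)]
        refine Real.sqrt_le_sqrt ?_
        have : (1 : ℝ) ≤ ρ := by exact_mod_cast hpos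
        push_cast
        linarith
      have h3 : |√(ρ : ℝ) * (v - μ m k)| ≤ scaledDev h T τ x μ N ρ m k + 1 / 2 :=
        abs_le.mpr ⟨by linarith [hb2.1], hb2.2⟩
      rw [abs_mul, abs_of_nonneg (Real.sqrt_nonneg _)] at h3 ⊢
      nlinarith [abs_nonneg (v - μ m k)]
  have hu : |√((ρ + 1 : ℕ) : ℝ) * (u - μ m k)| ≤ scaledDev h T τ x μ N (ρ + 1) m k + 1 / 2 :=
    abs_le.mpr ⟨by linarith [hb1.1], hb1.2⟩
  have hprec := two_pow_precision_le (Nat.le_add_left 1 ρ)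
  have hy : |(u - v) * 2 ^ precision (ρ + 1)|
      ≤ 4 * (|√((ρ + 1 : ℕ) : ℝ) * (u - μ m k)| + |√((ρ + 1 : ℕ) : ℝ) * (v - μ m k)|) := by
    calc |(u - v) * 2 ^ precision (ρ + 1)| = |u - v| * 2 ^ precision (ρ + 1) := by
          rw [abs_mul, abs_of_nonneg (by positivity : (0 : ℝ) ≤ 2 ^ precision (ρ + 1))]
      _ ≤ |u - v| * (4 * √((ρ + 1 : ℕ) : ℝ)) := by gcongr
      _ = 4 * |√((ρ + 1 : ℕ) : ℝ) * (u - μ m k) - √((ρ + 1 : ℕ) : ℝ) * (v - μ m k)| := by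
          rw [← mul_sub, sub_sub_sub_cancel_right, abs_mul, abs_of_nonneg hsq]; ring
      _ ≤ _ := by gcongr; exact abs_sub _ _
  have := abs_floor_le ((u - v) * 2 ^ precision (ρ + 1))
  rw [State.diffUnits, hρ]
  linarith

theorem State.length_messages_le (s : State M K) :
    s.messages.length ≤ M * ∑ m, ∑ k, ((s.diffUnits m k).natAbs + 1) := by
  unfold State.messages
  rw [List.length_flatMap, ← Fin.sum_univ_def, Finset.sum_comm, Finset.mul_sum]
  refine Finset.sum_le_sum fun k _ => ?_
  rw [List.length_flatMap, ← Fin.sum_univ_def, Finset.mul_sum]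
  refine Finset.sum_le_sum fun m _ => ?_
  rw [List.length_flatMap]
  simp only [List.length_map, List.map_const', List.sum_replicate, smul_eq_mul]
  exact Nat.mul_le_mul ((List.length_filter_le _ _).trans (List.length_finRange).le)
    (length_bitString_le _)

/-- A bound for the number of rounds of the communication phase of an epoch. -/
noncomputable def commBound (h : M < K) (T τ : ℕ) (x : RewardTable M K) (μ : Fin M → Fin K → ℝ)
    (N ρ : ℕ) : ℝ :=
  M * ∑ m, ∑ k,
    (4 * scaledDev h T τ x μ N (ρ + 1) m k + 8 * scaledDev h T τ x μ N ρ m k + 8)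

theorem commBound_nonneg (μ : Fin M → Fin K → ℝ) (N ρ : ℕ) :
    0 ≤ commBound h T τ x μ N ρ := by
  refine mul_nonneg (Nat.cast_nonneg _) (Finset.sum_nonneg fun m _ => Finset.sum_nonneg
    fun k _ => ?_)
  have := scaledDev_nonneg h T τ x μ N ρ m k
  have := scaledDev_nonneg h T τ x μ N (ρ + 1) m k
  positivity

theorem length_messages_stateAt_le (h0 : ∀ m k, 0 ≤ μ m k) (h1 : ∀ m k, μ m k ≤ 1) {n N : ℕ}
    (hn : n ≤ N) {q : List (Transmission M)} (hp : (stateAt h T τ x n).phase = .communicate q) :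
    ((stateAt h T τ x n).messages.length : ℝ)
      ≤ commBound h T τ x μ N (stateAt h T τ x n).epoch := by
  refine (Nat.cast_le.mpr (State.length_messages_le _)).trans ?_
  push_cast
  refine mul_le_mul_of_nonneg_left (Finset.sum_le_sum fun m _ => Finset.sum_le_sum fun k _ => ?_)
    (Nat.cast_nonneg _)
  have := abs_diffUnits_le h0 h1 hn hp rfl m k
  linarith

end Statistics

/-! ### Grouping rounds by epoch -/

section Counting

theorem sum_if_le_sum_mul (N : ℕ) (p : ℕ → Prop) [DecidablePred p] (e : ℕ → ℕ)
    (he : ∀ n < N, p n → e n < N) (c : ℕ → ℝ)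
    (hc : ∀ ρ, ((((Finset.range N).filter fun i => p i ∧ e i = ρ).card : ℕ) : ℝ) ≤ c ρ)
    (g : ℕ → ℝ) (hg : ∀ ρ, 0 ≤ g ρ) :
    ∑ n ∈ Finset.range N, (if p n then g (e n) else 0) ≤ ∑ ρ ∈ Finset.range N, c ρ * g ρ := by
  rw [← Finset.sum_filter, ← Finset.sum_fiberwise_of_maps_to (t := Finset.range N) (g := e)]
  · refine Finset.sum_le_sum fun ρ _ => ?_
    rw [Finset.filter_filter]
    calc ∑ i ∈ Finset.range N with p i ∧ e i = ρ, g (e i)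
        = ∑ i ∈ Finset.range N with p i ∧ e i = ρ, g ρ :=
          Finset.sum_congr rfl fun i hi => by rw [(Finset.mem_filter.mp hi).2.2]
      _ ≤ c ρ * g ρ := by
          rw [Finset.sum_const, nsmul_eq_mul]
          exact mul_le_mul_of_nonneg_right (hc ρ) (hg ρ)
  · intro n hn
    obtain ⟨h1, h2⟩ := Finset.mem_filter.mp hn
    exact Finset.mem_range.mpr (he n (Finset.mem_range.mp h1) h2)

theorem card_filter_range_succ (p : ℕ → Prop) [DecidablePred p] (n : ℕ) :
    ((Finset.range (n + 1)).filter p).card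
      = ((Finset.range n).filter p).card + if p n then 1 else 0 := by
  rw [Finset.range_add_one, Finset.filter_insert]
  split_ifs
  · rw [Finset.card_insert_of_notMem (by simp)]
  · rfl

end Counting

/-! ### Lengths of phases and history of the active edges -/

section Phases

variable {M K : ℕ}

/-- The next round is an exploration round. -/
def State.IsExplore (s : State M K) : Prop := ∃ j, s.phase = .explore j

/-- The next round is a communication round. -/
def State.IsCommunicate (s : State M K) : Prop := ∃ q, s.phase = .communicate q

variable (h : M < K) (T τ : ℕ) (x : RewardTable M K)

open Classical in
theorem card_explore_le (n ρ : ℕ) :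
    ((Finset.range n).filter fun i => (stateAt h T τ x i).IsExplore ∧
      (stateAt h T τ x i).epoch = ρ).card ≤ K := by
  let c : ℕ → ℕ → ℕ := fun n ρ => ((Finset.range n).filter fun i =>
    (stateAt h T τ x i).IsExplore ∧ (stateAt h T τ x i).epoch = ρ).card
  have hc : ∀ n ρ, c (n + 1) ρ = c n ρ + if (stateAt h T τ x n).IsExplore ∧
      (stateAt h T τ x n).epoch = ρ then 1 else 0 := fun n ρ => card_filter_range_succ _ n
  -- The induction also needs that future epochs have count 0 and that the counter `j` of the phase
  -- bounds the current count.
  suffices H : (∀ ρ, c n ρ ≤ K) ∧ (∀ ρ, (stateAt h T τ x n).epoch < ρ → c n ρ = 0) ∧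
      ∀ j, (stateAt h T τ x n).phase = .explore j →
        j < K ∧ c n (stateAt h T τ x n).epoch ≤ j from H.1 ρ
  induction n with
  | zero =>
    refine ⟨fun ρ => Nat.zero_le _, fun ρ _ => rfl, fun j hj => ?_⟩
    obtain rfl : 0 = j := by injection hj
    exact ⟨Nat.zero_lt_of_lt h, le_rfl⟩
  | succ n ih =>
    obtain ⟨ih1, ih2, ih3⟩ := ih
    have hmono : (stateAt h T τ x n).epoch ≤ (stateAt h T τ x (n + 1)).epoch :=
      epoch_mono h T τ x (Nat.le_succ n)
    have hK : ∀ ρ, c (n + 1) ρ ≤ K := by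
      intro ρ
      rw [hc]
      split_ifs with hif
      · obtain ⟨⟨j, hj⟩, rfl⟩ := hif
        obtain ⟨h1, h2⟩ := ih3 j hj
        omega
      · exact ih1 ρ
    have h0 : ∀ ρ, (stateAt h T τ x n).epoch < ρ → c (n + 1) ρ = 0 := by
      intro ρ hρ
      rw [hc, ih2 ρ hρ, if_neg (by omega)]
    refine ⟨hK, fun ρ hρ => h0 ρ (by omega), fun j hj => ?_⟩
    cases transition_stateAt h T τ x n with
    | explore j' hp hj' hp' he hs ha =>
      obtain rfl : j' + 1 = j := by rw [hp'] at hj; injection hj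
      refine ⟨hj', ?_⟩
      rw [hc, he, if_pos ⟨⟨j', hp⟩, rfl⟩]
      have := (ih3 j' hp).2
      omega
    | beginComm j' hp hj' hp' => rw [hp'] at hj; nomatch hj
    | comm q hp hp' => rw [hp'] at hj; nomatch hj
    | epoch hp he hs ha hp' =>
      split_ifs at hp'
      · obtain rfl : 0 = j := by rw [hp'] at hj; injection hj
        exact ⟨Nat.zero_lt_of_lt h, (h0 _ (by omega)).le⟩
      · rw [hp'] at hj; nomatch hj
    | exploit hp hs => rw [hs, hp] at hj; nomatch hj

open Classical in
theorem card_communicate_le (N : ℕ) (c : ℕ → ℝ) (hc0 : ∀ ρ, 0 ≤ c ρ)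
    (hc : ∀ n < N, (stateAt h T τ x n).IsCommunicate →
      ((stateAt h T τ x n).messages.length : ℝ) ≤ c (stateAt h T τ x n).epoch) (ρ : ℕ) :
    ((((Finset.range N).filter fun i => (stateAt h T τ x i).IsCommunicate ∧
      (stateAt h T τ x i).epoch = ρ).card : ℕ) : ℝ) ≤ c ρ := by
  let d : ℕ → ℕ → ℕ := fun n ρ => ((Finset.range n).filter fun i =>
    (stateAt h T τ x i).IsCommunicate ∧ (stateAt h T τ x i).epoch = ρ).card
  have hd : ∀ n ρ, d (n + 1) ρ = d n ρ + if (stateAt h T τ x n).IsCommunicate ∧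
      (stateAt h T τ x n).epoch = ρ then 1 else 0 := fun n ρ => card_filter_range_succ _ n
  -- Invariant: rounds already spent plus transmissions still queued equal the length of the message
  -- list, which does not change during the phase.
  suffices H : ∀ n ≤ N, (∀ ρ, (d n ρ : ℝ) ≤ c ρ) ∧
      (∀ ρ, (stateAt h T τ x n).blocks ≤ ρ → d n ρ = 0) ∧
      ∀ q, (stateAt h T τ x n).phase = .communicate q → q ≠ [] ∧
        d n (stateAt h T τ x n).epoch + q.length = (stateAt h T τ x n).messages.length from
    (H N le_rfl).1 ρ
  intro n
  induction n with
  | zero =>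
    exact fun _ => ⟨fun ρ => by simpa [d] using hc0 ρ, fun ρ _ => rfl, fun q hq => nomatch hq⟩
  | succ n ih =>
    intro hn
    obtain ⟨ih1, ih2, ih3⟩ := ih (by omega)
    have hmono : (stateAt h T τ x n).blocks ≤ (stateAt h T τ x (n + 1)).blocks :=
      blocks_mono h T τ x (Nat.le_succ n)
    have hle : ∀ ρ, (d (n + 1) ρ : ℝ) ≤ c ρ := by
      intro ρ
      rw [hd]
      split_ifs with hif
      · obtain ⟨⟨q, hq⟩, rfl⟩ := hif
        obtain ⟨h1, h2⟩ := ih3 q hq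
        refine le_trans ?_ (hc n (by omega) ⟨q, hq⟩)
        rw [← h2]
        have := List.length_pos_iff.mpr h1
        exact_mod_cast Nat.add_le_add_left this _
      · exact ih1 ρ
    have h0 : ∀ ρ, (stateAt h T τ x n).blocks ≤ ρ → d (n + 1) ρ = 0 := by
      intro ρ hρ
      rw [hd, ih2 ρ hρ, if_neg]
      rintro ⟨⟨q, hq⟩, he⟩
      rw [State.blocks_of_communicate hq] at hρ
      omega
    refine ⟨hle, fun ρ hρ => h0 ρ (by omega), fun q hq => ?_⟩
    cases transition_stateAt h T τ x n with
    | explore j' hp hj' hp' he hs ha => rw [hp'] at hq; nomatch hq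
    | beginComm j' hp hj' hp' hne he =>
      obtain rfl : (stateAt h T τ x (n + 1)).messages = q := by rw [hp'] at hq; injection hq
      refine ⟨hne, ?_⟩
      rw [he, h0 _ (State.blocks_of_explore hp).le, zero_add]
    | comm q' hp hp' hne he hs ha hm =>
      obtain rfl : q'.tail = q := by rw [hp'] at hq; injection hq
      refine ⟨hne, ?_⟩
      obtain ⟨h1, h2⟩ := ih3 q' hp
      have := List.length_pos_iff.mpr h1
      rw [hm, ← h2, hd, he, if_pos ⟨⟨q', hp⟩, rfl⟩, List.length_tail]
      omega
    | epoch hp he hs ha hp' =>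
      split_ifs at hp' <;> (rw [hp'] at hq; nomatch hq)
    | exploit hp hs => rw [hs, hp] at hq; nomatch hq

open Classical in
theorem sum_explore_le (N : ℕ) (g : ℕ → ℝ) (hg : ∀ ρ, 0 ≤ g ρ) :
    ∑ n ∈ Finset.range N,
        (if (stateAt h T τ x n).IsExplore then g (stateAt h T τ x n).epoch else 0)
      ≤ ∑ ρ ∈ Finset.range N, K * g ρ :=
  sum_if_le_sum_mul N (fun n => (stateAt h T τ x n).IsExplore) (fun n => (stateAt h T τ x n).epoch)
    (fun n hn _ => ((State.epoch_le_blocks _).trans (blocks_le h T τ x n)).trans_lt hn)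
    (fun _ => K) (fun ρ => Nat.cast_le.mpr (card_explore_le h T τ x N ρ)) g hg

open Classical in
theorem sum_communicate_le {μ : Fin M → Fin K → ℝ} (h0 : ∀ m k, 0 ≤ μ m k)
    (h1 : ∀ m k, μ m k ≤ 1) (N : ℕ) (g : ℕ → ℝ) (hg : ∀ ρ, 0 ≤ g ρ) :
    ∑ n ∈ Finset.range N,
        (if (stateAt h T τ x n).IsCommunicate then g (stateAt h T τ x n).epoch else 0)
      ≤ ∑ ρ ∈ Finset.range N, commBound h T τ x μ N ρ * g ρ :=
  sum_if_le_sum_mul N (fun n => (stateAt h T τ x n).IsCommunicate)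
    (fun n => (stateAt h T τ x n).epoch)
    (fun n hn _ => ((State.epoch_le_blocks _).trans (blocks_le h T τ x n)).trans_lt hn)
    (fun ρ => commBound h T τ x μ N ρ)
    (fun ρ => card_communicate_le h T τ x N _ (fun ρ => commBound_nonneg μ N ρ)
      (fun _ hn ⟨_, hq⟩ => length_messages_stateAt_le h0 h1 hn.le hq) ρ) g hg

/-- The elimination test of the edge `e`. -/
def State.Passes (s : State M K) (e : Fin M × Fin K) : Prop :=
  utility (s.matching h) s.shared - utility (bestMatchingThrough h s.shared e.1 e.2) s.shared
    ≤ 4 * (M : ℝ) * epsParam M T s.epoch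

/-- Turns the active set into a history of tests: a surviving edge passed in every finished epoch, a
missing edge failed in one of them. Epoch 0 is left out because its test is vacuous. -/
theorem active_structure (hM : 1 ≤ M) (n : ℕ) :
    (∀ e ∈ (stateAt h T τ x n).active, ∀ ρ, 1 ≤ ρ → ρ < (stateAt h T τ x n).epoch →
      ∃ i < n, (stateAt h T τ x i).epoch = ρ ∧ (stateAt h T τ x i).Passes h T e) ∧
    (∀ e ∉ (stateAt h T τ x n).active, ∃ i < n, 1 ≤ (stateAt h T τ x i).epoch ∧
      (stateAt h T τ x i).epoch < (stateAt h T τ x n).epoch ∧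
      ¬ (stateAt h T τ x i).Passes h T e) ∧
    ((stateAt h T τ x n).phase ≠ .exploit → M < (stateAt h T τ x n).active.card) ∧
    ((stateAt h T τ x n).phase = .exploit →
      (stateAt h T τ x n).active.card ≤ M ∧ 1 ≤ (stateAt h T τ x n).epoch) := by
  induction n with
  | zero =>
    refine ⟨fun e _ ρ _ hρ => absurd hρ (Nat.not_lt_zero _),
      fun e he => absurd (Finset.mem_univ e) he, fun _ => ?_, fun hc => nomatch hc⟩
    simp only [stateAt, State.init, Finset.card_univ, Fintype.card_prod, Fintype.card_fin]
    nlinarith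
  | succ n ih =>
    have hkeep : (stateAt h T τ x (n + 1)).epoch = (stateAt h T τ x n).epoch →
        (stateAt h T τ x (n + 1)).active = (stateAt h T τ x n).active →
        ((stateAt h T τ x n).phase ≠ .exploit) → ((stateAt h T τ x (n + 1)).phase ≠ .exploit) →
        (∀ e ∈ (stateAt h T τ x (n + 1)).active, ∀ ρ, 1 ≤ ρ →
          ρ < (stateAt h T τ x (n + 1)).epoch →
          ∃ i < n + 1, (stateAt h T τ x i).epoch = ρ ∧ (stateAt h T τ x i).Passes h T e) ∧
        (∀ e ∉ (stateAt h T τ x (n + 1)).active, ∃ i < n + 1, 1 ≤ (stateAt h T τ x i).epoch ∧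
          (stateAt h T τ x i).epoch < (stateAt h T τ x (n + 1)).epoch ∧
          ¬ (stateAt h T τ x i).Passes h T e) ∧
        ((stateAt h T τ x (n + 1)).phase ≠ .exploit →
          M < (stateAt h T τ x (n + 1)).active.card) ∧
        ((stateAt h T τ x (n + 1)).phase = .exploit →
          (stateAt h T τ x (n + 1)).active.card ≤ M ∧
            1 ≤ (stateAt h T τ x (n + 1)).epoch) := by
      intro he ha hp hp'
      refine ⟨?_, ?_, fun _ => ha ▸ ih.2.2.1 hp, fun hc => absurd hc hp'⟩
      · rw [ha, he]
        intro e hea ρ h1 hρ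
        obtain ⟨i, hi, hh⟩ := ih.1 e hea ρ h1 hρ
        exact ⟨i, by omega, hh⟩
      · rw [ha, he]
        intro e hea
        obtain ⟨i, hi, hh⟩ := ih.2.1 e hea
        exact ⟨i, by omega, hh⟩
    cases transition_stateAt h T τ x n with
    | explore j' hp hj' hp' he hs ha =>
      exact hkeep he ha (by rw [hp]; nofun) (by rw [hp']; nofun)
    | beginComm j' hp hj' hp' hne he hs ha =>
      exact hkeep he ha (by rw [hp]; nofun) (by rw [hp']; nofun)
    | comm q' hp hp' hne he hs ha hm =>
      exact hkeep he ha (by rw [hp]; nofun) (by rw [hp']; nofun)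
    | epoch hp he hs ha hp' =>
      have hmem : ∀ e, e ∈ (stateAt h T τ x (n + 1)).active ↔ e ∈ (stateAt h T τ x n).active ∧
          ((stateAt h T τ x n).epoch = 0 ∨ (stateAt h T τ x n).Passes h T e) := by
        intro e
        rw [ha, State.nextActive, Finset.mem_filter]
        rfl
      refine ⟨fun e hea ρ h1 hρ => ?_, fun e hea => ?_, fun hne => ?_, fun hex => ?_⟩
      · obtain ⟨h2, h3⟩ := (hmem e).mp hea
        rcases Nat.lt_succ_iff_lt_or_eq.mp (he ▸ hρ) with hlt | rfl
        · obtain ⟨i, hi, hh⟩ := ih.1 e h2 ρ h1 hlt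
          exact ⟨i, by omega, hh⟩
        · exact ⟨n, n.lt_succ_self, rfl, h3.resolve_left (by omega)⟩
      · by_cases hea' : e ∈ (stateAt h T τ x n).active
        · have hno : ¬ ((stateAt h T τ x n).epoch = 0 ∨ (stateAt h T τ x n).Passes h T e) :=
            fun hc => hea ((hmem e).mpr ⟨hea', hc⟩)
          rw [not_or] at hno
          exact ⟨n, n.lt_succ_self, Nat.one_le_iff_ne_zero.mpr hno.1, by omega, hno.2⟩
        · obtain ⟨i, hi, h1, h2, h3⟩ := ih.2.1 e hea'
          exact ⟨i, by omega, h1, by omega, h3⟩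
      · split_ifs at hp' with hif
        · exact hif
        · exact absurd hp' hne
      · split_ifs at hp' with hif
        · rw [hp'] at hex; nomatch hex
        · exact ⟨not_lt.mp hif, by omega⟩
    | exploit hp hs =>
      rw [hs]
      refine ⟨fun e hea ρ h1 hρ => ?_, fun e hea => ?_, ih.2.2.1, ih.2.2.2⟩
      · obtain ⟨i, hi, hh⟩ := ih.1 e hea ρ h1 hρ
        exact ⟨i, by omega, hh⟩
      · obtain ⟨i, hi, hh⟩ := ih.2.1 e hea
        exact ⟨i, by omega, hh⟩

end Phases

/-! ### Dependence on finitely many rounds, and the exponential process -/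

section Locality

open MeasureTheory ProbabilityTheory

variable {M K : ℕ}

theorem agree_of_le {x y : RewardTable M K} {a b : ℕ} (hab : a ≤ b)
    (hxy : ∀ i ∈ Set.Iio b, x i = y i) : ∀ i ∈ Set.Iio a, x i = y i :=
  fun i hi => hxy i (lt_of_lt_of_le hi hab)

theorem stateAt_dependsOn (h : M < K) (T τ n : ℕ) :
    DependsOn (fun x : RewardTable M K => stateAt h T τ x n) (Set.Iio (τ + n)) := by
  induction n with
  | zero => exact fun x y _ => rfl
  | succ n ih =>
    intro x y hxy
    have h1 := ih (agree_of_le (Nat.le_succ _) hxy)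
    have h2 := hxy (τ + n) (by simp)
    simp only at h1
    simp only [stateAt, h1, h2]

/-- A function of finitely many rounds factors through a finite discrete space, so measurability,
boundedness and integrability come for free. -/
theorem exists_eq_restrict {β : Type*} {f : RewardTable M K → β} {n : ℕ}
    (hf : DependsOn f (Set.Iio n)) :
    ∃ g : (Finset.range n → Fin M → Fin K → Bool) → β, ∀ x, f x = g fun i => x i := by
  refine ⟨fun y => f fun i => if hi : i ∈ Finset.range n then y ⟨i, hi⟩ else fun _ _ => false,
    fun x => hf fun i hi => ?_⟩
  rw [dif_pos (Finset.mem_range.mpr hi)]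

variable {Ω : Type*} [MeasurableSpace Ω] {P : Measure Ω} {X : Ω → RewardTable M K}

theorem measurable_round (hX : ∀ t m k, Measurable fun ω => X ω t m k) (t : ℕ) :
    Measurable fun ω => X ω t :=
  measurable_pi_lambda _ fun m => measurable_pi_lambda _ fun k => hX t m k

theorem measurable_rounds (hX : ∀ t m k, Measurable fun ω => X ω t m k) (n : ℕ) :
    Measurable fun ω (i : Finset.range n) => X ω i :=
  measurable_pi_lambda _ fun i => measurable_round hX i

theorem measurable_of_dependsOn {β : Type*} [MeasurableSpace β]
    (hX : ∀ t m k, Measurable fun ω => X ω t m k) {f : RewardTable M K → β} {n : ℕ}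
    (hf : DependsOn f (Set.Iio n)) : Measurable fun ω => f (X ω) := by
  obtain ⟨g, hg⟩ := exists_eq_restrict hf
  simp only [hg]
  exact (Measurable.of_discrete (f := g)).comp (measurable_rounds hX n)

theorem exists_bound_of_dependsOn {f : RewardTable M K → ℝ} {n : ℕ}
    (hf : DependsOn f (Set.Iio n)) : ∃ B : ℕ, ∀ x, |f x| ≤ B := by
  obtain ⟨g, hg⟩ := exists_eq_restrict hf
  obtain ⟨B, hB⟩ := (Set.finite_range fun y => |g y|).bddAbove
  refine ⟨⌈B⌉₊, fun x => ?_⟩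
  rw [hg]
  exact (hB ⟨_, rfl⟩).trans (Nat.le_ceil B)

theorem integrable_of_dependsOn [IsProbabilityMeasure P]
    (hX : ∀ t m k, Measurable fun ω => X ω t m k) {f : RewardTable M K → ℝ} {n : ℕ}
    (hf : DependsOn f (Set.Iio n)) : Integrable (fun ω => f (X ω)) P := by
  obtain ⟨B, hB⟩ := exists_bound_of_dependsOn hf
  exact Integrable.of_bound (measurable_of_dependsOn hX hf).aestronglyMeasurable B
    (.of_forall fun ω => hB (X ω))

theorem integral_mul_of_dependsOn [IsProbabilityMeasure P]
    (hX : ∀ t m k, Measurable fun ω => X ω t m k)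
    (hind : iIndepFun (fun (t : ℕ) (ω : Ω) => X ω t) P) {f : RewardTable M K → ℝ} {n : ℕ}
    (hf : DependsOn f (Set.Iio n)) (g : (Fin M → Fin K → Bool) → ℝ) :
    ∫ ω, f (X ω) * g (X ω n) ∂P = (∫ ω, f (X ω) ∂P) * ∫ ω, g (X ω n) ∂P := by
  obtain ⟨f', hf'⟩ := exists_eq_restrict hf
  have h1 := hind.indepFun_finset (Finset.range n) {n} (by simp) (measurable_round hX)
  have h2 := h1.comp (φ := f') (ψ := fun y => g (y ⟨n, Finset.mem_singleton_self n⟩))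
    Measurable.of_discrete (Measurable.of_discrete)
  have h3 := h2.integral_fun_mul_eq_mul_integral
    ((Measurable.of_discrete (f := f')).comp (measurable_rounds hX n)).aestronglyMeasurable
    ((Measurable.of_discrete (f := g)).comp (measurable_round hX n)).aestronglyMeasurable
  simp only [hf']
  exact h3

/-- Hoeffding's lemma for a variable with values in [0, 1]. -/
theorem integral_exp_bernoulli_le [IsProbabilityMeasure P] {b : Ω → Bool} (hb : Measurable b)
    (s : ℝ) :
    ∫ ω, Real.exp (s * (((b ω).toNat : ℝ) - P.real {ω | b ω = true})) ∂P
      ≤ Real.exp (s ^ 2 / 8) := by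
  have hm : Measurable fun ω => ((b ω).toNat : ℝ) :=
    (Measurable.of_discrete (f := fun c : Bool => ((c.toNat : ℕ) : ℝ))).comp hb
  have hsub := hasSubgaussianMGF_of_mem_Icc (μ := P) (X := fun ω => ((b ω).toNat : ℝ)) (a := 0)
    (b := 1) hm.aemeasurable (.of_forall fun ω => by cases b ω <;> simp)
  have hmean : ∫ ω, ((b ω).toNat : ℝ) ∂P = P.real {ω | b ω = true} := by
    rw [← integral_indicator_one (s := {ω | b ω = true}) (hb (measurableSet_singleton true))]
    refine integral_congr_ae (.of_forall fun ω => ?_)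
    by_cases hc : b ω = true
    · simp [hc, Set.indicator]
    · simp [hc, Set.indicator]
  rw [hmean] at hsub
  refine (hsub.mgf_le s).trans (le_of_eq ?_)
  congr 1
  simp
  ring

/-- The exponential process of a sum of observations with predictable multiplicities. -/
theorem integral_exp_process_le [IsProbabilityMeasure P]
    (hX : ∀ t m k, Measurable fun ω => X ω t m k)
    (hind : iIndepFun (fun (t : ℕ) (ω : Ω) => X ω t) P) {μ : Fin M → Fin K → ℝ}
    (hμ : ∀ t m k, P.real {ω | X ω t m k = true} = μ m k) (τ : ℕ)
    (w : ℕ → RewardTable M K → ℕ) (hw : ∀ i, DependsOn (w i) (Set.Iio (τ + i)))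
    (hw2 : ∀ i x, w i x ≤ 2) (m : Fin M) (k : Fin K) (s : ℝ) (N : ℕ) :
    ∫ ω, Real.exp (∑ i ∈ Finset.range N, (s * (w i (X ω)) * ((X ω (τ + i) m k).toNat - μ m k)
      - (s * (w i (X ω))) ^ 2 / 8)) ∂P ≤ 1 := by
  induction N with
  | zero => simp
  | succ N ih =>
    set F : RewardTable M K → ℝ := fun x => Real.exp (∑ i ∈ Finset.range N,
      (s * (w i x) * ((x (τ + i) m k).toNat - μ m k) - (s * (w i x)) ^ 2 / 8)) with hF
    have hFd : DependsOn F (Set.Iio (τ + N)) := by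
      intro x y hxy
      refine congrArg Real.exp (Finset.sum_congr rfl fun i hi => ?_)
      have hi := Finset.mem_range.mp hi
      rw [hw i (agree_of_le (by omega) hxy), hxy (τ + i) (by simpa using hi)]
    -- The weight of the new round is determined by the past. Splitting by its value v in {0, 1, 2}
    -- leaves products of a function of the past with a function of the new, independent round.
    let f : ℕ → RewardTable M K → ℝ := fun v x => if w N x = v then F x else 0
    have hfd : ∀ v, DependsOn (f v) (Set.Iio (τ + N)) := fun v x y hxy => by
      simp only [f, hw N hxy, hFd hxy]
    let g : ℕ → (Fin M → Fin K → Bool) → ℝ := fun v y =>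
      Real.exp (s * v * ((y m k).toNat - μ m k) - (s * v) ^ 2 / 8)
    have hg : ∀ v, ∫ ω, g v (X ω (τ + N)) ∂P ≤ 1 := by
      intro v
      simp only [g, Real.exp_sub]
      rw [integral_div, div_le_one (Real.exp_pos _)]
      have := integral_exp_bernoulli_le (P := P) (hX (τ + N) m k) (s * v)
      rwa [hμ] at this
    have hsplit : ∀ ω, Real.exp (∑ i ∈ Finset.range (N + 1), (s * (w i (X ω))
        * ((X ω (τ + i) m k).toNat - μ m k) - (s * (w i (X ω))) ^ 2 / 8))
        = ∑ v ∈ Finset.range 3, f v (X ω) * g v (X ω (τ + N)) := by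
      intro ω
      rw [Finset.sum_range_succ, Real.exp_add, Finset.sum_eq_single (s := Finset.range 3) (w N (X ω))]
      · simp [f, g, hF]
      · intro v _ hv
        simp [f, hv.symm]
      · intro hc
        exact absurd (Finset.mem_range.mpr (Nat.lt_succ_of_le (hw2 N (X ω)))) hc
    have hsum : ∀ ω, F (X ω) = ∑ v ∈ Finset.range 3, f v (X ω) := by
      intro ω
      rw [Finset.sum_eq_single (s := Finset.range 3) (w N (X ω))]
      · simp [f]
      · intro v _ hv
        simp [f, hv.symm]
      · intro hc
        exact absurd (Finset.mem_range.mpr (Nat.lt_succ_of_le (hw2 N (X ω)))) hc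
    have hgd : ∀ v, DependsOn (fun x : RewardTable M K => f v x * g v (x (τ + N)))
        (Set.Iio (τ + N + 1)) := fun v x y hxy => by
      simp only
      rw [hfd v (agree_of_le (Nat.le_succ _) hxy), hxy (τ + N) (by simp)]
    simp only [hsplit]
    rw [integral_finsetSum _ fun v _ => integrable_of_dependsOn hX (hgd v)]
    refine le_trans ?_ ih
    change _ ≤ ∫ ω, F (X ω) ∂P
    simp only [hsum]
    rw [integral_finsetSum _ fun v _ => integrable_of_dependsOn hX (hfd v)]
    refine Finset.sum_le_sum fun v _ => ?_
    rw [integral_mul_of_dependsOn hX hind (hfd v) (g v)]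
    have hnn : 0 ≤ ∫ ω, f v (X ω) ∂P := integral_nonneg fun ω => by
      simp only [f, hF]; split_ifs <;> positivity
    exact mul_le_of_le_one_right hnn (hg v)

end Locality

/-! ### Subgaussian tails of the scaled errors -/

section Tails

open MeasureTheory ProbabilityTheory

variable {M K : ℕ} (h : M < K) (T τ : ℕ)

theorem obsWeight_dependsOn (m : Fin M) (k : Fin K) (i : ℕ) :
    DependsOn (fun x : RewardTable M K => obsWeight h T τ x m k i) (Set.Iio (τ + i)) :=
  fun x y hxy => by
    have := stateAt_dependsOn h T τ i hxy
    simp only at this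
    simp only [obsWeight, this]

theorem scaledDev_dependsOn (μ : Fin M → Fin K → ℝ) (N ρ : ℕ) (m : Fin M) (k : Fin K) :
    DependsOn (fun x : RewardTable M K => scaledDev h T τ x μ N ρ m k) (Set.Iio (τ + N)) := by
  intro x y hxy
  have h0 := stateAt_dependsOn h T τ N hxy
  have hx : ∀ i ∈ Finset.range N, ∀ t < τ + i, x t = y t := fun i hi t ht =>
    hxy t (ht.trans (by simpa using hi))
  have h1 : ∀ i ∈ Finset.range N, stateAt h T τ x i = stateAt h T τ y i := fun i hi =>
    stateAt_dependsOn h T τ i (hx i hi)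
  have h2 : ∀ i ∈ Finset.range N, obsWeight h T τ x m k i = obsWeight h T τ y m k i :=
    fun i hi => obsWeight_dependsOn h T τ m k i (hx i hi)
  have hc : obsCount h T τ x N ρ m k = obsCount h T τ y N ρ m k :=
    Finset.sum_congr rfl fun i hi => by rw [h1 i hi, h2 i hi]
  have hs : obsSum h T τ x N ρ m k = obsSum h T τ y N ρ m k :=
    Finset.sum_congr rfl fun i hi => by
      rw [h1 i hi, h2 i hi, hxy (τ + i) (by simpa using hi)]
  simp only at h0
  simp only [scaledDev, obsMean, hc, hs, h0]

theorem obsWeight_le_two (x : RewardTable M K) (m : Fin M) (k : Fin K) (i : ℕ) :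
    obsWeight h T τ x m k i ≤ 2 := by
  unfold obsWeight State.weight
  split
  · split_ifs <;> simp
  · simp

/-- The number of observations of an edge in round `τ + i`, if that round belongs to the first `ρ`
exploration blocks. -/
noncomputable def blockWeight (ρ : ℕ) (m : Fin M) (k : Fin K) (i : ℕ) (x : RewardTable M K) : ℕ :=
  if (stateAt h T τ x i).blocks < ρ then obsWeight h T τ x m k i else 0

/-- Up to the first time at which ρ blocks are complete, the cutoff on the block index is not
active, and each block supplies a round of weight 1. -/
theorem le_card_blockWeight_eq_one (x : RewardTable M K) {N ρ : ℕ}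
    (hρ : ρ ≤ (stateAt h T τ x N).blocks) (m : Fin M) (k : Fin K) :
    ρ ≤ ((Finset.range N).filter fun i => blockWeight h T τ ρ m k i x = 1).card := by
  classical
  have hex : ∃ n, ρ ≤ (stateAt h T τ x n).blocks := ⟨N, hρ⟩
  refine (Nat.find_spec hex).trans ((blocks_le_singles h T τ x m k _).trans
    (Finset.card_le_card fun i hi => ?_))
  obtain ⟨h1, h2⟩ := Finset.mem_filter.mp hi
  have h1 := Finset.mem_range.mp h1
  refine Finset.mem_filter.mpr
    ⟨Finset.mem_range.mpr (h1.trans_le (Nat.find_min' hex hρ)), ?_⟩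
  rw [blockWeight, if_pos (not_le.mp (Nat.find_min hex h1)), h2]

theorem sum_sq_blockWeight_le (x : RewardTable M K) {N ρ : ℕ}
    (hρ : ρ ≤ (stateAt h T τ x N).blocks) (m : Fin M) (k : Fin K) :
    ∑ i ∈ Finset.range N, (blockWeight h T τ ρ m k i x : ℝ) ^ 2
      ≤ 2 * (obsCount h T τ x N ρ m k : ℝ) - ρ := by
  -- For b in {0, 1, 2} one has b² = 2b, except that b = 1 saves 1; the savings add up to at least
  -- ρ.
  have h1 : ∀ i, (blockWeight h T τ ρ m k i x) ^ 2
      + (if blockWeight h T τ ρ m k i x = 1 then 1 else 0) = 2 * blockWeight h T τ ρ m k i x := by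
    intro i
    have : blockWeight h T τ ρ m k i x ≤ 2 := by
      unfold blockWeight
      split_ifs
      · exact obsWeight_le_two h T τ x m k i
      · simp
    generalize blockWeight h T τ ρ m k i x = b at this ⊢
    interval_cases b <;> rfl
  have h2 : ∑ i ∈ Finset.range N, (blockWeight h T τ ρ m k i x) ^ 2
      + ((Finset.range N).filter fun i => blockWeight h T τ ρ m k i x = 1).card
      = 2 * obsCount h T τ x N ρ m k := by
    rw [Finset.card_filter, ← Finset.sum_add_distrib, obsCount, Finset.mul_sum]
    exact Finset.sum_congr rfl fun i _ => h1 i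
  have h3 := le_card_blockWeight_eq_one h T τ x hρ m k
  have h4 : ∑ i ∈ Finset.range N, (blockWeight h T τ ρ m k i x) ^ 2 + ρ
      ≤ 2 * obsCount h T τ x N ρ m k := by omega
  have h5 : (∑ i ∈ Finset.range N, (blockWeight h T τ ρ m k i x : ℝ) ^ 2) + ρ
      ≤ 2 * (obsCount h T τ x N ρ m k : ℝ) := by exact_mod_cast h4
  linarith

/-- With n observations the sum deviates by at least yn, and ∑ w² ≤ 2n - ρ, so the parameter 4y
gives 4y²n - 2y²(2n - ρ) = 2ρy². As n cancels, no union over its possible values is needed. The sign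
σ covers both tails. -/
theorem exponent_bound (x : RewardTable M K) (μ : Fin M → Fin K → ℝ) {N ρ : ℕ} (hρ1 : 1 ≤ ρ)
    (hρ : ρ ≤ (stateAt h T τ x N).blocks) (m : Fin M) (k : Fin K) {y σ : ℝ} (hy : 0 ≤ y)
    (hσ : σ ^ 2 = 1) (hdev : y ≤ σ * (obsMean h T τ x N ρ m k - μ m k)) :
    2 * ρ * y ^ 2 ≤ ∑ i ∈ Finset.range N, (4 * y * σ * (blockWeight h T τ ρ m k i x)
      * ((x (τ + i) m k).toNat - μ m k) - (4 * y * σ * (blockWeight h T τ ρ m k i x)) ^ 2 / 8) := by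
  have hq := sum_sq_blockWeight_le h T τ x hρ m k
  have hn : (ρ : ℝ) ≤ 2 * obsCount h T τ x N ρ m k := by
    have : 0 ≤ ∑ i ∈ Finset.range N, (blockWeight h T τ ρ m k i x : ℝ) ^ 2 :=
      Finset.sum_nonneg fun i _ => sq_nonneg _
    linarith
  have hρ' : (1 : ℝ) ≤ ρ := by exact_mod_cast hρ1
  have hn0 : (0 : ℝ) < obsCount h T τ x N ρ m k := by linarith
  have hS : (obsSum h T τ x N ρ m k : ℝ)
      = ∑ i ∈ Finset.range N, (blockWeight h T τ ρ m k i x : ℝ) * (x (τ + i) m k).toNat := by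
    rw [obsSum, Nat.cast_sum]
    refine Finset.sum_congr rfl fun i _ => ?_
    unfold blockWeight
    split_ifs <;> simp
  have hC : (obsCount h T τ x N ρ m k : ℝ)
      = ∑ i ∈ Finset.range N, (blockWeight h T τ ρ m k i x : ℝ) := by
    rw [obsCount, Nat.cast_sum]
    rfl
  have hid : ∑ i ∈ Finset.range N, (4 * y * σ * (blockWeight h T τ ρ m k i x)
      * ((x (τ + i) m k).toNat - μ m k) - (4 * y * σ * (blockWeight h T τ ρ m k i x)) ^ 2 / 8)
      = 4 * y * (σ * (obsSum h T τ x N ρ m k - μ m k * obsCount h T τ x N ρ m k))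
        - 2 * y ^ 2 * ∑ i ∈ Finset.range N, (blockWeight h T τ ρ m k i x : ℝ) ^ 2 := by
    rw [hS, hC, Finset.mul_sum, Finset.mul_sum, ← Finset.sum_sub_distrib, Finset.mul_sum,
      Finset.mul_sum, ← Finset.sum_sub_distrib]
    refine Finset.sum_congr rfl fun i _ => ?_
    linear_combination (-2 * y ^ 2 * (blockWeight h T τ ρ m k i x : ℝ) ^ 2) * hσ
  have hdev' : y * obsCount h T τ x N ρ m k
      ≤ σ * (obsSum h T τ x N ρ m k - μ m k * obsCount h T τ x N ρ m k) := by
    have := mul_le_mul_of_nonneg_right hdev hn0.le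
    rwa [obsMean, mul_assoc, sub_mul, div_mul_cancel₀ _ hn0.ne'] at this
  rw [hid]
  have e1 := mul_le_mul_of_nonneg_left hdev' (by positivity : 0 ≤ 4 * y)
  have e2 := mul_le_mul_of_nonneg_left hq (by positivity : 0 ≤ 2 * y ^ 2)
  nlinarith

variable {Ω : Type*} [MeasurableSpace Ω] {P : Measure Ω} [IsProbabilityMeasure P]
  {X : Ω → RewardTable M K} (hX : ∀ t m k, Measurable fun ω => X ω t m k)
  (hind : iIndepFun (fun (t : ℕ) (ω : Ω) => X ω t) P) {μ : Fin M → Fin K → ℝ}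
  (hμ : ∀ t m k, P.real {ω | X ω t m k = true} = μ m k)

include hX hind hμ in
theorem one_sided_tail {N ρ : ℕ} (hρ1 : 1 ≤ ρ) (m : Fin M) (k : Fin K) {y σ : ℝ} (hy : 0 ≤ y)
    (hσ : σ ^ 2 = 1) :
    P.real {ω | ρ ≤ (stateAt h T τ (X ω) N).blocks ∧
      y ≤ σ * (obsMean h T τ (X ω) N ρ m k - μ m k)} ≤ Real.exp (-(2 * ρ * y ^ 2)) := by
  have hwd : ∀ i, DependsOn (blockWeight h T τ ρ m k i) (Set.Iio (τ + i)) := fun i x y hxy => by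
    have h1 := stateAt_dependsOn h T τ i hxy
    have h2 := obsWeight_dependsOn h T τ m k i hxy
    simp only at h1 h2
    simp only [blockWeight, h1, h2]
  have hw2 : ∀ i x, blockWeight h T τ ρ m k i x ≤ 2 := fun i x => by
    unfold blockWeight
    split_ifs
    · exact obsWeight_le_two h T τ x m k i
    · simp
  have hE := integral_exp_process_le hX hind hμ τ (blockWeight h T τ ρ m k) hwd hw2 m k
    (4 * y * σ) N
  set Z : RewardTable M K → ℝ := fun x => Real.exp (∑ i ∈ Finset.range N,
    (4 * y * σ * (blockWeight h T τ ρ m k i x) * ((x (τ + i) m k).toNat - μ m k)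
      - (4 * y * σ * (blockWeight h T τ ρ m k i x)) ^ 2 / 8)) with hZ
  have hZd : DependsOn Z (Set.Iio (τ + N)) := by
    intro x y hxy
    refine congrArg Real.exp (Finset.sum_congr rfl fun i hi => ?_)
    have hi := Finset.mem_range.mp hi
    rw [hwd i (agree_of_le (by omega) hxy), hxy (τ + i) (by simpa using hi)]
  have hmarkov := mul_meas_ge_le_integral_of_nonneg (μ := P) (f := fun ω => Z (X ω))
    (.of_forall fun ω => (Real.exp_pos _).le) (integrable_of_dependsOn hX hZd)
    (Real.exp (2 * ρ * y ^ 2))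
  have hsub : P.real {ω | ρ ≤ (stateAt h T τ (X ω) N).blocks ∧
      y ≤ σ * (obsMean h T τ (X ω) N ρ m k - μ m k)}
      ≤ P.real {ω | Real.exp (2 * ρ * y ^ 2) ≤ Z (X ω)} :=
    measureReal_mono fun ω hω => Real.exp_le_exp.mpr
      (exponent_bound h T τ (X ω) μ hρ1 hω.1 m k hy hσ hω.2)
  rw [Real.exp_neg, ← one_div, le_div_iff₀ (Real.exp_pos _), mul_comm]
  exact (mul_le_mul_of_nonneg_left hsub (Real.exp_pos _).le).trans (hmarkov.trans hE)

include hX hind hμ in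
theorem scaledDev_tail (N ρ : ℕ) (m : Fin M) (k : Fin K) {u : ℝ} (hu : 0 ≤ u) :
    P.real {ω | u ≤ scaledDev h T τ (X ω) μ N ρ m k} ≤ 2 * Real.exp (-(2 * u ^ 2)) := by
  rcases hu.eq_or_lt with rfl | hu
  · have := measureReal_le_one (μ := P) (s := {ω | 0 ≤ scaledDev h T τ (X ω) μ N ρ m k})
    simp
    linarith
  rcases Nat.eq_zero_or_pos ρ with rfl | hρ
  · have : {ω | u ≤ scaledDev h T τ (X ω) μ N 0 m k} = ∅ := by
      ext ω
      simp [scaledDev, hu]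
    rw [this, measureReal_empty]
    positivity
  · have hsq : 0 < √(ρ : ℝ) := Real.sqrt_pos.mpr (by exact_mod_cast hρ)
    have hexp : 2 * ρ * (u / √(ρ : ℝ)) ^ 2 = 2 * u ^ 2 := by
      rw [div_pow, Real.sq_sqrt (Nat.cast_nonneg _)]
      have : (ρ : ℝ) ≠ 0 := by positivity
      field_simp
    have h1 := one_sided_tail h T τ hX hind hμ (N := N) hρ m k (div_pos hu hsq).le
      (σ := 1) (by norm_num)
    have h2 := one_sided_tail h T τ hX hind hμ (N := N) hρ m k (div_pos hu hsq).le
      (σ := -1) (by norm_num)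
    rw [hexp] at h1 h2
    have hsub : {ω | u ≤ scaledDev h T τ (X ω) μ N ρ m k} ⊆
        {ω | ρ ≤ (stateAt h T τ (X ω) N).blocks ∧
          u / √ρ ≤ 1 * (obsMean h T τ (X ω) N ρ m k - μ m k)} ∪
        {ω | ρ ≤ (stateAt h T τ (X ω) N).blocks ∧
          u / √ρ ≤ -1 * (obsMean h T τ (X ω) N ρ m k - μ m k)} := by
      intro ω hω
      have hω : u ≤ scaledDev h T τ (X ω) μ N ρ m k := hω
      unfold scaledDev at hω
      split_ifs at hω with hb
      · have hdiv : u / √ρ ≤ |obsMean h T τ (X ω) N ρ m k - μ m k| := by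
          rwa [div_le_iff₀ hsq, mul_comm]
        rcases le_abs.mp hdiv with hd | hd
        · exact .inl ⟨hb, by rwa [one_mul]⟩
        · exact .inr ⟨hb, by rwa [neg_one_mul]⟩
      · exact absurd hω (not_le.mpr hu)
    refine (measureReal_mono hsub).trans ((measureReal_union_le _ _).trans ?_)
    linarith

end Tails

/-! ### Moments of the scaled errors -/

section Moments

open MeasureTheory ProbabilityTheory

/-- A bound for the third moment of a nonnegative random variable with subgaussian tails. -/
noncomputable def thirdMoment : ℝ :=
  ∑' i : ℕ, ((i + 1 : ℕ) : ℝ) ^ 3 * (2 * Real.exp (-(2 * (i : ℝ) ^ 2)))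

theorem summable_thirdMoment :
    Summable fun i : ℕ => ((i + 1 : ℕ) : ℝ) ^ 3 * (2 * Real.exp (-(2 * (i : ℝ) ^ 2))) := by
  have h1 := (summable_nat_add_iff 1).mpr
    (Real.summable_pow_mul_exp_neg_nat_mul 3 (two_pos (α := ℝ)))
  refine Summable.of_nonneg_of_le (fun i => by positivity) (fun i => ?_)
    (h1.mul_left (2 * Real.exp 2))
  have h2 : Real.exp (-(2 * (i : ℝ) ^ 2)) ≤ Real.exp 2 * Real.exp (-2 * ((i + 1 : ℕ) : ℝ)) := by
    rw [← Real.exp_add]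
    refine Real.exp_le_exp.mpr ?_
    have : (i : ℝ) ≤ (i : ℝ) ^ 2 := by exact_mod_cast Nat.le_self_pow two_ne_zero i
    push_cast
    linarith
  calc ((i + 1 : ℕ) : ℝ) ^ 3 * (2 * Real.exp (-(2 * (i : ℝ) ^ 2)))
      ≤ ((i + 1 : ℕ) : ℝ) ^ 3 * (2 * (Real.exp 2 * Real.exp (-2 * ((i + 1 : ℕ) : ℝ)))) := by
        gcongr
    _ = _ := by ring

theorem thirdMoment_nonneg : 0 ≤ thirdMoment := tsum_nonneg fun i => by positivity

variable {Ω : Type*} [MeasurableSpace Ω] {P : Measure Ω} [IsProbabilityMeasure P]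

theorem integral_pow_three_le {A : Ω → ℝ} (hm : Measurable A) (h0 : ∀ ω, 0 ≤ A ω) {B : ℕ}
    (hB : ∀ ω, A ω ≤ B)
    (htail : ∀ i : ℕ, P.real {ω | (i : ℝ) ≤ A ω} ≤ 2 * Real.exp (-(2 * (i : ℝ) ^ 2))) :
    ∫ ω, A ω ^ 3 ∂P ≤ thirdMoment := by
  classical
  -- The term i = ⌊A⌋ alone already dominates A³.
  have hpt : ∀ ω, A ω ^ 3 ≤ ∑ i ∈ Finset.range (B + 1),
      ((i + 1 : ℕ) : ℝ) ^ 3 * Set.indicator {ω | (i : ℝ) ≤ A ω} 1 ω := by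
    intro ω
    have hle : ⌊A ω⌋₊ ∈ Finset.range (B + 1) := Finset.mem_range.mpr
      (Nat.lt_succ_of_le ((Nat.floor_le_floor (hB ω)).trans (Nat.floor_natCast B).le))
    refine le_trans ?_ (Finset.single_le_sum (f := fun i : ℕ =>
      ((i + 1 : ℕ) : ℝ) ^ 3 * Set.indicator {ω | (i : ℝ) ≤ A ω} 1 ω) (fun i _ => ?_) hle)
    · rw [Set.indicator_of_mem (show ω ∈ {ω' | (⌊A ω⌋₊ : ℝ) ≤ A ω'} from Nat.floor_le (h0 ω)),
        Pi.one_apply, mul_one]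
      refine pow_le_pow_left₀ (h0 ω) ?_ 3
      push_cast
      exact (Nat.lt_floor_add_one _).le
    · exact mul_nonneg (by positivity) (Set.indicator_nonneg (fun _ _ => zero_le_one) _)
  have hms : ∀ i : ℕ, MeasurableSet {ω | (i : ℝ) ≤ A ω} := fun i =>
    measurableSet_le measurable_const hm
  have hint : ∀ i : ℕ, Integrable (fun ω => ((i + 1 : ℕ) : ℝ) ^ 3 *
      Set.indicator {ω | (i : ℝ) ≤ A ω} (1 : Ω → ℝ) ω) P := fun i =>
    ((integrable_const (1 : ℝ)).indicator (hms i)).const_mul _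
  calc ∫ ω, A ω ^ 3 ∂P ≤ ∫ ω, ∑ i ∈ Finset.range (B + 1),
        ((i + 1 : ℕ) : ℝ) ^ 3 * Set.indicator {ω | (i : ℝ) ≤ A ω} 1 ω ∂P := by
        refine integral_mono_of_nonneg (.of_forall fun ω => pow_nonneg (h0 ω) 3)
          (integrable_finsetSum _ fun i _ => hint i) (.of_forall hpt)
    _ = ∑ i ∈ Finset.range (B + 1), ((i + 1 : ℕ) : ℝ) ^ 3 * P.real {ω | (i : ℝ) ≤ A ω} := by
        rw [integral_finsetSum _ fun i _ => hint i]
        refine Finset.sum_congr rfl fun i _ => ?_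
        rw [integral_const_mul, integral_indicator_one (hms i)]
    _ ≤ ∑ i ∈ Finset.range (B + 1), ((i + 1 : ℕ) : ℝ) ^ 3 * (2 * Real.exp (-(2 * (i : ℝ) ^ 2))) :=
        Finset.sum_le_sum fun i _ => mul_le_mul_of_nonneg_left (htail i) (by positivity)
    _ ≤ thirdMoment := summable_thirdMoment.sum_le_tsum _ fun i _ => by positivity

variable {M K : ℕ} (h : M < K) (T τ : ℕ) {X : Ω → RewardTable M K}
  (hX : ∀ t m k, Measurable fun ω => X ω t m k)
  (hind : iIndepFun (fun (t : ℕ) (ω : Ω) => X ω t) P) {μ : Fin M → Fin K → ℝ}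
  (hμ : ∀ t m k, P.real {ω | X ω t m k = true} = μ m k)

include hX hind hμ in
theorem integral_scaledDev_pow_three_le (N ρ : ℕ) (m : Fin M) (k : Fin K) :
    ∫ ω, scaledDev h T τ (X ω) μ N ρ m k ^ 3 ∂P ≤ thirdMoment := by
  have hd := scaledDev_dependsOn h T τ μ N ρ m k
  obtain ⟨B, hB⟩ := exists_bound_of_dependsOn hd
  exact integral_pow_three_le (measurable_of_dependsOn hX hd)
    (fun ω => scaledDev_nonneg h T τ (X ω) μ N ρ m k)
    (fun ω => (le_abs_self _).trans (hB (X ω)))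
    (fun i => scaledDev_tail h T τ hX hind hμ N ρ m k (Nat.cast_nonneg i))

include hX hind hμ in
theorem integral_scaledDev_le (N ρ : ℕ) (m : Fin M) (k : Fin K) :
    ∫ ω, scaledDev h T τ (X ω) μ N ρ m k ∂P ≤ 1 + thirdMoment := by
  have hd := scaledDev_dependsOn h T τ μ N ρ m k
  have hi3 : Integrable (fun ω => scaledDev h T τ (X ω) μ N ρ m k ^ 3) P :=
    integrable_of_dependsOn hX (f := fun x => scaledDev h T τ x μ N ρ m k ^ 3)
      fun x y hxy => congrArg (· ^ 3) (hd hxy)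
  calc ∫ ω, scaledDev h T τ (X ω) μ N ρ m k ∂P
      ≤ ∫ ω, (1 + scaledDev h T τ (X ω) μ N ρ m k ^ 3) ∂P := by
        refine integral_mono (integrable_of_dependsOn hX hd)
          ((integrable_const _).add hi3) fun ω => ?_
        have h0 := scaledDev_nonneg h T τ (X ω) μ N ρ m k
        simp only
        generalize scaledDev h T τ (X ω) μ N ρ m k = a at h0 ⊢
        nlinarith [sq_nonneg (a - 1), mul_nonneg h0 (sq_nonneg (a - 1))]
    _ = 1 + ∫ ω, scaledDev h T τ (X ω) μ N ρ m k ^ 3 ∂P := by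
        rw [integral_add (integrable_const _) hi3]; simp
    _ ≤ 1 + thirdMoment := by
        linarith [integral_scaledDev_pow_three_le h T τ hX hind hμ N ρ m k]

end Moments

/-! ### The logarithm L = log(2/η) -/

section LogTerm

/-- The logarithm `log (T √(2 M))`, which is `log (2 / η)`. -/
noncomputable def logTerm (M T : ℕ) : ℝ := Real.log ((T : ℝ) * √(2 * (M : ℝ)))

variable {M T : ℕ} (hM : 1 ≤ M) (hT : 1 ≤ T)

include hM hT

theorem two_div_etaParam : 2 / etaParam M T = T * √(2 * (M : ℝ)) := by
  have hM' : (0 : ℝ) < M := by exact_mod_cast hM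
  have hT' : (0 : ℝ) < T := by exact_mod_cast hT
  have hη : 0 < etaParam M T := Real.sqrt_pos.mpr (by positivity)
  rw [div_eq_iff hη.ne', etaParam, mul_assoc, ← Real.sqrt_mul (by positivity)]
  have : 2 * (M : ℝ) * (2 / (M * T ^ 2)) = (2 / T) ^ 2 := by field_simp
  rw [this, Real.sqrt_sq (by positivity)]
  field_simp

theorem epsParam_eq (ρ : ℕ) : epsParam M T ρ = √(logTerm M T) / √ρ := by
  rw [epsParam, two_div_etaParam hM hT, Real.sqrt_div' _ (Nat.cast_nonneg _)]
  rfl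

theorem exp_logTerm : Real.exp (logTerm M T) = T * √(2 * (M : ℝ)) := by
  have hM' : (0 : ℝ) < M := by exact_mod_cast hM
  have hT' : (0 : ℝ) < T := by exact_mod_cast hT
  exact Real.exp_log (by positivity)

theorem le_exp_logTerm : (T : ℝ) ≤ Real.exp (logTerm M T) := by
  rw [exp_logTerm hM hT]
  refine le_mul_of_one_le_right (Nat.cast_nonneg _) (Real.one_le_sqrt.mpr ?_)
  have : (1 : ℝ) ≤ M := by exact_mod_cast hM
  linarith

/-- The extreme case is M = T = 1, with L = (log 2)/2. The resulting √L ≥ 1/2 lets the rounding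
error 1/2 be absorbed: 2√L + 1/2 ≤ 3√L. -/
theorem quarter_le_logTerm : 1 / 4 ≤ logTerm M T := by
  have hM' : (1 : ℝ) ≤ M := by exact_mod_cast hM
  have hT' : (1 : ℝ) ≤ T := by exact_mod_cast hT
  have h1 : √2 ≤ T * √(2 * (M : ℝ)) :=
    (Real.sqrt_le_sqrt (by linarith)).trans (le_mul_of_one_le_left (Real.sqrt_nonneg _) hT')
  have h2 := Real.log_le_log (Real.sqrt_pos.mpr two_pos) h1
  rw [Real.log_sqrt two_pos.le] at h2
  have := Real.log_two_gt_d9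
  unfold logTerm
  linarith

theorem half_le_sqrt_logTerm : 1 / 2 ≤ √(logTerm M T) :=
  Real.le_sqrt_of_sq_le (by linarith [quarter_le_logTerm hM hT])

theorem exp_neg_two_mul_logTerm :
    Real.exp (-(2 * logTerm M T)) = 1 / (2 * M * (T : ℝ) ^ 2) := by
  rw [Real.exp_neg, two_mul, Real.exp_add, exp_logTerm hM hT, one_div]
  congr 1
  have : √(2 * (M : ℝ)) * √(2 * (M : ℝ)) = 2 * M := Real.mul_self_sqrt (by positivity)
  linear_combination (T : ℝ) ^ 2 * this

end LogTerm

/-! ### Consequences of good estimates along one run -/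

section Path

variable {M K : ℕ} {h : M < K} {T τ : ℕ} {x : RewardTable M K} {μ : Fin M → Fin K → ℝ}
  {Gstar : PullGraph M K} {n N : ℕ}

theorem utility_sub_shared_le (hn : n ≤ N) (h1 : 1 ≤ (stateAt h T τ x n).epoch) {a : ℝ}
    (ha : ∀ m k, scaledDev h T τ x μ N (stateAt h T τ x n).epoch m k ≤ a)
    {G G' : PullGraph M K} (hG : Function.Injective G) (hG' : Function.Injective G') :
    utility G (stateAt h T τ x n).shared - utility G' (stateAt h T τ x n).shared
      ≤ utility G μ - utility G' μ + M * ((2 * a + 1 / 2) / √(stateAt h T τ x n).epoch) := by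
  have hsq : 0 < √((stateAt h T τ x n).epoch : ℝ) :=
    Real.sqrt_pos.mpr (by exact_mod_cast h1)
  have := utility_sub_le_of_close (μ := μ) (w := (stateAt h T τ x n).shared)
    (a := a / √(stateAt h T τ x n).epoch) (b := (a + 1 / 2) / √(stateAt h T τ x n).epoch)
    (fun m k => by
      rw [← neg_div, div_le_iff₀ hsq, mul_comm]
      linarith [(shared_bounds (μ := μ) hn h1 m k).1, ha m k])
    (fun m k => by
      rw [le_div_iff₀ hsq, mul_comm]
      linarith [(shared_bounds (μ := μ) hn h1 m k).2, ha m k]) hG hG'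
  rw [← add_div] at this
  convert this using 4
  ring

theorem loss_le (h0 : ∀ m k, 0 ≤ μ m k) (h1 : ∀ m k, μ m k ≤ 1) (s : State M K) :
    loss h μ Gstar s ≤ M := by
  unfold loss
  linarith [utility_nonneg h0 (s.pulls h), utility_le_card h1 Gstar]

theorem loss_le_add_two (h0 : ∀ m k, 0 ≤ μ m k) (h1 : ∀ m k, μ m k ≤ 1) (s : State M K) :
    loss h μ Gstar s ≤ utility Gstar μ - utility (s.matching h) μ + 2 := by
  unfold loss State.pulls
  split
  · split_ifs
    · have := utility_sub_update_le h0 h1 (G := s.matching h)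
        (bestMatching_injective h s.shared) ‹Transmission M›.sender ‹Transmission M›.receiver
      linarith
    · linarith
  · linarith

/-- The matching of an epoch is nearly optimal if the estimates are good. -/
theorem utility_sub_matching_le (hinj : Function.Injective Gstar) (hn : n ≤ N)
    (h1 : 1 ≤ (stateAt h T τ x n).epoch) {a : ℝ}
    (ha : ∀ m k, scaledDev h T τ x μ N (stateAt h T τ x n).epoch m k ≤ a) :
    utility Gstar μ - utility ((stateAt h T τ x n).matching h) μ
      ≤ M * ((2 * a + 1 / 2) / √(stateAt h T τ x n).epoch) := by
  have hGi := bestMatching_injective h (stateAt h T τ x n).shared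
  have h2 := utility_le_bestMatching h (stateAt h T τ x n).shared hinj
  have h3 := utility_sub_shared_le hn h1 ha hGi hinj
  unfold State.matching
  linarith

theorem passes_iff (hM : 1 ≤ M) (hT : 1 ≤ T) (s : State M K) (e : Fin M × Fin K) :
    s.Passes h T e ↔ utility (s.matching h) s.shared
      - utility (bestMatchingThrough h s.shared e.1 e.2) s.shared
        ≤ 4 * M * (√(logTerm M T) / √s.epoch) := by
  rw [State.Passes, epsParam_eq hM hT]

/-- The edges of a graph. -/
def graphEdges (G : PullGraph M K) : Finset (Fin M × Fin K) :=
  Finset.univ.map ⟨fun m => (m, G m), fun _ _ hab => congrArg Prod.fst hab⟩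

theorem mem_graphEdges {G : PullGraph M K} {e : Fin M × Fin K} :
    e ∈ graphEdges G ↔ e.2 = G e.1 := by
  simp only [graphEdges, Finset.mem_map, Finset.mem_univ, true_and]
  constructor
  · rintro ⟨m, rfl⟩
    rfl
  · exact fun he => ⟨e.1, Prod.ext rfl he.symm⟩

theorem card_graphEdges (G : PullGraph M K) : (graphEdges G).card = M := by
  simp [graphEdges]

/-- With good estimates, only the edges of the optimal matching survive the elimination once the
confidence radius is small compared with the gap. -/
theorem epoch_le_of_ne_exploit (hM : 1 ≤ M) (hT : 1 ≤ T) (hinj : Function.Injective Gstar)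
    (hn : n ≤ N) {ρ : ℕ} (hρ : 1 ≤ ρ)
    (hgap : 8 * M * (√(logTerm M T) / √ρ) ≤ minGap μ Gstar)
    (hgood : ∀ m k, scaledDev h T τ x μ N ρ m k ≤ √(logTerm M T))
    (hp : (stateAt h T τ x n).phase ≠ .exploit) : (stateAt h T τ x n).epoch ≤ ρ := by
  by_contra! hlt
  obtain ⟨hact, -, hcard, -⟩ := active_structure h T τ x hM n
  have hl := half_le_sqrt_logTerm hM hT
  have hMpos : (0 : ℝ) < M := by exact_mod_cast hM
  have hsq : 0 < √(ρ : ℝ) := Real.sqrt_pos.mpr (by exact_mod_cast hρ)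
  have hsub : (stateAt h T τ x n).active ⊆ graphEdges Gstar := by
    intro e he
    by_contra hne
    obtain ⟨i, hi, hie, hpass⟩ := hact e he ρ hρ hlt
    rw [passes_iff hM hT, hie] at hpass
    -- A matching through a non-optimal edge loses at least the gap, that is, at least 8Mε. Passing
    -- the test bounds its empirical loss by 4Mε, and estimation adds at most 3Mε.
    have hGe : bestMatchingThrough h (stateAt h T τ x i).shared e.1 e.2 ≠ Gstar := fun hc =>
      hne (mem_graphEdges.mpr (by rw [← hc, bestMatchingThrough_self]))
    have h1 := minGap_le (μ := μ) hGe
    have h2 := utility_le_bestMatching h (stateAt h T τ x i).shared hinj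
    have h3 := utility_sub_shared_le (μ := μ) (x := x) (n := i) (N := N) (by omega)
      (by rw [hie]; exact hρ) (by rw [hie]; exact hgood)
      (bestMatchingThrough_injective h (stateAt h T τ x i).shared e.1 e.2) hinj
    rw [hie] at h3
    have h4 : (M : ℝ) * ((2 * √(logTerm M T) + 1 / 2) / √ρ)
        ≤ 3 * M * (√(logTerm M T) / √ρ) := by
      rw [show 3 * M * (√(logTerm M T) / √(ρ : ℝ)) = M * (3 * √(logTerm M T) / √ρ) by ring]
      gcongr
      linarith
    have h5 : 0 < M * (√(logTerm M T) / √(ρ : ℝ)) := by positivity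
    unfold State.matching at hpass
    linarith
  have := Finset.card_le_card hsub
  rw [card_graphEdges] at this
  exact absurd (hcard hp) (not_lt.mpr this)

/-- The radius, in units of `√(log (T √(2 M)))`, within which the estimates have to be for
exploitation to be optimal. -/
noncomputable def radiusFactor (M T : ℕ) (Δ : ℝ) (ρ : ℕ) : ℝ :=
  if √(ρ : ℝ) * Δ < 4 * M * √(logTerm M T) then 7 / 8 else 1

theorem matching_eq_of_exploit (hM : 1 ≤ M) (hT : 1 ≤ T) (hopt : IsUniqueOptimal μ Gstar)
    (hinj : Function.Injective Gstar) (hΔ : 0 < minGap μ Gstar) (hL : 4 ≤ logTerm M T) (hn : n ≤ N)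
    (hgood : ∀ ρ ∈ Finset.Icc 1 N, ∀ m k, scaledDev h T τ x μ N ρ m k
      ≤ radiusFactor M T (minGap μ Gstar) ρ * √(logTerm M T))
    (hp : (stateAt h T τ x n).phase = .exploit) : (stateAt h T τ x n).matching h = Gstar := by
  by_contra hne
  obtain ⟨-, hdrop, -, hcard⟩ := active_structure h T τ x hM n
  obtain ⟨hcard, hepoch⟩ := hcard hp
  set l := √(logTerm M T) with hldef
  have hl : 2 ≤ l := Real.le_sqrt_of_sq_le (by linarith)
  have hMpos : (0 : ℝ) < M := by exact_mod_cast hM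
  have hle : ∀ i ≤ n, (stateAt h T τ x i).epoch ≤ N := fun i hi =>
    ((State.epoch_le_blocks _).trans (blocks_le h T τ x i)).trans (hi.trans hn)
  have hR := hgood _ (Finset.mem_Icc.mpr ⟨hepoch, hle n le_rfl⟩)
  have hsq : 0 < √((stateAt h T τ x n).epoch : ℝ) := Real.sqrt_pos.mpr (by exact_mod_cast hepoch)
  have hloss := utility_sub_matching_le hinj hn hepoch hR
  have hgap := minGap_le (μ := μ) hne
  -- In a late epoch the final matching would lose at most 3Ml/√ρ, below the gap, and so be optimal.
  -- Hence exploitation started early, and the radius 7/8 holds in all epochs so far.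
  have hsmall : √((stateAt h T τ x n).epoch : ℝ) * minGap μ Gstar < 4 * M * l := by
    by_contra hc
    rw [radiusFactor, if_neg hc, one_mul] at hloss
    have h1 : utility Gstar μ - utility ((stateAt h T τ x n).matching h) μ
        ≤ M * (3 * l) / √((stateAt h T τ x n).epoch : ℝ) := by
      refine hloss.trans ?_
      rw [mul_div_assoc']
      gcongr
      linarith
    have h2 := hgap.trans h1
    rw [le_div_iff₀ hsq, mul_comm] at h2
    have : 0 < M * l := by positivity
    linarith
  have hfac : ∀ i ≤ n, radiusFactor M T (minGap μ Gstar) (stateAt h T τ x i).epoch = 7 / 8 := by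
    intro i hi
    refine if_pos (lt_of_le_of_lt ?_ hsmall)
    have hm : (stateAt h T τ x i).epoch ≤ (stateAt h T τ x n).epoch := epoch_mono h T τ x hi
    gcongr
  -- Here l ≥ 2 enters: 2(7/8)l + 1/2 ≤ 2l, exactly half of the slack 4Ml/√ρ in the test.
  have hclose : ∀ i ≤ n, 1 ≤ (stateAt h T τ x i).epoch → ∀ G G' : PullGraph M K,
      Function.Injective G → Function.Injective G' →
      utility G (stateAt h T τ x i).shared - utility G' (stateAt h T τ x i).shared
        ≤ utility G μ - utility G' μ + 2 * (M * (l / √(stateAt h T τ x i).epoch)) := by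
    intro i hi hi1 G G' hG hG'
    have h1 := utility_sub_shared_le (hi.trans hn) hi1
      (hgood _ (Finset.mem_Icc.mpr ⟨hi1, hle i hi⟩)) hG hG'
    rw [hfac i hi] at h1
    refine h1.trans (add_le_add le_rfl ?_)
    rw [show 2 * (M * (l / √((stateAt h T τ x i).epoch : ℝ)))
      = M * (2 * l / √(stateAt h T τ x i).epoch) by ring]
    gcongr
    linarith
  have hGi := bestMatching_injective h (stateAt h T τ x n).shared
  have hδ : utility Gstar μ - utility ((stateAt h T τ x n).matching h) μ
      ≤ 2 * (M * (l / √(stateAt h T τ x n).epoch)) := by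
    have h1 := hclose n le_rfl hepoch _ _ hGi hinj
    have h2 := utility_le_bestMatching h (stateAt h T τ x n).shared hinj
    unfold State.matching
    linarith
  -- A failed test shows an empirical loss above 4Mε at some earlier epoch. Estimation takes at most
  -- half of it, and the remaining 2Mε is no smaller than the same radius at the present epoch, as ε
  -- decreases.
  have hkey : ∀ e ∉ (stateAt h T τ x n).active, ∀ G : PullGraph M K, Function.Injective G →
      e.2 = G e.1 → 2 * (M * (l / √(stateAt h T τ x n).epoch)) < utility Gstar μ - utility G μ := by
    intro e he G hG hGe
    obtain ⟨i, hi, hi1, hin, hfail⟩ := hdrop e he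
    rw [passes_iff hM hT, not_le, ← hldef, hGe] at hfail
    have h1 := utility_le_bestMatchingThrough h (stateAt h T τ x i).shared hG e.1
    have h2 := hclose i hi.le hi1 _ _ (bestMatching_injective h (stateAt h T τ x i).shared) hG
    have h3 : utility (bestMatching h (stateAt h T τ x i).shared) μ ≤ utility Gstar μ := by
      by_cases hc : bestMatching h (stateAt h T τ x i).shared = Gstar
      · rw [hc]
      · exact (hopt _ hc).le
    have hsqi : 0 < √((stateAt h T τ x i).epoch : ℝ) := Real.sqrt_pos.mpr (by exact_mod_cast hi1)
    have h4 : M * (l / √((stateAt h T τ x n).epoch : ℝ))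
        ≤ M * (l / √((stateAt h T τ x i).epoch : ℝ)) := by gcongr
    unfold State.matching at hfail
    linarith
  have hpos : 0 ≤ 2 * (M * (l / √((stateAt h T τ x n).epoch : ℝ))) := by positivity
  have hsub : graphEdges Gstar ⊆ (stateAt h T τ x n).active := by
    intro e he
    by_contra hc
    have := hkey e hc Gstar hinj (mem_graphEdges.mp he)
    linarith
  -- At most M edges are active and they include the M optimal ones. A different final matching
  -- would use an eliminated edge and lose more than `hδ` permits.
  have heq := Finset.eq_of_subset_of_card_le hsub (by rwa [card_graphEdges])
  obtain ⟨m, hm⟩ := Function.ne_iff.mp hne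
  have := hkey (m, (stateAt h T τ x n).matching h m)
    (fun hc => hm (mem_graphEdges.mp (heq ▸ hc))) _ hGi rfl
  unfold State.matching at hδ
  linarith

end Path

/-! ### The loss of an epoch's matching through cubes of errors -/

section ExploreLoss

variable {M K : ℕ} {h : M < K} {T τ : ℕ} {x : RewardTable M K} {μ : Fin M → Fin K → ℝ}
  {Gstar : PullGraph M K} {n N : ℕ}

theorem sum_pow_three_le {M : ℕ} (a : Fin M → ℝ) (ha : ∀ m, 0 ≤ a m) :
    (∑ m, a m) ^ 3 ≤ (M : ℝ) ^ 2 * ∑ m, a m ^ 3 := by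
  rcases Nat.eq_zero_or_pos M with rfl | hM
  · simp
  have hM' : (0 : ℝ) < (M : ℝ) ^ 2 := by positivity
  have := pow_sum_div_card_le_sum_pow (s := Finset.univ) (fun m _ => ha m) 2
  rw [Finset.card_univ, Fintype.card_fin, div_le_iff₀ hM', mul_comm] at this
  exact this

/-- The sum of the cubes of the estimation errors of an epoch. -/
noncomputable def cubeSum (h : M < K) (T τ : ℕ) (x : RewardTable M K) (μ : Fin M → Fin K → ℝ)
    (N ρ : ℕ) : ℝ :=
  ∑ m, ∑ k, (scaledDev h T τ x μ N ρ m k ^ 3 + 1)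

theorem cubeSum_nonneg (N ρ : ℕ) : 0 ≤ cubeSum h T τ x μ N ρ :=
  Finset.sum_nonneg fun m _ => Finset.sum_nonneg fun k _ => by
    have := scaledDev_nonneg h T τ x μ N ρ m k
    positivity

/-- The power mean inequality for three terms, with (1/2)³ enlarged to 1. -/
theorem add_half_pow_three_le {a b : ℝ} (ha : 0 ≤ a) (hb : 0 ≤ b) :
    (a + b + 1 / 2) ^ 3 ≤ 9 * (a ^ 3 + b ^ 3 + 1) := by
  have h1 : ∀ u v : ℝ, 0 ≤ u → 0 ≤ v → u ^ 2 * v ≤ (2 * u ^ 3 + v ^ 3) / 3 := fun u v hu hv => by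
    nlinarith [mul_nonneg (add_nonneg (mul_nonneg two_pos.le hu) hv) (sq_nonneg (u - v))]
  nlinarith [h1 a b ha hb, h1 b a hb ha, h1 a (1 / 2) ha (by norm_num),
    h1 (1 / 2) a (by norm_num) ha, h1 b (1 / 2) hb (by norm_num), h1 (1 / 2) b (by norm_num) hb,
    mul_nonneg (mul_nonneg ha hb) (by norm_num : (0 : ℝ) ≤ 1 / 2),
    mul_nonneg (add_nonneg ha hb) (sq_nonneg (a - b)), mul_nonneg ha (sq_nonneg (b - 1 / 2)),
    mul_nonneg hb (sq_nonneg (a - 1 / 2)), mul_nonneg ha (sq_nonneg (a - b)),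
    pow_nonneg ha 3, pow_nonneg hb 3]

/-- The matching of an epoch is either optimal or loses at least the gap, and in the latter case
its loss is at most the cube of the loss divided by the square of the gap. -/
theorem utility_sub_matching_le_cube (hinj : Function.Injective Gstar)
    (hΔ : 0 < minGap μ Gstar) (hn : n ≤ N) (h1 : 1 ≤ (stateAt h T τ x n).epoch) :
    utility Gstar μ - utility ((stateAt h T τ x n).matching h) μ
      ≤ 18 * (M : ℝ) ^ 2 / minGap μ Gstar ^ 2 * (cubeSum h T τ x μ N (stateAt h T τ x n).epoch
        * (1 / √((stateAt h T τ x n).epoch : ℝ) ^ 3)) := by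
  set s := stateAt h T τ x n
  set ρ := s.epoch
  set A := scaledDev h T τ x μ N ρ
  have hA : ∀ m k, 0 ≤ A m k := fun m k => scaledDev_nonneg h T τ x μ N ρ m k
  set δ := utility Gstar μ - utility (s.matching h) μ with hδ
  have hcs := cubeSum_nonneg (h := h) (T := T) (τ := τ) (x := x) (μ := μ) N ρ
  by_cases hG : s.matching h = Gstar
  · rw [hδ, hG, sub_self]
    positivity
  have hgap : minGap μ Gstar ≤ δ := minGap_le hG
  have hsq : 0 < √(ρ : ℝ) := Real.sqrt_pos.mpr (by exact_mod_cast h1)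
  have hGi : Function.Injective (s.matching h) := bestMatching_injective h s.shared
  have hopt := utility_le_bestMatching h s.shared hinj
  change utility Gstar s.shared ≤ utility (s.matching h) s.shared at hopt
  have hsum : √(ρ : ℝ) * δ ≤ ∑ m, (A m (s.matching h m) + A m (Gstar m) + 1 / 2) := by
    have e1 : √(ρ : ℝ) * δ ≤ √ρ * ((utility (s.matching h) s.shared - utility (s.matching h) μ)
        - (utility Gstar s.shared - utility Gstar μ)) :=
      mul_le_mul_of_nonneg_left (by linarith) hsq.le
    refine e1.trans ?_
    rw [utility_of_injective hGi, utility_of_injective hGi, utility_of_injective hinj,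
      utility_of_injective hinj, ← Finset.sum_sub_distrib, ← Finset.sum_sub_distrib,
      ← Finset.sum_sub_distrib, Finset.mul_sum]
    refine Finset.sum_le_sum fun m _ => ?_
    have e2 := (shared_bounds (μ := μ) hn h1 m (s.matching h m)).2
    have e3 := (shared_bounds (μ := μ) hn h1 m (Gstar m)).1
    rw [mul_sub]
    linarith
  have hcube : (√(ρ : ℝ) * δ) ^ 3 ≤ 18 * (M : ℝ) ^ 2 * cubeSum h T τ x μ N ρ := by
    calc (√(ρ : ℝ) * δ) ^ 3 ≤ (∑ m, (A m (s.matching h m) + A m (Gstar m) + 1 / 2)) ^ 3 :=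
          pow_le_pow_left₀ (by have := hΔ.trans_le hgap; positivity) hsum 3
      _ ≤ (M : ℝ) ^ 2 * ∑ m, (A m (s.matching h m) + A m (Gstar m) + 1 / 2) ^ 3 :=
          sum_pow_three_le _ fun m => by
            have := hA m (s.matching h m)
            have := hA m (Gstar m)
            positivity
      -- The arm chosen by the matching is random and depends on the errors, so its cube is bounded
      -- by the sum over all arms. This costs a factor K.
      _ ≤ (M : ℝ) ^ 2 * ∑ m, 18 * ∑ k, (A m k ^ 3 + 1) := by
          refine mul_le_mul_of_nonneg_left (Finset.sum_le_sum fun m _ => ?_) (by positivity)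
          have e1 := add_half_pow_three_le (hA m (s.matching h m)) (hA m (Gstar m))
          have e2 : ∀ k, A m k ^ 3 + 1 ≤ ∑ k, (A m k ^ 3 + 1) := fun k =>
            Finset.single_le_sum (f := fun k => A m k ^ 3 + 1)
              (fun k _ => by have := hA m k; positivity) (Finset.mem_univ k)
          linarith [e2 (s.matching h m), e2 (Gstar m)]
      _ = 18 * (M : ℝ) ^ 2 * cubeSum h T τ x μ N ρ := by
          rw [← Finset.mul_sum, cubeSum]; ring
  have hδ0 : 0 < δ := hΔ.trans_le hgap
  have hδ3 : δ * minGap μ Gstar ^ 2 ≤ δ ^ 3 := by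
    rw [pow_succ' δ 2]
    gcongr
  rw [div_mul_eq_mul_div, le_div_iff₀ (by positivity), ← mul_assoc, mul_one_div,
    le_div_iff₀ (by positivity)]
  calc δ * minGap μ Gstar ^ 2 * √(ρ : ℝ) ^ 3 ≤ δ ^ 3 * √(ρ : ℝ) ^ 3 := by gcongr
    _ = (√(ρ : ℝ) * δ) ^ 3 := by ring
    _ ≤ _ := hcube

end ExploreLoss

/-! ### Integration: bad events and expected bounds -/

section Expectations

open MeasureTheory ProbabilityTheory

variable {M K : ℕ} {h : M < K} {T τ : ℕ}

theorem total_dependsOn (h : M < K) (T τ : ℕ) (f : State M K → ℝ) :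
    DependsOn (fun x : RewardTable M K => total h T τ f x) (Set.Iio (τ + (T - τ))) := by
  intro x y hxy
  refine Finset.sum_congr rfl fun n hn => ?_
  have hn := Finset.mem_range.mp hn
  exact congrArg f (stateAt_dependsOn h T τ n (agree_of_le (by omega) hxy))

/-- Some estimation error of an epoch in `S` exceeds its radius. -/
def Deviates (h : M < K) (T τ : ℕ) (μ : Fin M → Fin K → ℝ) (N : ℕ) (S : Finset ℕ) (u : ℕ → ℝ)
    (x : RewardTable M K) : Prop :=
  ∃ ρ ∈ S, ∃ m k, u ρ < scaledDev h T τ x μ N ρ m k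

theorem deviates_dependsOn (μ : Fin M → Fin K → ℝ) (N : ℕ) (S : Finset ℕ) (u : ℕ → ℝ) :
    DependsOn (Deviates h T τ μ N S u) (Set.Iio (τ + N)) := by
  intro x y hxy
  have : ∀ ρ m k, scaledDev h T τ x μ N ρ m k = scaledDev h T τ y μ N ρ m k := fun ρ m k =>
    scaledDev_dependsOn h T τ μ N ρ m k hxy
  simp only [Deviates, this]

theorem commBound_dependsOn (μ : Fin M → Fin K → ℝ) (N ρ : ℕ) :
    DependsOn (fun x : RewardTable M K => commBound h T τ x μ N ρ) (Set.Iio (τ + N)) := by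
  intro x y hxy
  have : ∀ ρ m k, scaledDev h T τ x μ N ρ m k = scaledDev h T τ y μ N ρ m k := fun ρ m k =>
    scaledDev_dependsOn h T τ μ N ρ m k hxy
  simp only [commBound, this]

theorem cubeSum_dependsOn (μ : Fin M → Fin K → ℝ) (N ρ : ℕ) :
    DependsOn (fun x : RewardTable M K => cubeSum h T τ x μ N ρ) (Set.Iio (τ + N)) := by
  intro x y hxy
  have : ∀ ρ m k, scaledDev h T τ x μ N ρ m k = scaledDev h T τ y μ N ρ m k := fun ρ m k =>
    scaledDev_dependsOn h T τ μ N ρ m k hxy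
  simp only [cubeSum, this]

variable {Ω : Type*} [MeasurableSpace Ω] {P : Measure Ω} [IsProbabilityMeasure P]
  {X : Ω → RewardTable M K} (hX : ∀ t m k, Measurable fun ω => X ω t m k)
  (hind : iIndepFun (fun (t : ℕ) (ω : Ω) => X ω t) P) {μ : Fin M → Fin K → ℝ}
  (hμ : ∀ t m k, P.real {ω | X ω t m k = true} = μ m k)

include hX in
theorem integral_le_add_of_good {f g : RewardTable M K → ℝ} {b : RewardTable M K → Prop} {n : ℕ}
    (hf : DependsOn f (Set.Iio n)) (hg : DependsOn g (Set.Iio n)) (hb : DependsOn b (Set.Iio n))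
    (hg0 : ∀ x, 0 ≤ g x) {B : ℝ} (hfB : ∀ x, f x ≤ B) (hgood : ∀ x, ¬ b x → f x ≤ g x) :
    ∫ ω, f (X ω) ∂P ≤ ∫ ω, g (X ω) ∂P + B * P.real {ω | b (X ω)} := by
  have hms : MeasurableSet {ω | b (X ω)} := measurableSet_setOfPred.mpr (measurable_of_dependsOn hX hb)
  have hint : Integrable (fun ω => B * Set.indicator {ω | b (X ω)} (1 : Ω → ℝ) ω) P :=
    ((integrable_const (1 : ℝ)).indicator hms).const_mul _
  calc ∫ ω, f (X ω) ∂P ≤ ∫ ω, (g (X ω) + B * Set.indicator {ω | b (X ω)} (1 : Ω → ℝ) ω) ∂P := by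
        refine integral_mono (integrable_of_dependsOn hX hf)
          ((integrable_of_dependsOn hX hg).add hint) fun ω => ?_
        by_cases hbω : b (X ω)
        · have hmem : ω ∈ {ω | b (X ω)} := hbω
          simp only [Set.indicator_of_mem hmem, Pi.one_apply]
          linarith [hg0 (X ω), hfB (X ω)]
        · have hmem : ω ∉ {ω | b (X ω)} := hbω
          simp only [Set.indicator_of_notMem hmem]
          linarith [hgood (X ω) hbω]
    _ = _ := by
        rw [integral_add (integrable_of_dependsOn hX hg) hint, integral_const_mul,
          integral_indicator_one hms]

include hX hind hμ in
theorem prob_deviates_le (N : ℕ) (S : Finset ℕ) (u : ℕ → ℝ) (hu : ∀ ρ, 0 ≤ u ρ) :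
    P.real {ω | Deviates h T τ μ N S u (X ω)}
      ≤ ∑ ρ ∈ S, M * K * (2 * Real.exp (-(2 * u ρ ^ 2))) := by
  have hsub : {ω | Deviates h T τ μ N S u (X ω)} ⊆
      ⋃ ρ ∈ S, ⋃ e ∈ (Finset.univ : Finset (Fin M × Fin K)),
        {ω | u ρ ≤ scaledDev h T τ (X ω) μ N ρ e.1 e.2} := by
    rintro ω ⟨ρ, hρ, m, k, hd⟩
    simp only [Set.mem_iUnion]
    exact ⟨ρ, hρ, (m, k), Finset.mem_univ _, hd.le⟩
  refine (measureReal_mono hsub (measure_ne_top _ _)).trans ((measureReal_biUnion_finset_le _ _).trans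
    (Finset.sum_le_sum fun ρ _ => (measureReal_biUnion_finset_le _ _).trans ?_))
  refine (Finset.sum_le_sum fun e _ =>
    scaledDev_tail h T τ hX hind hμ N ρ e.1 e.2 (hu ρ)).trans (le_of_eq ?_)
  simp [Finset.sum_const, Finset.card_univ]

include hX hind hμ in
theorem integral_cubeSum_le (N ρ : ℕ) :
    ∫ ω, cubeSum h T τ (X ω) μ N ρ ∂P ≤ M * K * (thirdMoment + 1) := by
  have hi : ∀ m k, Integrable (fun ω => scaledDev h T τ (X ω) μ N ρ m k ^ 3) P := fun m k =>
    integrable_of_dependsOn hX (f := fun x => scaledDev h T τ x μ N ρ m k ^ 3)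
      fun x y hxy => congrArg (· ^ 3) (scaledDev_dependsOn h T τ μ N ρ m k hxy)
  have hi1 : ∀ m k, Integrable (fun ω => scaledDev h T τ (X ω) μ N ρ m k ^ 3 + 1) P :=
    fun m k => (hi m k).add (integrable_const _)
  unfold cubeSum
  rw [integral_finsetSum _ fun m _ => integrable_finsetSum _ fun k _ => hi1 m k]
  calc ∑ m, ∫ ω, ∑ k, (scaledDev h T τ (X ω) μ N ρ m k ^ 3 + 1) ∂P
      ≤ ∑ _m : Fin M, ∑ _k : Fin K, (thirdMoment + 1) := by
        refine Finset.sum_le_sum fun m _ => ?_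
        rw [integral_finsetSum _ fun k _ => hi1 m k]
        refine Finset.sum_le_sum fun k _ => ?_
        rw [integral_add (hi m k) (integrable_const _)]
        have := integral_scaledDev_pow_three_le h T τ hX hind hμ N ρ m k
        simpa using this
    _ = M * K * (thirdMoment + 1) := by simp; ring

include hX hind hμ in
theorem integral_commBound_le (N ρ : ℕ) :
    ∫ ω, commBound h T τ (X ω) μ N ρ ∂P ≤ (M : ℝ) ^ 2 * K * (12 * thirdMoment + 20) := by
  have hi : ∀ ρ m k, Integrable (fun ω => scaledDev h T τ (X ω) μ N ρ m k) P := fun ρ m k =>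
    integrable_of_dependsOn hX (scaledDev_dependsOn h T τ μ N ρ m k)
  have hi1 : ∀ m k, Integrable (fun ω => 4 * scaledDev h T τ (X ω) μ N (ρ + 1) m k
      + 8 * scaledDev h T τ (X ω) μ N ρ m k) P := fun m k =>
    ((hi (ρ + 1) m k).const_mul 4).add ((hi ρ m k).const_mul 8)
  have hi2 : ∀ m k, Integrable (fun ω => 4 * scaledDev h T τ (X ω) μ N (ρ + 1) m k
      + 8 * scaledDev h T τ (X ω) μ N ρ m k + 8) P := fun m k =>
    (hi1 m k).add (integrable_const 8)
  unfold commBound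
  rw [integral_const_mul,
    integral_finsetSum _ fun m _ => integrable_finsetSum _ fun k _ => hi2 m k]
  calc M * ∑ m, ∫ ω, ∑ k, (4 * scaledDev h T τ (X ω) μ N (ρ + 1) m k
        + 8 * scaledDev h T τ (X ω) μ N ρ m k + 8) ∂P
      ≤ M * ∑ _m : Fin M, ∑ _k : Fin K, (12 * thirdMoment + 20) := by
        refine mul_le_mul_of_nonneg_left (Finset.sum_le_sum fun m _ => ?_) (Nat.cast_nonneg _)
        rw [integral_finsetSum _ fun k _ => hi2 m k]
        refine Finset.sum_le_sum fun k _ => ?_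
        rw [integral_add (hi1 m k) (integrable_const _),
          integral_add ((hi (ρ + 1) m k).const_mul 4) ((hi ρ m k).const_mul 8),
          integral_const_mul, integral_const_mul]
        have e1 := integral_scaledDev_le h T τ hX hind hμ N (ρ + 1) m k
        have e2 := integral_scaledDev_le h T τ hX hind hμ N ρ m k
        simp only [integral_const, probReal_univ, smul_eq_mul, one_mul]
        linarith
    _ = (M : ℝ) ^ 2 * K * (12 * thirdMoment + 20) := by simp; ring

end Expectations

/-! ### The number of epochs when all estimates are good -/

section Horizon

open MeasureTheory ProbabilityTheory

theorem sum_if_le_le (N r : ℕ) (a : ℕ → ℝ) (ha : ∀ ρ, 0 ≤ a ρ) :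
    ∑ ρ ∈ Finset.range N, (if ρ ≤ r then a ρ else 0) ≤ ∑ ρ ∈ Finset.range (r + 1), a ρ := by
  rw [← Finset.sum_filter]
  refine Finset.sum_le_sum_of_subset_of_nonneg (fun ρ hρ => ?_) fun ρ _ _ => ha ρ
  exact Finset.mem_range.mpr (Nat.lt_succ_of_le (Finset.mem_filter.mp hρ).2)

/-- Telescoping: each term is at most 2(√(n+1) - √n). -/
theorem sum_one_div_sqrt_le (n : ℕ) :
    ∑ ρ ∈ Finset.range n, 1 / √((ρ + 1 : ℕ) : ℝ) ≤ 2 * √(n : ℝ) := by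
  induction n with
  | zero => simp
  | succ n ih =>
    rw [Finset.sum_range_succ]
    refine (add_le_add ih le_rfl).trans ?_
    have h1 : 0 < √((n + 1 : ℕ) : ℝ) := Real.sqrt_pos.mpr (by positivity)
    have h2 : √(n : ℝ) * √(n : ℝ) = n := Real.mul_self_sqrt (Nat.cast_nonneg _)
    have h3 : √((n + 1 : ℕ) : ℝ) * √((n + 1 : ℕ) : ℝ) = n + 1 := by
      rw [Real.mul_self_sqrt (Nat.cast_nonneg _)]; push_cast; ring
    have h4 : 1 / √((n + 1 : ℕ) : ℝ) ≤ 2 * (√((n + 1 : ℕ) : ℝ) - √(n : ℝ)) := by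
      rw [div_le_iff₀ h1]
      nlinarith [sq_nonneg (√((n + 1 : ℕ) : ℝ) - √(n : ℝ))]
    linarith

variable {M K : ℕ} {h : M < K} {T τ : ℕ} {μ : Fin M → Fin K → ℝ} {Gstar : PullGraph M K}

/-- The order of the number of epochs: `M² log (T √(2 M)) / Δ²`. -/
noncomputable def epochScale (M T : ℕ) (Δ : ℝ) : ℝ := (M : ℝ) ^ 2 * logTerm M T / Δ ^ 2

/-- The epoch in which exploration ends if all estimates are good. -/
noncomputable def lastEpoch (M T : ℕ) (Δ : ℝ) : ℕ := ⌈64 * epochScale M T Δ⌉₊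

theorem sqrt_epochScale {M T : ℕ} (hM : 1 ≤ M) (hT : 1 ≤ T) {Δ : ℝ} (hΔ : 0 < Δ) :
    √(epochScale M T Δ) = M * √(logTerm M T) / Δ := by
  have hL := quarter_le_logTerm hM hT
  rw [epochScale, Real.sqrt_div (by positivity), Real.sqrt_mul (by positivity),
    Real.sqrt_sq (by positivity), Real.sqrt_sq hΔ.le]

section Scale

variable (hM : 1 ≤ M) (hT : 1 ≤ T) {Δ : ℝ} (hΔ : 0 < Δ) (hΔ1 : Δ ≤ 1)
include hM hT hΔ hΔ1

theorem quarter_le_epochScale : 1 / 4 ≤ epochScale M T Δ := by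
  have hM' : (1 : ℝ) ≤ (M : ℝ) ^ 2 := one_le_pow₀ (by exact_mod_cast hM)
  have hL := quarter_le_logTerm hM hT
  rw [epochScale, le_div_iff₀ (by positivity)]
  have : Δ ^ 2 ≤ 1 := pow_le_one₀ hΔ.le hΔ1
  nlinarith

theorem lastEpoch_add_one_le : (lastEpoch M T Δ : ℝ) + 1 ≤ 72 * epochScale M T Δ := by
  have hQ := quarter_le_epochScale hM hT hΔ hΔ1
  have := Nat.ceil_lt_add_one (by linarith : 0 ≤ 64 * epochScale M T Δ)
  unfold lastEpoch
  linarith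

theorem one_le_lastEpoch : 1 ≤ lastEpoch M T Δ :=
  Nat.one_le_ceil_iff.mpr (by linarith [quarter_le_epochScale hM hT hΔ hΔ1])

theorem lastEpoch_radius_le : 8 * M * (√(logTerm M T) / √(lastEpoch M T Δ)) ≤ Δ := by
  have hpos : 0 < √(lastEpoch M T Δ : ℝ) :=
    Real.sqrt_pos.mpr (by exact_mod_cast one_le_lastEpoch hM hT hΔ hΔ1)
  have h1 : √(64 * epochScale M T Δ) ≤ √(lastEpoch M T Δ : ℝ) :=
    Real.sqrt_le_sqrt (Nat.le_ceil _)
  rw [Real.sqrt_mul (by norm_num), sqrt_epochScale hM hT hΔ,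
    show (64 : ℝ) = 8 ^ 2 by norm_num, Real.sqrt_sq (by norm_num), ← mul_div_assoc,
    div_le_iff₀ hΔ] at h1
  rw [← mul_div_assoc, div_le_iff₀ hpos]
  linarith

theorem mul_sqrt_logTerm_mul_sqrt_lastEpoch_le :
    M * √(logTerm M T) * √((lastEpoch M T Δ + 1 : ℕ) : ℝ) ≤ 9 * epochScale M T Δ := by
  have hL := quarter_le_logTerm hM hT
  have hQ := quarter_le_epochScale hM hT hΔ hΔ1
  -- The bound 72 is enlarged to the square 81.
  have h1 : √((lastEpoch M T Δ + 1 : ℕ) : ℝ) ≤ 9 * √(epochScale M T Δ) := by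
    rw [show (9 : ℝ) = √(81 : ℝ) by rw [show (81 : ℝ) = 9 ^ 2 by norm_num]; simp,
      ← Real.sqrt_mul (by norm_num)]
    refine Real.sqrt_le_sqrt ?_
    have := lastEpoch_add_one_le hM hT hΔ hΔ1
    push_cast
    linarith
  have h2 : M * √(logTerm M T) ≤ √(epochScale M T Δ) := by
    rw [sqrt_epochScale hM hT hΔ, le_div_iff₀ hΔ]
    exact mul_le_of_le_one_right (by positivity) hΔ1
  have h3 : √(epochScale M T Δ) * √(epochScale M T Δ) = epochScale M T Δ :=
    Real.mul_self_sqrt (by linarith)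
  calc M * √(logTerm M T) * √((lastEpoch M T Δ + 1 : ℕ) : ℝ)
      ≤ √(epochScale M T Δ) * (9 * √(epochScale M T Δ)) := by gcongr
    _ = 9 * epochScale M T Δ := by linear_combination 9 * h3

end Scale

theorem epoch_le_lastEpoch (hM : 1 ≤ M) (hT : 1 ≤ T) (hinj : Function.Injective Gstar)
    (hΔ : 0 < minGap μ Gstar) (hΔ1 : minGap μ Gstar ≤ 1) {x : RewardTable M K} {n N : ℕ}
    (hn : n ≤ N) (hgood : ¬ Deviates h T τ μ N (Finset.Icc 1 N) (fun _ => √(logTerm M T)) x)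
    (hp : (stateAt h T τ x n).phase ≠ .exploit) :
    (stateAt h T τ x n).epoch ≤ lastEpoch M T (minGap μ Gstar) := by
  have h1 := one_le_lastEpoch hM hT hΔ hΔ1
  by_cases hN : lastEpoch M T (minGap μ Gstar) ≤ N
  · refine epoch_le_of_ne_exploit hM hT hinj hn h1 (lastEpoch_radius_le hM hT hΔ hΔ1)
      (fun m k => ?_) hp
    by_contra hc
    exact hgood ⟨_, Finset.mem_Icc.mpr ⟨h1, hN⟩, m, k, not_le.mp hc⟩
  · have := (State.epoch_le_blocks _).trans (blocks_le h T τ x n)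
    omega

variable {Ω : Type*} [MeasurableSpace Ω] {P : Measure Ω} [IsProbabilityMeasure P]
  {X : Ω → RewardTable M K} (hX : ∀ t m k, Measurable fun ω => X ω t m k)
  (hind : iIndepFun (fun (t : ℕ) (ω : Ω) => X ω t) P)
  (hμ : ∀ t m k, P.real {ω | X ω t m k = true} = μ m k)

include hX hind hμ in
-- The choice of η gives exp(-2L) = 1/(2MT²), so the union bound over at most T epochs and MK edges
-- is K/T. The worst case total MT then costs MK.
theorem mul_prob_deviates_le (hM : 1 ≤ M) (hT : 1 ≤ T) {N : ℕ} (hN : N ≤ T) :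
    (M * T : ℝ) * P.real {ω | Deviates h T τ μ N (Finset.Icc 1 N)
      (fun _ => √(logTerm M T)) (X ω)} ≤ M * K := by
  have hL := quarter_le_logTerm hM hT
  have hM' : (0 : ℝ) < M := by exact_mod_cast hM
  have hT' : (0 : ℝ) < T := by exact_mod_cast hT
  have h1 := prob_deviates_le (h := h) (T := T) (τ := τ) hX hind hμ N (Finset.Icc 1 N)
    (fun _ => √(logTerm M T)) (fun _ => Real.sqrt_nonneg _)
  simp only [Real.sq_sqrt (by linarith : 0 ≤ logTerm M T)] at h1
  rw [exp_neg_two_mul_logTerm hM hT, Finset.sum_const, Nat.card_Icc, Nat.add_sub_cancel,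
    nsmul_eq_mul] at h1
  calc (M * T : ℝ) * P.real _ ≤ M * T * (N * (M * K * (2 * (1 / (2 * M * (T : ℝ) ^ 2))))) := by
        gcongr
    _ ≤ M * T * (T * (M * K * (2 * (1 / (2 * M * (T : ℝ) ^ 2))))) := by gcongr
    _ = M * K := by field_simp

end Horizon

/-! ### The three bounds -/

section Regret

open MeasureTheory ProbabilityTheory

variable {M K : ℕ} {h : M < K} {T τ : ℕ} {μ : Fin M → Fin K → ℝ} {Gstar : PullGraph M K}

theorem total_le_mul {f : State M K → ℝ} {B : ℝ} (hB : 0 ≤ B) (hf : ∀ s, f s ≤ B)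
    (x : RewardTable M K) : total h T τ f x ≤ B * T := by
  calc total h T τ f x ≤ ∑ _n ∈ Finset.range (T - τ), B := Finset.sum_le_sum fun n _ => hf _
    _ = B * ((T - τ : ℕ) : ℝ) := by simp [mul_comm]
    _ ≤ B * T := by gcongr; exact Nat.sub_le T τ

open Classical in
theorem hintQueries_eq (s : State M K) : hintQueries s = if s.IsExplore then (M : ℝ) else 0 := by
  unfold hintQueries State.IsExplore
  split
  · rename_i j hp
    rw [if_pos ⟨j, hp⟩]
  · rename_i hp
    rw [if_neg (not_exists.mpr hp)]

theorem total_hintQueries_le (hM : 1 ≤ M) (hT : 1 ≤ T) (hinj : Function.Injective Gstar)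
    (hΔ : 0 < minGap μ Gstar) (hΔ1 : minGap μ Gstar ≤ 1) {x : RewardTable M K}
    (hgood : ¬ Deviates h T τ μ (T - τ) (Finset.Icc 1 (T - τ)) (fun _ => √(logTerm M T)) x) :
    total h T τ hintQueries x ≤ M * K * (lastEpoch M T (minGap μ Gstar) + 1) := by
  classical
  set r := lastEpoch M T (minGap μ Gstar)
  calc total h T τ hintQueries x
      ≤ ∑ n ∈ Finset.range (T - τ), (if (stateAt h T τ x n).IsExplore then
          (if (stateAt h T τ x n).epoch ≤ r then (M : ℝ) else 0) else 0) := by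
        refine Finset.sum_le_sum fun n hn => ?_
        rw [hintQueries_eq]
        split_ifs with h1 h2
        · exact le_rfl
        · obtain ⟨j, hj⟩ := h1
          exact absurd (epoch_le_lastEpoch hM hT hinj hΔ hΔ1 (Finset.mem_range.mp hn).le hgood
            (by rw [hj]; nofun)) h2
        · exact le_rfl
    _ ≤ ∑ ρ ∈ Finset.range (T - τ), K * (if ρ ≤ r then (M : ℝ) else 0) :=
        sum_explore_le h T τ x (T - τ) (fun ρ => if ρ ≤ r then (M : ℝ) else 0)
          fun ρ => by split_ifs <;> simp
    _ = ∑ ρ ∈ Finset.range (T - τ), (if ρ ≤ r then (K * M : ℝ) else 0) :=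
        Finset.sum_congr rfl fun ρ _ => by split_ifs <;> simp
    _ ≤ ∑ _ρ ∈ Finset.range (r + 1), (K * M : ℝ) :=
        sum_if_le_le _ _ _ fun _ => by positivity
    _ = M * K * (r + 1) := by simp; ring

theorem comLoss_le (h0 : ∀ m k, 0 ≤ μ m k) (h1 : ∀ m k, μ m k ≤ 1) (s : State M K) :
    comLoss h μ Gstar s ≤ M := by
  unfold comLoss
  split
  · exact loss_le h0 h1 s
  · exact Nat.cast_nonneg M

theorem expLoss_le (h0 : ∀ m k, 0 ≤ μ m k) (h1 : ∀ m k, μ m k ≤ 1) (s : State M K) :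
    expLoss h μ Gstar s ≤ M := by
  unfold expLoss
  split
  · exact Nat.cast_nonneg M
  · exact loss_le h0 h1 s

/-- A bound for the loss of a communication round in an epoch with good estimates. -/
noncomputable def commLossBound (M T : ℕ) (ρ : ℕ) : ℝ :=
  2 + 5 * M * √(logTerm M T) * (1 / √((ρ + 1 : ℕ) : ℝ))

theorem commLossBound_nonneg (M T : ℕ) (ρ : ℕ) : 0 ≤ commLossBound M T ρ := by
  unfold commLossBound
  positivity

theorem loss_le_commLossBound (hM : 1 ≤ M) (hT : 1 ≤ T) (h0 : ∀ m k, 0 ≤ μ m k)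
    (h1 : ∀ m k, μ m k ≤ 1) (hinj : Function.Injective Gstar) {x : RewardTable M K} {n N : ℕ}
    (hn : n ≤ N) (hgood : ¬ Deviates h T τ μ N (Finset.Icc 1 N) (fun _ => √(logTerm M T)) x) :
    loss h μ Gstar (stateAt h T τ x n) ≤ commLossBound M T (stateAt h T τ x n).epoch := by
  have hl := half_le_sqrt_logTerm hM hT
  have hM' : (0 : ℝ) < M := by exact_mod_cast hM
  refine (loss_le_add_two h0 h1 _).trans ?_
  rw [commLossBound, add_comm]
  refine add_le_add le_rfl ?_
  rcases Nat.eq_zero_or_pos (stateAt h T τ x n).epoch with he | he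
  · rw [he]
    have := utility_nonneg h0 ((stateAt h T τ x n).matching h)
    have := utility_le_card h1 Gstar
    simp only [zero_add, Nat.cast_one, Real.sqrt_one, div_one, mul_one]
    nlinarith
  · have hle : (stateAt h T τ x n).epoch ≤ N :=
      ((State.epoch_le_blocks _).trans (blocks_le h T τ x n)).trans hn
    set ρ := (stateAt h T τ x n).epoch with hρ
    have hsq : 0 < √(ρ : ℝ) := Real.sqrt_pos.mpr (by exact_mod_cast he)
    have hsq1 : 0 < √((ρ + 1 : ℕ) : ℝ) := Real.sqrt_pos.mpr (by positivity)
    have h2 := utility_sub_matching_le (μ := μ) hinj hn he (a := √(logTerm M T)) fun m k => by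
      by_contra hc
      exact hgood ⟨_, Finset.mem_Icc.mpr ⟨he, hle⟩, m, k, not_le.mp hc⟩
    rw [← hρ] at h2
    -- Any constant above √2 would do; 5/3 turns the factor 3 into the 5 of `commLossBound`.
    have h3 : √((ρ + 1 : ℕ) : ℝ) ≤ 5 / 3 * √(ρ : ℝ) := by
      rw [show (5 / 3 : ℝ) = √((5 / 3 : ℝ) ^ 2) by rw [Real.sqrt_sq (by norm_num)],
        ← Real.sqrt_mul (by norm_num)]
      refine Real.sqrt_le_sqrt ?_
      have : (1 : ℝ) ≤ ρ := by exact_mod_cast he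
      push_cast
      linarith
    calc _ ≤ M * ((2 * √(logTerm M T) + 1 / 2) / √(ρ : ℝ)) := h2
      _ ≤ M * (3 * √(logTerm M T) / √(ρ : ℝ)) := by gcongr; linarith
      _ = 5 * M * √(logTerm M T) * (1 / (5 / 3 * √(ρ : ℝ))) := by field_simp
      _ ≤ 5 * M * √(logTerm M T) * (1 / √((ρ + 1 : ℕ) : ℝ)) := by gcongr

/-- On the good event the loss bound per round depends on the epoch only. The one random factor is
the length of the phase, so no product of dependent variables has to be integrated. -/
theorem total_comLoss_le (hM : 1 ≤ M) (hT : 1 ≤ T) (h0 : ∀ m k, 0 ≤ μ m k)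
    (h1 : ∀ m k, μ m k ≤ 1) (hinj : Function.Injective Gstar)
    (hΔ : 0 < minGap μ Gstar) (hΔ1 : minGap μ Gstar ≤ 1) {x : RewardTable M K}
    (hgood : ¬ Deviates h T τ μ (T - τ) (Finset.Icc 1 (T - τ)) (fun _ => √(logTerm M T)) x) :
    total h T τ (comLoss h μ Gstar) x
      ≤ ∑ ρ ∈ Finset.range (lastEpoch M T (minGap μ Gstar) + 1),
        commBound h T τ x μ (T - τ) ρ * commLossBound M T ρ := by
  classical
  set r := lastEpoch M T (minGap μ Gstar)
  calc total h T τ (comLoss h μ Gstar) x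
      ≤ ∑ n ∈ Finset.range (T - τ), (if (stateAt h T τ x n).IsCommunicate then
          (if (stateAt h T τ x n).epoch ≤ r then commLossBound M T (stateAt h T τ x n).epoch
            else 0) else 0) := by
        refine Finset.sum_le_sum fun n hn => ?_
        have hn := (Finset.mem_range.mp hn).le
        unfold comLoss
        split
        · rename_i q hq
          rw [if_pos ⟨q, hq⟩, if_pos (epoch_le_lastEpoch hM hT hinj hΔ hΔ1 hn hgood
            (by rw [hq]; nofun))]
          exact loss_le_commLossBound hM hT h0 h1 hinj hn hgood
        · split_ifs <;> simp [commLossBound_nonneg]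
    _ ≤ ∑ ρ ∈ Finset.range (T - τ), commBound h T τ x μ (T - τ) ρ
          * (if ρ ≤ r then commLossBound M T ρ else 0) :=
        sum_communicate_le h T τ x h0 h1 (T - τ)
          (fun ρ => if ρ ≤ r then commLossBound M T ρ else 0)
          fun ρ => by split_ifs <;> simp [commLossBound_nonneg]
    _ = ∑ ρ ∈ Finset.range (T - τ), (if ρ ≤ r then commBound h T τ x μ (T - τ) ρ
          * commLossBound M T ρ else 0) :=
        Finset.sum_congr rfl fun ρ _ => by split_ifs <;> simp
    _ ≤ _ := sum_if_le_le _ _ _ fun ρ =>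
        mul_nonneg (commBound_nonneg μ _ ρ) (commLossBound_nonneg M T ρ)

/-- The constant is 234 = 2·72 + 5·2·9. -/
theorem sum_commLossBound_le (hM : 1 ≤ M) (hT : 1 ≤ T) {Δ : ℝ} (hΔ : 0 < Δ) (hΔ1 : Δ ≤ 1) :
    ∑ ρ ∈ Finset.range (lastEpoch M T Δ + 1), commLossBound M T ρ ≤ 234 * epochScale M T Δ := by
  have e1 := sum_one_div_sqrt_le (lastEpoch M T Δ + 1)
  have e2 := lastEpoch_add_one_le hM hT hΔ hΔ1
  have e3 := mul_sqrt_logTerm_mul_sqrt_lastEpoch_le hM hT hΔ hΔ1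
  have e4 := mul_le_mul_of_nonneg_left e1 (by positivity : 0 ≤ 5 * (M : ℝ) * √(logTerm M T))
  simp only [commLossBound]
  rw [Finset.sum_add_distrib, ← Finset.mul_sum, Finset.sum_const, Finset.card_range,
    nsmul_eq_mul]
  push_cast at e1 e2 e3 e4 ⊢
  linarith

/-- A bound for the exploration loss, in terms of the estimation errors. -/
noncomputable def exploreBound (h : M < K) (T τ : ℕ) (μ : Fin M → Fin K → ℝ) (Δ : ℝ)
    (x : RewardTable M K) (N ρ : ℕ) : ℝ :=
  (if ρ = 0 then (M : ℝ) else 0)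
    + 18 * (M : ℝ) ^ 2 / Δ ^ 2 * (cubeSum h T τ x μ N ρ * (1 / √(ρ : ℝ) ^ 3))

theorem exploreBound_nonneg (μ : Fin M → Fin K → ℝ) (Δ : ℝ) (x : RewardTable M K) (N ρ : ℕ) :
    0 ≤ exploreBound h T τ μ Δ x N ρ := by
  have := cubeSum_nonneg (h := h) (T := T) (τ := τ) (x := x) (μ := μ) N ρ
  unfold exploreBound
  split_ifs <;> positivity

theorem exploreBound_dependsOn (μ : Fin M → Fin K → ℝ) (Δ : ℝ) (N ρ : ℕ) :
    DependsOn (fun x : RewardTable M K => exploreBound h T τ μ Δ x N ρ) (Set.Iio (τ + N)) := by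
  intro x y hxy
  have : cubeSum h T τ x μ N ρ = cubeSum h T τ y μ N ρ := cubeSum_dependsOn μ N ρ hxy
  simp only [exploreBound, this]

theorem loss_le_exploreBound (h0 : ∀ m k, 0 ≤ μ m k) (h1 : ∀ m k, μ m k ≤ 1)
    (hinj : Function.Injective Gstar) (hΔ : 0 < minGap μ Gstar) {x : RewardTable M K} {n N : ℕ}
    (hn : n ≤ N) (hp : (stateAt h T τ x n).IsExplore) :
    loss h μ Gstar (stateAt h T τ x n)
      ≤ exploreBound h T τ μ (minGap μ Gstar) x N (stateAt h T τ x n).epoch := by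
  rcases Nat.eq_zero_or_pos (stateAt h T τ x n).epoch with he | he
  · rw [he, exploreBound, if_pos rfl]
    simpa using loss_le h0 h1 (stateAt h T τ x n)
  · obtain ⟨j, hj⟩ := hp
    rw [exploreBound, if_neg he.ne', zero_add, loss,
      State.pulls_of_ne_communicate h fun q => by rw [hj]; nofun]
    exact utility_sub_matching_le_cube hinj hΔ hn he

theorem total_expLoss_le (h0 : ∀ m k, 0 ≤ μ m k) (h1 : ∀ m k, μ m k ≤ 1)
    (hinj : Function.Injective Gstar) (hΔ : 0 < minGap μ Gstar) {x : RewardTable M K}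
    (hexploit : ∀ n ≤ T - τ, (stateAt h T τ x n).phase = .exploit →
      (stateAt h T τ x n).matching h = Gstar) :
    total h T τ (expLoss h μ Gstar) x
      ≤ ∑ ρ ∈ Finset.range (T - τ), K * exploreBound h T τ μ (minGap μ Gstar) x (T - τ) ρ := by
  classical
  refine le_trans (Finset.sum_le_sum fun n hn => ?_) (sum_explore_le h T τ x (T - τ)
    (exploreBound h T τ μ (minGap μ Gstar) x (T - τ)) (exploreBound_nonneg μ _ x _))
  have hn := (Finset.mem_range.mp hn).le
  have hnn := exploreBound_nonneg (h := h) (T := T) (τ := τ) μ (minGap μ Gstar) x (T - τ)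
    (stateAt h T τ x n).epoch
  by_cases hp : (stateAt h T τ x n).IsExplore
  · rw [if_pos hp]
    unfold expLoss
    split
    · exact hnn
    · exact loss_le_exploreBound h0 h1 hinj hΔ hn hp
  · rw [if_neg hp]
    unfold expLoss
    split
    · exact le_rfl
    · rename_i hc
      have hpe : (stateAt h T τ x n).phase = .exploit := by
        cases hq : (stateAt h T τ x n).phase with
        | explore j => exact absurd ⟨j, hq⟩ hp
        | communicate q => exact absurd hq (hc q)
        | exploit => rfl
      rw [loss, State.pulls_of_ne_communicate h hc, hexploit n hn hpe, sub_self]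

/-- The sum `∑ ρ ^ (-3/2)`. -/
noncomputable def zetaThreeHalves : ℝ := ∑' ρ : ℕ, 1 / √(ρ : ℝ) ^ 3

theorem summable_one_div_sqrt_pow_three : Summable fun ρ : ℕ => 1 / √(ρ : ℝ) ^ 3 := by
  have := Real.summable_one_div_nat_rpow.mpr (by norm_num : (1 : ℝ) < 3 / 2)
  refine this.congr fun ρ => ?_
  rw [Real.sqrt_eq_rpow, ← Real.rpow_natCast, ← Real.rpow_mul (Nat.cast_nonneg _)]
  norm_num

theorem zetaThreeHalves_nonneg : 0 ≤ zetaThreeHalves := tsum_nonneg fun ρ => by positivity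

variable {Ω : Type*} [MeasurableSpace Ω] {P : Measure Ω} [IsProbabilityMeasure P]
  {X : Ω → RewardTable M K} (hX : ∀ t m k, Measurable fun ω => X ω t m k)
  (hind : iIndepFun (fun (t : ℕ) (ω : Ω) => X ω t) P)
  (hμ : ∀ t m k, P.real {ω | X ω t m k = true} = μ m k)

include hX hind hμ in
theorem integral_sum_exploreBound_le {Δ : ℝ} (N : ℕ) :
    ∫ ω, ∑ ρ ∈ Finset.range N, K * exploreBound h T τ μ Δ (X ω) N ρ ∂P
      ≤ K * M + 18 * (thirdMoment + 1) * zetaThreeHalves * ((M : ℝ) ^ 3 * (K : ℝ) ^ 2 / Δ ^ 2) := by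
  have hi := fun ρ => integrable_of_dependsOn (P := P) hX
    (exploreBound_dependsOn (h := h) (T := T) (τ := τ) μ Δ N ρ)
  have hic := fun ρ => integrable_of_dependsOn (P := P) hX
    (cubeSum_dependsOn (h := h) (T := T) (τ := τ) μ N ρ)
  have hterm : ∀ ρ, ∫ ω, exploreBound h T τ μ Δ (X ω) N ρ ∂P ≤ (if ρ = 0 then (M : ℝ) else 0)
      + 18 * (M : ℝ) ^ 2 / Δ ^ 2 * (M * K * (thirdMoment + 1)) * (1 / √(ρ : ℝ) ^ 3) := by
    intro ρ
    unfold exploreBound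
    rw [integral_add (integrable_const _) (((hic ρ).mul_const _).const_mul _),
      integral_const_mul, integral_mul_const, integral_const, probReal_univ, one_smul,
      mul_assoc (18 * (M : ℝ) ^ 2 / Δ ^ 2)]
    have := integral_cubeSum_le (h := h) (T := T) (τ := τ) hX hind hμ N ρ
    gcongr
  rw [integral_finsetSum _ fun ρ _ => (hi ρ).const_mul _]
  calc ∑ ρ ∈ Finset.range N, ∫ ω, K * exploreBound h T τ μ Δ (X ω) N ρ ∂P
      ≤ ∑ ρ ∈ Finset.range N, (K * (if ρ = 0 then (M : ℝ) else 0)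
        + K * (18 * (M : ℝ) ^ 2 / Δ ^ 2 * (M * K * (thirdMoment + 1))) * (1 / √(ρ : ℝ) ^ 3)) := by
        refine Finset.sum_le_sum fun ρ _ => ?_
        rw [integral_const_mul, mul_assoc, ← mul_add]
        exact mul_le_mul_of_nonneg_left (hterm ρ) (Nat.cast_nonneg K)
    _ ≤ K * M + K * (18 * (M : ℝ) ^ 2 / Δ ^ 2 * (M * K * (thirdMoment + 1)))
          * zetaThreeHalves := by
        rw [Finset.sum_add_distrib, ← Finset.mul_sum, ← Finset.mul_sum]
        have e1 : ∑ ρ ∈ Finset.range N, (if ρ = 0 then (M : ℝ) else 0) ≤ M := by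
          rw [Finset.sum_ite_eq' (Finset.range N) 0 fun _ => (M : ℝ)]
          split_ifs <;> simp
        have e2 : ∑ ρ ∈ Finset.range N, 1 / √(ρ : ℝ) ^ 3 ≤ zetaThreeHalves :=
          summable_one_div_sqrt_pow_three.sum_le_tsum _ fun ρ _ => by positivity
        have := thirdMoment_nonneg
        gcongr
    _ = _ := by ring

include hX hind hμ in
/-- The probability that exploitation uses a suboptimal matching. -/
theorem mul_prob_deviates_radiusFactor_le (hM : 1 ≤ M) (hT : 1 ≤ T) {Δ : ℝ} (hΔ : 0 < Δ)
    {N : ℕ} (hN : N ≤ T) :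
    (M * T : ℝ) * P.real {ω | Deviates h T τ μ N (Finset.Icc 1 N)
      (fun ρ => radiusFactor M T Δ ρ * √(logTerm M T)) (X ω)}
      ≤ 64 * ((M : ℝ) ^ 4 * K / Δ ^ 2) + M * K := by
  have hL := quarter_le_logTerm hM hT
  have hM' : (0 : ℝ) < M := by exact_mod_cast hM
  have hT' : (0 : ℝ) < T := by exact_mod_cast hT
  have h1 := prob_deviates_le (h := h) (T := T) (τ := τ) hX hind hμ N (Finset.Icc 1 N)
    (fun ρ => radiusFactor M T Δ ρ * √(logTerm M T)) (fun ρ => by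
      unfold radiusFactor; split_ifs <;> positivity)
  have hterm : ∀ ρ, M * K * (2 * Real.exp (-(2 * (radiusFactor M T Δ ρ * √(logTerm M T)) ^ 2)))
      ≤ (if √(ρ : ℝ) * Δ < 4 * M * √(logTerm M T) then
          M * K * (2 * Real.exp (-(3 / 2 * logTerm M T))) else 0)
        + M * K * (2 * Real.exp (-(2 * logTerm M T))) := by
    intro ρ
    rw [mul_pow, Real.sq_sqrt (by linarith), radiusFactor]
    -- The smaller radius leaves the exponent 2(7/8)² = 49/32, which exceeds 3/2.
    split_ifs
    · have e1 : Real.exp (-(2 * ((7 / 8) ^ 2 * logTerm M T)))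
          ≤ Real.exp (-(3 / 2 * logTerm M T)) := Real.exp_le_exp.mpr (by linarith)
      have e2 : (0 : ℝ) ≤ M * K * (2 * Real.exp (-(2 * logTerm M T))) := by positivity
      have e3 : M * K * (2 * Real.exp (-(2 * ((7 / 8) ^ 2 * logTerm M T))))
          ≤ M * K * (2 * Real.exp (-(3 / 2 * logTerm M T))) := by gcongr
      linarith
    · simp
  -- The smaller radius is used only for ρ below 16M²L/Δ², a number of epochs not linear in T.
  have hcard : ((((Finset.Icc 1 N).filter fun ρ : ℕ =>
      √(ρ : ℝ) * Δ < 4 * M * √(logTerm M T)).card : ℕ) : ℝ) ≤ 16 * epochScale M T Δ := by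
    have hQ : 0 ≤ 16 * epochScale M T Δ := by unfold epochScale; positivity
    refine le_trans (Nat.cast_le.mpr (Finset.card_le_card (t := Finset.Icc 1
      ⌊16 * epochScale M T Δ⌋₊) fun ρ hρ => ?_)) ?_
    · obtain ⟨h2, h3⟩ := Finset.mem_filter.mp hρ
      refine Finset.mem_Icc.mpr ⟨(Finset.mem_Icc.mp h2).1, Nat.le_floor ?_⟩
      have h4 := pow_le_pow_left₀ (by positivity) h3.le 2
      rw [mul_pow, mul_pow, Real.sq_sqrt (Nat.cast_nonneg _), Real.sq_sqrt (by linarith)] at h4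
      rw [epochScale, mul_div_assoc', le_div_iff₀ (by positivity)]
      linarith
    · rw [Nat.card_Icc, Nat.add_sub_cancel]
      exact Nat.floor_le hQ
  have hsum : P.real {ω | Deviates h T τ μ N (Finset.Icc 1 N)
      (fun ρ => radiusFactor M T Δ ρ * √(logTerm M T)) (X ω)}
      ≤ 16 * epochScale M T Δ * (M * K * (2 * Real.exp (-(3 / 2 * logTerm M T))))
        + T * (M * K * (2 * Real.exp (-(2 * logTerm M T)))) := by
    refine h1.trans ((Finset.sum_le_sum fun ρ _ => hterm ρ).trans ?_)
    rw [Finset.sum_add_distrib, ← Finset.sum_filter, Finset.sum_const, Finset.sum_const,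
      Nat.card_Icc, Nat.add_sub_cancel, nsmul_eq_mul, nsmul_eq_mul]
    gcongr
  -- The factor L comes from the number of early epochs. Half of L in the exponent pays for it, and
  -- exp(-L) ≤ 1/T cancels the horizon, which makes the bound uniform in T.
  have hexp : logTerm M T * Real.exp (-(3 / 2 * logTerm M T)) ≤ 2 / T := by
    have e1 : logTerm M T ≤ 2 * Real.exp (logTerm M T / 2) := by
      linarith [Real.add_one_le_exp (logTerm M T / 2)]
    calc logTerm M T * Real.exp (-(3 / 2 * logTerm M T))
        ≤ 2 * Real.exp (logTerm M T / 2) * Real.exp (-(3 / 2 * logTerm M T)) := by gcongr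
      _ = 2 / Real.exp (logTerm M T) := by
          rw [mul_assoc, ← Real.exp_add, div_eq_mul_inv 2 (Real.exp _), ← Real.exp_neg]
          congr 2
          ring
      _ ≤ 2 / T := by gcongr; exact le_exp_logTerm hM hT
  rw [exp_neg_two_mul_logTerm hM hT] at hsum
  calc (M * T : ℝ) * P.real _
      ≤ M * T * (16 * epochScale M T Δ * (M * K * (2 * Real.exp (-(3 / 2 * logTerm M T))))
        + T * (M * K * (2 * (1 / (2 * M * (T : ℝ) ^ 2))))) := by gcongr
    _ = 32 * ((M : ℝ) ^ 4 * K / Δ ^ 2) * T * (logTerm M T * Real.exp (-(3 / 2 * logTerm M T)))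
        + M * K := by unfold epochScale; field_simp; ring
    _ ≤ 32 * ((M : ℝ) ^ 4 * K / Δ ^ 2) * T * (2 / T) + M * K := by gcongr
    _ = 64 * ((M : ℝ) ^ 4 * K / Δ ^ 2) + M * K := by field_simp; ring

include hX hind hμ in
theorem integral_hintQueries_le (hM : 1 ≤ M) (hT : 1 ≤ T) (hinj : Function.Injective Gstar)
    (hΔ : 0 < minGap μ Gstar) (hΔ1 : minGap μ Gstar ≤ 1) :
    ∫ ω, total h T τ hintQueries (X ω) ∂P
      ≤ 76 * (M * K * epochScale M T (minGap μ Gstar)) := by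
  have hQ := quarter_le_epochScale hM hT hΔ hΔ1
  have hr := lastEpoch_add_one_le hM hT hΔ hΔ1
  have e1 := integral_le_add_of_good (P := P) hX (total_dependsOn h T τ hintQueries)
    (g := fun _ => M * K * (lastEpoch M T (minGap μ Gstar) + 1)) (fun _ _ _ => rfl)
    (deviates_dependsOn (h := h) (T := T) (τ := τ) μ (T - τ) (Finset.Icc 1 (T - τ))
      fun _ => √(logTerm M T)) (fun _ => by positivity)
    (total_le_mul (Nat.cast_nonneg M) fun s => by
      classical
      rw [hintQueries_eq]; split_ifs <;> simp)
    (fun x hx => total_hintQueries_le hM hT hinj hΔ hΔ1 hx)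
  have e2 := mul_prob_deviates_le (h := h) (T := T) (τ := τ) hX hind hμ hM hT (Nat.sub_le T τ)
  rw [integral_const, probReal_univ, one_smul] at e1
  have e3 : (M * K : ℝ) * (lastEpoch M T (minGap μ Gstar) + 1)
      ≤ M * K * (72 * epochScale M T (minGap μ Gstar)) := by gcongr
  have e4 : (M * K : ℝ) * 1 ≤ M * K * (4 * epochScale M T (minGap μ Gstar)) := by
    gcongr; linarith
  linarith

include hX hind hμ in
theorem integral_comLoss_le (hM : 1 ≤ M) (hT : 1 ≤ T) (h0 : ∀ m k, 0 ≤ μ m k)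
    (h1 : ∀ m k, μ m k ≤ 1) (hinj : Function.Injective Gstar)
    (hΔ : 0 < minGap μ Gstar) (hΔ1 : minGap μ Gstar ≤ 1) :
    ∫ ω, total h T τ (comLoss h μ Gstar) (X ω) ∂P
      ≤ ((12 * thirdMoment + 20) * 234 + 4)
        * ((M : ℝ) ^ 2 * K * epochScale M T (minGap μ Gstar)) := by
  have hM1 : (1 : ℝ) ≤ M := by exact_mod_cast hM
  have hQ := quarter_le_epochScale hM hT hΔ hΔ1
  set r := lastEpoch M T (minGap μ Gstar) with hr
  have hgd : DependsOn (fun x : RewardTable M K => ∑ ρ ∈ Finset.range (r + 1),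
      commBound h T τ x μ (T - τ) ρ * commLossBound M T ρ) (Set.Iio (τ + (T - τ))) :=
    fun x y hxy => Finset.sum_congr rfl fun ρ _ =>
      congrArg (· * _) (commBound_dependsOn μ (T - τ) ρ hxy)
  have e1 := integral_le_add_of_good (P := P) hX (total_dependsOn h T τ (comLoss h μ Gstar)) hgd
    (deviates_dependsOn (h := h) (T := T) (τ := τ) μ (T - τ) (Finset.Icc 1 (T - τ))
      fun _ => √(logTerm M T))
    (fun x => Finset.sum_nonneg fun ρ _ =>
      mul_nonneg (commBound_nonneg μ _ ρ) (commLossBound_nonneg M T ρ))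
    (total_le_mul (Nat.cast_nonneg M) fun s => comLoss_le h0 h1 s)
    (fun x hx => total_comLoss_le hM hT h0 h1 hinj hΔ hΔ1 hx)
  have e2 := mul_prob_deviates_le (h := h) (T := T) (τ := τ) hX hind hμ hM hT (Nat.sub_le T τ)
  have hi := fun ρ => integrable_of_dependsOn (P := P) hX
    (commBound_dependsOn (h := h) (T := T) (τ := τ) μ (T - τ) ρ)
  rw [integral_finsetSum _ fun ρ _ => (hi ρ).mul_const _] at e1
  have e3 : ∑ ρ ∈ Finset.range (r + 1),
      ∫ ω, commBound h T τ (X ω) μ (T - τ) ρ * commLossBound M T ρ ∂P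
      ≤ (M : ℝ) ^ 2 * K * (12 * thirdMoment + 20) * (234 * epochScale M T (minGap μ Gstar)) := by
    calc _ ≤ ∑ ρ ∈ Finset.range (r + 1),
          (M : ℝ) ^ 2 * K * (12 * thirdMoment + 20) * commLossBound M T ρ := by
          refine Finset.sum_le_sum fun ρ _ => ?_
          rw [integral_mul_const]
          exact mul_le_mul_of_nonneg_right (integral_commBound_le hX hind hμ (T - τ) ρ)
            (commLossBound_nonneg M T ρ)
      _ ≤ _ := by
          rw [← Finset.mul_sum]
          have := thirdMoment_nonneg
          exact mul_le_mul_of_nonneg_left (sum_commLossBound_le hM hT hΔ hΔ1) (by positivity)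
  have e4 : (M * K : ℝ) * 1 ≤ (M : ℝ) ^ 2 * K * (4 * epochScale M T (minGap μ Gstar)) := by
    have : (M : ℝ) ≤ (M : ℝ) ^ 2 := le_self_pow₀ hM1 two_ne_zero
    gcongr
    linarith
  linarith

include hX hind hμ in
theorem integral_expLoss_le (hM : 1 ≤ M) (hT : 1 ≤ T) (h0 : ∀ m k, 0 ≤ μ m k)
    (h1 : ∀ m k, μ m k ≤ 1) (hopt : IsUniqueOptimal μ Gstar) (hinj : Function.Injective Gstar)
    (hΔ : 0 < minGap μ Gstar) (hΔ1 : minGap μ Gstar ≤ 1) :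
    ∫ ω, total h T τ (expLoss h μ Gstar) (X ω) ∂P
      ≤ (18 * (thirdMoment + 1) * zetaThreeHalves + 66 + Real.exp 4)
        * ((M : ℝ) ^ 3 * (K : ℝ) ^ 2 / minGap μ Gstar ^ 2) := by
  have hM1 : (1 : ℝ) ≤ M := by exact_mod_cast hM
  have hMK : (M : ℝ) ≤ K := by exact_mod_cast h.le
  have hK1 : (1 : ℝ) ≤ K := hM1.trans hMK
  set Δ := minGap μ Gstar with hΔdef
  have hΔ2 : Δ ^ 2 ≤ 1 := pow_le_one₀ hΔ.le hΔ1
  have hΔ2' : 0 < Δ ^ 2 := by positivity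
  have hW1 : (M * K : ℝ) ≤ (M : ℝ) ^ 3 * (K : ℝ) ^ 2 / Δ ^ 2 := by
    rw [le_div_iff₀ hΔ2']
    have : (M : ℝ) ≤ (M : ℝ) ^ 3 := le_self_pow₀ hM1 (by norm_num)
    have : (K : ℝ) ≤ (K : ℝ) ^ 2 := le_self_pow₀ hK1 (by norm_num)
    calc (M * K : ℝ) * Δ ^ 2 ≤ M * K * 1 := by gcongr
      _ = M * K := mul_one _
      _ ≤ _ := by gcongr
  have hW2 : (M : ℝ) ^ 4 * K / Δ ^ 2 ≤ (M : ℝ) ^ 3 * (K : ℝ) ^ 2 / Δ ^ 2 := by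
    refine div_le_div_of_nonneg_right ?_ hΔ2'.le
    calc (M : ℝ) ^ 4 * K = (M : ℝ) ^ 3 * (M * K) := by ring
      _ ≤ (M : ℝ) ^ 3 * (K * K) := by gcongr
      _ = _ := by ring
  have hW0 : 0 ≤ (M : ℝ) ^ 3 * (K : ℝ) ^ 2 / Δ ^ 2 := by positivity
  have hC0 : 0 ≤ 18 * (thirdMoment + 1) * zetaThreeHalves := by
    have := thirdMoment_nonneg
    have := zetaThreeHalves_nonneg
    positivity
  have hB := total_le_mul (h := h) (T := T) (τ := τ) (Nat.cast_nonneg M)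
    fun s => expLoss_le (h := h) (Gstar := Gstar) h0 h1 s
  -- For L < 4 the horizon is at most e⁴, and the trivial bound MT suffices.
  by_cases hL : 4 ≤ logTerm M T
  · have e1 := integral_le_add_of_good (P := P) hX (total_dependsOn h T τ (expLoss h μ Gstar))
      (g := fun x => ∑ ρ ∈ Finset.range (T - τ), K * exploreBound h T τ μ Δ x (T - τ) ρ)
      (fun x y hxy => Finset.sum_congr rfl fun ρ _ =>
        congrArg (_ * ·) (exploreBound_dependsOn μ Δ (T - τ) ρ hxy))
      (deviates_dependsOn (h := h) (T := T) (τ := τ) μ (T - τ) (Finset.Icc 1 (T - τ))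
        fun ρ => radiusFactor M T Δ ρ * √(logTerm M T))
      (fun x => Finset.sum_nonneg fun ρ _ =>
        mul_nonneg (Nat.cast_nonneg K) (exploreBound_nonneg μ Δ x _ ρ))
      hB
      (fun x hx => total_expLoss_le h0 h1 hinj hΔ fun n hn hp =>
        matching_eq_of_exploit hM hT hopt hinj hΔ hL hn (fun ρ hρ m k => by
          by_contra hc
          exact hx ⟨ρ, hρ, m, k, not_le.mp hc⟩) hp)
    have e2 := mul_prob_deviates_radiusFactor_le (h := h) (τ := τ) hX hind hμ hM hT hΔ
      (Nat.sub_le T τ)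
    have e3 := integral_sum_exploreBound_le (h := h) (T := T) (τ := τ) hX hind hμ (Δ := Δ) (T - τ)
    have e4 : 0 ≤ Real.exp 4 * ((M : ℝ) ^ 3 * (K : ℝ) ^ 2 / Δ ^ 2) := by positivity
    linarith
  · have hT4 : (T : ℝ) ≤ Real.exp 4 :=
      (le_exp_logTerm hM hT).trans (Real.exp_le_exp.mpr (not_le.mp hL).le)
    have e1 : ∫ ω, total h T τ (expLoss h μ Gstar) (X ω) ∂P ≤ M * T := by
      have := integral_mono (μ := P)
        (integrable_of_dependsOn hX (total_dependsOn h T τ (expLoss h μ Gstar)))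
        (integrable_const (M * T : ℝ)) fun ω => hB (X ω)
      simpa using this
    calc _ ≤ (M * T : ℝ) := e1
      _ ≤ M * Real.exp 4 := by gcongr
      _ = Real.exp 4 * M := mul_comm _ _
      _ ≤ Real.exp 4 * ((M : ℝ) ^ 3 * (K : ℝ) ^ 2 / Δ ^ 2) := by
          gcongr
          exact (le_mul_of_one_le_right (Nat.cast_nonneg M) hK1).trans hW1
      _ ≤ _ := by
          gcongr
          linarith

end Regret

end HMA2B

/-! ### The theorem, with one constant for all three bounds -/

theorem mainTheorem5 :
    ∃ C : ℝ, 0 < C ∧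
      ∀ (M K T τ : ℕ) (_ : 1 ≤ M) (h : M < K) (_ : 1 ≤ T) (_ : τ ≤ T)
        (μ : Fin M → Fin K → ℝ) (Gstar : HMA2B.PullGraph M K)
        (_ : HMA2B.IsUniqueOptimal μ Gstar)
        {Ω : Type*} [MeasurableSpace Ω] (P : MeasureTheory.Measure Ω)
        [MeasureTheory.IsProbabilityMeasure P]
        (X : Ω → HMA2B.RewardTable M K)
        (_ : ∀ t m k, Measurable fun ω => X ω t m k)
        (_ : ProbabilityTheory.iIndepFun (fun (t : ℕ) (ω : Ω) => X ω t) P)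
        (_ : ∀ t m k, P.real {ω | X ω t m k = true} = μ m k),
        -- exploration regret
        (MeasureTheory.Integrable
            (fun ω => HMA2B.total h T τ (HMA2B.expLoss h μ Gstar) (X ω)) P ∧
          ∫ ω, HMA2B.total h T τ (HMA2B.expLoss h μ Gstar) (X ω) ∂P
            ≤ C * ((M : ℝ) ^ 3 * (K : ℝ) ^ 2 / HMA2B.minGap μ Gstar ^ 2)) ∧
        -- hint complexity
        (MeasureTheory.Integrable
            (fun ω => HMA2B.total h T τ HMA2B.hintQueries (X ω)) P ∧
          ∫ ω, HMA2B.total h T τ HMA2B.hintQueries (X ω) ∂P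
            ≤ C * ((M : ℝ) ^ 3 * (K : ℝ) * Real.log ((T : ℝ) * Real.sqrt (2 * (M : ℝ)))
                / HMA2B.minGap μ Gstar ^ 2)) ∧
        -- communication regret
        (MeasureTheory.Integrable
            (fun ω => HMA2B.total h T τ (HMA2B.comLoss h μ Gstar) (X ω)) P ∧
          ∫ ω, HMA2B.total h T τ (HMA2B.comLoss h μ Gstar) (X ω) ∂P
            ≤ C * ((M : ℝ) ^ 4 * (K : ℝ) * Real.log ((T : ℝ) * Real.sqrt (2 * (M : ℝ)))
                / HMA2B.minGap μ Gstar ^ 2)) := by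
  refine ⟨(18 * (HMA2B.thirdMoment + 1) * HMA2B.zetaThreeHalves + 66 + Real.exp 4)
    + ((12 * HMA2B.thirdMoment + 20) * 234 + 4) + 76, ?_, ?_⟩
  · have := HMA2B.thirdMoment_nonneg
    have := HMA2B.zetaThreeHalves_nonneg
    positivity
  intro M K T τ hM h hT _ μ Gstar hopt Ω _ P _ X hX hind hμ
  have h0 : ∀ m k, 0 ≤ μ m k := fun m k => hμ 0 m k ▸ MeasureTheory.measureReal_nonneg
  have h1 : ∀ m k, μ m k ≤ 1 := fun m k => hμ 0 m k ▸ MeasureTheory.measureReal_le_one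
  have hinj := hopt.injective h h0
  have hΔ := HMA2B.minGap_pos hM h h0 hopt
  have hΔ1 := HMA2B.minGap_le_one hM h h0 h1 hopt
  have hL : 0 ≤ HMA2B.logTerm M T := by linarith [HMA2B.quarter_le_logTerm hM hT]
  have hc3 := HMA2B.thirdMoment_nonneg
  have hcz : 0 ≤ 18 * (HMA2B.thirdMoment + 1) * HMA2B.zetaThreeHalves :=
    mul_nonneg (by positivity) HMA2B.zetaThreeHalves_nonneg
  have he := Real.exp_pos 4
  have hint := fun f => HMA2B.integrable_of_dependsOn (P := P) hX (HMA2B.total_dependsOn h T τ f)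
  refine ⟨⟨hint _, ?_⟩, ⟨hint _, ?_⟩, ⟨hint _, ?_⟩⟩
  · refine (HMA2B.integral_expLoss_le hX hind hμ hM hT h0 h1 hopt hinj hΔ hΔ1).trans ?_
    exact mul_le_mul_of_nonneg_right (by linarith) (by positivity)
  · refine (HMA2B.integral_hintQueries_le hX hind hμ hM hT hinj hΔ hΔ1).trans ?_
    rw [show (M : ℝ) * K * HMA2B.epochScale M T (HMA2B.minGap μ Gstar)
      = (M : ℝ) ^ 3 * K * HMA2B.logTerm M T / HMA2B.minGap μ Gstar ^ 2 by
        unfold HMA2B.epochScale; ring]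
    change _ ≤ _ * ((M : ℝ) ^ 3 * K * HMA2B.logTerm M T / HMA2B.minGap μ Gstar ^ 2)
    exact mul_le_mul_of_nonneg_right (by linarith) (by positivity)
  · refine (HMA2B.integral_comLoss_le hX hind hμ hM hT h0 h1 hinj hΔ hΔ1).trans ?_
    rw [show (M : ℝ) ^ 2 * K * HMA2B.epochScale M T (HMA2B.minGap μ Gstar)
      = (M : ℝ) ^ 4 * K * HMA2B.logTerm M T / HMA2B.minGap μ Gstar ^ 2 by
        unfold HMA2B.epochScale; ring]
    change _ ≤ _ * ((M : ℝ) ^ 4 * K * HMA2B.logTerm M T / HMA2B.minGap μ Gstar ^ 2)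
    exact mul_le_mul_of_nonneg_right (by linarith) (by positivity)
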